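/- Let $M$ be a smooth complete Riemannian manifold with boundary (possibly non-compact; metric $G$, second countable), with Laplace--Beltrami operator $\Delta_G$ (non-positive), Riemannian volume $dV_G$, surface measure $dS_G$ on $\partial M$ and outward unit normal $\nu$. For real-valued $F\in C_0^\infty(\partial M\times(0,\infty))$ let $u^F\in C^\infty(M\times[0,\infty))$ denote the solution of $$(\partial_t^2-\Delta_G)u^F=0\ \text{ in } M\times(0,\infty),\qquad \frac{\partial u^F}{\partial\nu}=F\ \text{ on }\partial M\times(0,\infty),\qquad u^F|_{t=0}=0,\quad \partial_tu^F|_{t=0}=0,$$ and let $\Lambda^{(h)}F=u^F|_{\partial M\times(0,\infty)}$ be the hyperbolic response (Neumann-to-Dirichlet) operator. Then for all $F,H\in C_0^\infty(\partial M\times(0,\infty))$ and all $T>0$, $$\int_M u^F(x,T)\,u^H(x,T)\,dV_G(x)=\frac12\int_L\int_{\partial M}\Big(F(x,t)\,(\Lambda^{(h)}H)(x,s)-(\Lambda^{(h)}F)(x,t)\,H(x,s)\Big)\,dS_G(x)\,dt\,ds,$$ where $$L=\{(s,t):\ 0\le t+s\le 2T,\ t<s,\ t>0,\ s>0\}.$$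 All the integrals converge absolutely: $u^F(\cdot,T)u^H(\cdot,T)$ is integrable over $M$, the boundary integrand is integrable over $\partial M$ for every $(s,t)\in L$, and its integral over $\partial M$ is integrable over $L$. -/

import Mathlib

open Set MeasureTheory Bundle Manifold
open scoped ContDiff Manifold

namespace NeumannWave

noncomputable section

/-- The tangent vector `∂/∂yᵢ` of the chart around `x₀`, at the point with coordinates `y`. -/
def coordVec {m : ℕ} {M : Type*} [TopologicalSpace M]
    [ChartedSpace (EuclideanHalfSpace (m + 1)) M]
    (x₀ : M) (y : EuclideanSpace ℝ (Fin (m + 1))) (i : Fin (m + 1)) :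
    TangentSpace (𝓡∂ (m + 1)) ((extChartAt (𝓡∂ (m + 1)) x₀).symm y) :=
  mfderivWithin 𝓘(ℝ, EuclideanSpace ℝ (Fin (m + 1))) (𝓡∂ (m + 1))
    (extChartAt (𝓡∂ (m + 1)) x₀).symm (range (𝓡∂ (m + 1))) y (EuclideanSpace.single i (1 : ℝ))

/-- The matrix `(gᵢⱼ)` of the Riemannian metric in the chart around `x₀`, as a function of the
coordinates `y`. -/
def gram {m : ℕ} {M : Type*} [TopologicalSpace M]
    [ChartedSpace (EuclideanHalfSpace (m + 1)) M]
    [RiemannianBundle (fun x : M => TangentSpace (𝓡∂ (m + 1)) x)]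
    (x₀ : M) (y : EuclideanSpace ℝ (Fin (m + 1))) : Matrix (Fin (m + 1)) (Fin (m + 1)) ℝ :=
  Matrix.of fun i j => inner ℝ (coordVec x₀ y i) (coordVec x₀ y j)

/-- The partial derivative `∂φ/∂yᵢ` of a function on the half-space (one-sided on the boundary
hyperplane). -/
def pderiv {m : ℕ} (φ : EuclideanSpace ℝ (Fin (m + 1)) → ℝ) (i : Fin (m + 1))
    (y : EuclideanSpace ℝ (Fin (m + 1))) : ℝ :=
  fderivWithin ℝ φ (range (𝓡∂ (m + 1))) y (EuclideanSpace.single i (1 : ℝ))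

/-- The contravariant components `∑ⱼ gⁱʲ ∂f/∂yⱼ` of the Riemannian gradient of `f`, in the chart
around `x₀`. -/
def gradCoord {m : ℕ} {M : Type*} [TopologicalSpace M]
    [ChartedSpace (EuclideanHalfSpace (m + 1)) M]
    [RiemannianBundle (fun x : M => TangentSpace (𝓡∂ (m + 1)) x)]
    (x₀ : M) (f : M → ℝ) (i : Fin (m + 1)) (y : EuclideanSpace ℝ (Fin (m + 1))) : ℝ :=
  ∑ j, (gram x₀ y)⁻¹ i j * pderiv (f ∘ (extChartAt (𝓡∂ (m + 1)) x₀).symm) j y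

/-- The Laplace-Beltrami operator (with non-positive spectrum) in the chart around `x₀`:
`Δ f = (det g)^(-1/2) ∑ᵢ ∂ᵢ ((det g)^(1/2) ∑ⱼ gⁱʲ ∂ⱼ f)`. -/
def laplacian {m : ℕ} {M : Type*} [TopologicalSpace M]
    [ChartedSpace (EuclideanHalfSpace (m + 1)) M]
    [RiemannianBundle (fun x : M => TangentSpace (𝓡∂ (m + 1)) x)]
    (x₀ : M) (f : M → ℝ) (y : EuclideanSpace ℝ (Fin (m + 1))) : ℝ :=
  (Real.sqrt (gram x₀ y).det)⁻¹ *
    ∑ i, pderiv (fun y' => Real.sqrt (gram x₀ y').det * gradCoord x₀ f i y') i y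

/-- The derivative of `f` along the outward unit normal, in the chart around `x₀`, at a boundary
point with coordinates `y`. The manifold lies on the side `y₀ ≥ 0`, so the outward unit normal is
`ν = -∇y₀ / |∇y₀|`, and `df(ν) = -(∑ⱼ g⁰ʲ ∂ⱼ f) / (g⁰⁰)^(1/2)`. -/
def normalDeriv {m : ℕ} {M : Type*} [TopologicalSpace M]
    [ChartedSpace (EuclideanHalfSpace (m + 1)) M]
    [RiemannianBundle (fun x : M => TangentSpace (𝓡∂ (m + 1)) x)]
    (x₀ : M) (f : M → ℝ) (y : EuclideanSpace ℝ (Fin (m + 1))) : ℝ :=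
  -(gradCoord x₀ f 0 y) / Real.sqrt ((gram x₀ y)⁻¹ 0 0)

/-- The Riemannian volume on the domain of the chart around `x₀` (and zero outside):
`(det g)^(1/2) dy`. -/
def chartVolume {m : ℕ} {M : Type*} [TopologicalSpace M] [MeasurableSpace M]
    [ChartedSpace (EuclideanHalfSpace (m + 1)) M]
    [RiemannianBundle (fun x : M => TangentSpace (𝓡∂ (m + 1)) x)] (x₀ : M) : Measure M :=
  Measure.map (extChartAt (𝓡∂ (m + 1)) x₀).symm
    (((volume : Measure (EuclideanSpace ℝ (Fin (m + 1)))).restrict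
      (extChartAt (𝓡∂ (m + 1)) x₀).target).withDensity
        fun y => ENNReal.ofReal (Real.sqrt (gram x₀ y).det))

/-- The Riemannian volume `dV`. Two chart volumes agree on the intersection of their domains, so
the least measure above all of them is the measure that restricts to each of them. -/
def volumeMeasure (m : ℕ) (M : Type*) [TopologicalSpace M] [MeasurableSpace M]
    [ChartedSpace (EuclideanHalfSpace (m + 1)) M]
    [RiemannianBundle (fun x : M => TangentSpace (𝓡∂ (m + 1)) x)] : Measure M :=
  ⨆ x₀ : M, chartVolume (m := m) x₀

/-- The inclusion `z ↦ (0, z)` of the boundary hyperplane of the half-space. -/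
def hyperplane {m : ℕ} (z : EuclideanSpace ℝ (Fin m)) : EuclideanSpace ℝ (Fin (m + 1)) :=
  WithLp.toLp 2 (Fin.cons 0 z.ofLp)

/-- The Riemannian surface measure of the boundary on the domain of the chart around `x₀` (and zero
outside): `(det (gᵢⱼ)_{i,j ≥ 1})^(1/2) dy₁ ⋯ dy_m` on `y₀ = 0`. -/
def chartSurface {m : ℕ} {M : Type*} [TopologicalSpace M] [MeasurableSpace M]
    [ChartedSpace (EuclideanHalfSpace (m + 1)) M]
    [RiemannianBundle (fun x : M => TangentSpace (𝓡∂ (m + 1)) x)] (x₀ : M) : Measure M :=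
  Measure.map (fun z : EuclideanSpace ℝ (Fin m) =>
      (extChartAt (𝓡∂ (m + 1)) x₀).symm (hyperplane z))
    (((volume : Measure (EuclideanSpace ℝ (Fin m))).restrict
      (hyperplane ⁻¹' (extChartAt (𝓡∂ (m + 1)) x₀).target)).withDensity
        fun z => ENNReal.ofReal
          (Real.sqrt ((gram x₀ (hyperplane z)).submatrix Fin.succ Fin.succ).det))

/-- The Riemannian surface measure `dS` of the boundary, as a measure on the manifold that is
carried by the boundary; glued from the charts like `volumeMeasure`. -/
def surfaceMeasure (m : ℕ) (M : Type*) [TopologicalSpace M] [MeasurableSpace M]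
    [ChartedSpace (EuclideanHalfSpace (m + 1)) M]
    [RiemannianBundle (fun x : M => TangentSpace (𝓡∂ (m + 1)) x)] : Measure M :=
  ⨆ x₀ : M, chartSurface (m := m) x₀

/-- `F` is a smooth function with compact support on `∂M × (0, ∞)`. Only the values of `F` at
boundary points matter. Smoothness within the closed submanifold `∂M × ℝ` of `M × ℝ` is smoothness
in the boundary variables and time. -/
structure IsBoundarySource (m : ℕ) {M : Type*} [TopologicalSpace M]
    [ChartedSpace (EuclideanHalfSpace (m + 1)) M] (F : M × ℝ → ℝ) : Prop where
  smooth : ContMDiffOn ((𝓡∂ (m + 1)).prod 𝓘(ℝ, ℝ)) 𝓘(ℝ, ℝ) ∞ F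
    ((𝓡∂ (m + 1)).boundary M ×ˢ univ)
  compactSupport : ∃ K : Set (M × ℝ), IsCompact K ∧
    K ⊆ (𝓡∂ (m + 1)).boundary M ×ˢ Ioi 0 ∧
      ∀ q ∈ (𝓡∂ (m + 1)).boundary M ×ˢ univ, q ∉ K → F q = 0

/-- `u` is a smooth solution on `M × [0, ∞)` of the wave equation `∂ₜ² u = Δ u` with Neumann data
`∂u/∂ν = F` on `∂M × (0, ∞)` and vanishing Cauchy data at time `0`. The equations are required in
the coordinates of every chart `chartAt _ x₀`. -/
structure IsSolution (m : ℕ) {M : Type*} [TopologicalSpace M]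
    [ChartedSpace (EuclideanHalfSpace (m + 1)) M]
    [RiemannianBundle (fun x : M => TangentSpace (𝓡∂ (m + 1)) x)]
    (F u : M × ℝ → ℝ) : Prop where
  smooth : ContMDiffOn ((𝓡∂ (m + 1)).prod 𝓘(ℝ, ℝ)) 𝓘(ℝ, ℝ) ∞ u (univ ×ˢ Ici 0)
  wave : ∀ x₀ x : M, x ∈ (extChartAt (𝓡∂ (m + 1)) x₀).source → ∀ t : ℝ, 0 < t →
    iteratedDeriv 2 (fun τ => u (x, τ)) t =
      laplacian (m := m) x₀ (fun x' => u (x', t)) (extChartAt (𝓡∂ (m + 1)) x₀ x)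
  neumann : ∀ x₀ x : M, x ∈ (extChartAt (𝓡∂ (m + 1)) x₀).source →
    x ∈ (𝓡∂ (m + 1)).boundary M → ∀ t : ℝ, 0 < t →
      normalDeriv (m := m) x₀ (fun x' => u (x', t)) (extChartAt (𝓡∂ (m + 1)) x₀ x) = F (x, t)
  initial_value : ∀ x : M, u (x, 0) = 0
  initial_velocity : ∀ x : M, derivWithin (fun τ => u (x, τ)) (Ici 0) 0 = 0

open Classical in
/-- The hyperbolic response operator `Λ : F ↦ u^F` restricted to `∂M × (0, ∞)`, where `u^F` is the
solution with Neumann data `F` (extended by zero to all of `M × ℝ`, and zero if there is no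
solution). -/
def response (m : ℕ) {M : Type*} [TopologicalSpace M]
    [ChartedSpace (EuclideanHalfSpace (m + 1)) M]
    [RiemannianBundle (fun x : M => TangentSpace (𝓡∂ (m + 1)) x)]
    (F : M × ℝ → ℝ) : M × ℝ → ℝ :=
  if h : ∃ u, IsSolution m F u then
    ((𝓡∂ (m + 1)).boundary M ×ˢ Ioi (0 : ℝ)).indicator h.choose
  else 0

/-- The triangle `L = {(s, t) : 0 ≤ t + s ≤ 2T, t < s, t > 0, s > 0}`. -/
def triangle (T : ℝ) : Set (ℝ × ℝ) :=
  {q | 0 ≤ q.2 + q.1 ∧ q.2 + q.1 ≤ 2 * T ∧ q.2 < q.1 ∧ 0 < q.2 ∧ 0 < q.1}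

/-- The boundary integrand `F(x,t) (ΛH)(x,s) - (ΛF)(x,t) H(x,s)`, at `q = (s, t)`. -/
def boundaryPairing (m : ℕ) {M : Type*} [TopologicalSpace M]
    [ChartedSpace (EuclideanHalfSpace (m + 1)) M]
    [RiemannianBundle (fun x : M => TangentSpace (𝓡∂ (m + 1)) x)]
    (F H : M × ℝ → ℝ) (q : ℝ × ℝ) (x : M) : ℝ :=
  F (x, q.2) * response m H (x, q.1) - response m F (x, q.2) * H (x, q.1)

end

end NeumannWave

/-!
Two facts carry the proof.

For fixed `x`, put `W(s, t) = u^F(x, t) u^H(x, s)`. Since both factors vanish to second order at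
time `0`, d'Alembert's formula for the one-dimensional wave operator (`dalembert_mul`) writes
`W(T, T)` as half the integral over the triangle `L` of
`(∂ₜ² - ∂ₛ²) W = ∂ₜ²u^F(x, t) u^H(x, s) - u^F(x, t) ∂ₛ²u^H(x, s)`.
Integrate over `M`, exchange the integrals, and replace `∂ₜ²` by the Laplacian: for fixed `(s, t)`,
Green's second formula (`green_second`) turns the integral over `M` into the boundary pairing.

This needs the solutions to have compact support in space, uniformly for bounded times, and the
response operator to be determined by the equations. Both follow from finite speed of propagation
(`IsSolution.eq_zero_of_forall_edist_le`). Locally it is an energy estimate in a chart: the energy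
density, weighted by the square of `min (φ - r²) 0` where `φ` is a squared distance and the radius
`r` shrinks at speed `2`, has non-increasing integral (`timeDeriv_eq_zero_of_cone`). The cone used
is wider than the light cone by a fixed factor, so that it suffices to compare the metric with its
value at a point, and the Riemannian distance with the length of coordinate segments. Closed balls
are compact by the Hopf-Rinow theorem (`isCompact_closedEBall`), so finitely many local steps of
uniform length reach any time `T`.

The volume and surface measures are suprema of measures given in charts. These agree on overlaps by
the change of variables formula, so the supremum restricts to each of them
(`volumeMeasure_restrict_source`, `surfaceMeasure_restrict_source`). Green's formula is proved in
charts from the divergence theorem on a box and globalized by a partition of unity; the first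
formula contains only first derivatives of the test function `v`, through the pairing `⟨∇v, ∇f⟩`,
whose independence of the chart is easily checked, and the second follows by symmetry.
-/

namespace NeumannWave

section

open Filter Metric
open scoped ENNReal NNReal Topology

/-! ### Compactness of closed balls -/

/-- In a Riemannian manifold, a point at distance less than `a + b` from `x` is at distance less
than `b` from some point at distance at most `a` from `x`: follow a short path. -/
theorem exists_edist_le_and_edist_lt {E H M : Type*} [NormedAddCommGroup E] [NormedSpace ℝ E]
    [TopologicalSpace H] {I : ModelWithCorners ℝ E H} [PseudoEMetricSpace M] [ChartedSpace H M]
    [RiemannianBundle (fun x : M => TangentSpace I x)] [IsRiemannianManifold I M]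
    {x y : M} {a b : ℝ≥0} (hb : 0 < b) (h : edist x y < a + b) :
    ∃ z, edist x z ≤ a ∧ edist z y < b := by
  rcases le_or_gt (edist x y) a with hxy | hxy
  · exact ⟨y, hxy, by simpa using hb⟩
  rw [IsRiemannianManifold.out (I := I) x y] at h
  obtain ⟨γ, h0, h1, hγ, hlen⟩ := exists_lt_of_riemannianEDist_lt h
  have hcont : ContinuousOn (fun t => edist x (γ t)) (Icc 0 1) :=
    continuous_edist.comp_continuousOn (continuousOn_const.prodMk hγ.continuousOn)
  obtain ⟨t, ht, hta⟩ := intermediate_value_Icc zero_le_one hcont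
    (show (a : ℝ≥0∞) ∈ Icc (edist x (γ 0)) (edist x (γ 1)) by simpa [h0, h1] using hxy.le)
  refine ⟨γ t, hta.le, ?_⟩
  have l1 : edist x (γ t) ≤ pathELength I γ 0 t := by
    rw [IsRiemannianManifold.out (I := I)]
    exact riemannianEDist_le_pathELength (hγ.mono (Icc_subset_Icc le_rfl ht.2)) h0 rfl ht.1
  have l2 : edist (γ t) y ≤ pathELength I γ t 1 := by
    rw [IsRiemannianManifold.out (I := I)]
    exact riemannianEDist_le_pathELength (hγ.mono (Icc_subset_Icc ht.1 le_rfl)) rfl h1 ht.2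
  rw [← pathELength_add ht.1 ht.2] at hlen
  refine l2.trans_lt ?_
  have : (a : ℝ≥0∞) + pathELength I γ t 1 < a + b := by
    refine lt_of_le_of_lt ?_ hlen
    gcongr
    exact hta.symm.le.trans l1
  exact (ENNReal.add_lt_add_iff_left ENNReal.coe_ne_top).1 this

/-- A compact set in a locally compact extended metric space has a uniform compact neighbourhood. -/
theorem exists_isCompact_thickening {X : Type*} [EMetricSpace X] [WeaklyLocallyCompactSpace X]
    {K : Set X} (hK : IsCompact K) :
    ∃ (K' : Set X) (δ : ℝ≥0), IsCompact K' ∧ 0 < δ ∧ ∀ x ∈ K, ∀ y, edist x y < δ → y ∈ K' := by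
  obtain ⟨K', hK', hsub⟩ := exists_compact_superset hK
  obtain ⟨δ, hδ, h⟩ := lebesgue_number_lemma_of_emetric_sUnion (c := {interior K'}) hK
    (by simp) (by simpa using hsub)
  obtain ⟨ε, hε, hεδ⟩ := ENNReal.lt_iff_exists_nnreal_btwn.1 hδ
  refine ⟨K', ε, hK', by exact_mod_cast hε, fun x hx y hxy => ?_⟩
  obtain ⟨t, rfl, ht⟩ := h x hx
  exact interior_subset (ht (by simpa [edist_comm] using hxy.trans hεδ))

/-- The Hopf-Rinow theorem: in a complete locally compact space in which points can be approached
as in `exists_edist_le_and_edist_lt`, closed balls of finite radius are compact. -/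
theorem isCompact_closedEBall {X : Type*} [EMetricSpace X] [CompleteSpace X]
    [WeaklyLocallyCompactSpace X]
    (h : ∀ (x y : X) (a b : ℝ≥0), 0 < b → edist x y < a + b → ∃ z, edist x z ≤ a ∧ edist z y < b)
    (x : X) (r : ℝ≥0) : IsCompact (closedEBall x (r : ℝ≥0∞)) := by
  by_contra hr
  -- the radii of compact balls form an interval; its supremum is attained and can be exceeded
  let S : Set ℝ≥0 := {s | IsCompact (closedEBall x (s : ℝ≥0∞))}
  have hdown : ∀ s ∈ S, ∀ s' ≤ s, s' ∈ S := fun s hs s' hs' =>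
    IsCompact.of_isClosed_subset hs isClosed_closedEBall
      (closedEBall_subset_closedEBall (by exact_mod_cast hs'))
  have hbdd : BddAbove S := ⟨r, fun s hs => by
    by_contra hlt
    exact hr (hdown s hs r (not_le.1 hlt).le)⟩
  have h0 : (0 : ℝ≥0) ∈ S := by
    simp [S]
  have hlt : ∀ s < sSup S, s ∈ S := fun s hs => by
    obtain ⟨s', hs', hss'⟩ := exists_lt_of_lt_csSup ⟨0, h0⟩ hs
    exact hdown s' hs' s hss'.le
  have hmem : sSup S ∈ S := by
    rcases eq_or_ne (sSup S) 0 with hz | hz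
    · rw [hz]; exact h0
    refine isCompact_iff_totallyBounded_isComplete.2 ⟨?_, isClosed_closedEBall.isComplete⟩
    rw [EMetric.totallyBounded_iff]
    intro ε hε
    obtain ⟨δ, hδ, hδε⟩ := ENNReal.lt_iff_exists_nnreal_btwn.1 (ENNReal.half_pos hε.ne')
    have hδ0 : 0 < δ := by exact_mod_cast hδ
    -- the ball of radius `s - η` with `η < δ` is compact, and every point is `δ`-close to it
    set s := sSup S with hs
    have hη : s - min δ s / 2 < s := tsub_lt_self (pos_iff_ne_zero.2 hz)
      (by have := lt_min hδ0 (pos_iff_ne_zero.2 hz); positivity)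
    have hc : IsCompact (closedEBall x ((s - min δ s / 2 : ℝ≥0) : ℝ≥0∞)) := hlt _ hη
    obtain ⟨t, htf, ht⟩ := EMetric.totallyBounded_iff.1 hc.totallyBounded (ε / 2)
      (ENNReal.half_pos hε.ne')
    refine ⟨t, htf, fun y hy => ?_⟩
    have hsum : s < (s - min δ s / 2) + δ := by
      have h1 : min δ s / 2 < δ := by
        refine lt_of_lt_of_le (half_lt_self ?_) (min_le_left _ _)
        exact lt_min hδ0 (pos_iff_ne_zero.2 hz)
      have h2 : min δ s / 2 ≤ s := (half_le_self zero_le).trans (min_le_right _ _)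
      calc s = (s - min δ s / 2) + min δ s / 2 := (tsub_add_cancel_of_le h2).symm
        _ < _ := by gcongr
    obtain ⟨z, hxz, hzy⟩ := h x y (s - min δ s / 2) δ hδ0
      (lt_of_le_of_lt (by simpa [edist_comm] using hy) (by exact_mod_cast hsum))
    have hz' := ht (show z ∈ closedEBall x _ by simpa [edist_comm] using hxz)
    simp only [mem_iUnion, exists_prop] at hz' ⊢
    obtain ⟨w, hw, hzw⟩ := hz'
    refine ⟨w, hw, ?_⟩
    rw [mem_eball] at hzw ⊢
    calc edist y w ≤ edist y z + edist z w := edist_triangle _ _ _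
      _ < ε / 2 + ε / 2 := ENNReal.add_lt_add ((edist_comm y z ▸ hzy).trans hδε) hzw
      _ = ε := ENNReal.add_halves _
  -- the compact ball of radius `sSup S` has a compact thickening, which contains a larger ball
  obtain ⟨K', δ, hK', hδ, hsub⟩ := exists_isCompact_thickening hmem
  have : sSup S + δ / 2 ∈ S := by
    refine hK'.of_isClosed_subset isClosed_closedEBall fun y hy => ?_
    have hlt : ((sSup S + δ / 2 : ℝ≥0) : ℝ≥0∞) < sSup S + δ := by
      rw [← ENNReal.coe_add, ENNReal.coe_lt_coe]
      gcongr
      exact half_lt_self hδ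
    obtain ⟨z, hxz, hzy⟩ := h x y (sSup S) δ hδ
      (lt_of_le_of_lt (mem_closedEBall'.1 hy) hlt)
    exact hsub z (by simpa [edist_comm] using hxz) y hzy
  exact absurd (le_csSup hbdd this) (not_le.2 (lt_add_of_pos_right _ (half_pos hδ)))

/-- The points within a given finite distance of a compact set lie in a compact set. -/
theorem exists_isCompact_of_edist_le {X : Type*} [EMetricSpace X] [CompleteSpace X]
    [WeaklyLocallyCompactSpace X]
    (h : ∀ (x y : X) (a b : ℝ≥0), 0 < b → edist x y < a + b → ∃ z, edist x z ≤ a ∧ edist z y < b)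
    {K : Set X} (hK : IsCompact K) (r : ℝ≥0) :
    ∃ K' : Set X, IsCompact K' ∧ ∀ x ∈ K, ∀ y, edist y x ≤ r → y ∈ K' := by
  obtain ⟨t, -, htf, ht⟩ := EMetric.totallyBounded_iff'.1 hK.totallyBounded 1 one_pos
  refine ⟨⋃ c ∈ t, closedEBall c ((r + 1 : ℝ≥0) : ℝ≥0∞),
    htf.isCompact_biUnion fun c _ => isCompact_closedEBall h c _, fun x hx y hxy => ?_⟩
  have hx' := ht hx
  simp only [mem_iUnion, exists_prop] at hx' ⊢
  obtain ⟨c, hc, hxc⟩ := hx'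
  refine ⟨c, hc, (edist_triangle y x c).trans ?_⟩
  push_cast
  gcongr
  exact (mem_eball.1 hxc).le

end

section

/-! ### The divergence theorem in the half-space -/

open Filter
open scoped Topology

theorem mem_range_halfSpace {m : ℕ} {y : EuclideanSpace ℝ (Fin (m + 1))} :
    y ∈ range (𝓡∂ (m + 1)) ↔ 0 ≤ y 0 := by
  rw [range_modelWithCornersEuclideanHalfSpace]; rfl

theorem hyperplane_mem_range {m : ℕ} (z : EuclideanSpace ℝ (Fin m)) :
    hyperplane z ∈ range (𝓡∂ (m + 1)) := by
  rw [mem_range_halfSpace]; simp [hyperplane]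

theorem isClosed_range_halfSpace {m : ℕ} : IsClosed (range (𝓡∂ (m + 1))) :=
  (𝓡∂ (m + 1)).isClosed_range

/-- `T` is relatively open in the half-space. -/
def RelOpen {m : ℕ} (T : Set (EuclideanSpace ℝ (Fin (m + 1)))) : Prop :=
  ∃ O, IsOpen O ∧ T = O ∩ range (𝓡∂ (m + 1))

theorem RelOpen.subset_range {m : ℕ} {T : Set (EuclideanSpace ℝ (Fin (m + 1)))}
    (hT : RelOpen T) : T ⊆ range (𝓡∂ (m + 1)) := by
  obtain ⟨O, -, rfl⟩ := hT
  exact inter_subset_right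

theorem RelOpen.mem_nhdsWithin {m : ℕ} {T : Set (EuclideanSpace ℝ (Fin (m + 1)))}
    (hT : RelOpen T) {y : EuclideanSpace ℝ (Fin (m + 1))} (hy : y ∈ T) :
    T ∈ 𝓝[range (𝓡∂ (m + 1))] y := by
  obtain ⟨O, hO, rfl⟩ := hT
  exact inter_mem (mem_nhdsWithin_of_mem_nhds (hO.mem_nhds hy.1)) self_mem_nhdsWithin

theorem RelOpen.nhdsWithin_eq {m : ℕ} {T : Set (EuclideanSpace ℝ (Fin (m + 1)))}
    (hT : RelOpen T) {y : EuclideanSpace ℝ (Fin (m + 1))} (hy : y ∈ T) :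
    𝓝[T] y = 𝓝[range (𝓡∂ (m + 1))] y :=
  le_antisymm (nhdsWithin_mono _ hT.subset_range)
    (nhdsWithin_le_of_mem (hT.mem_nhdsWithin hy))

theorem RelOpen.measurableSet {m : ℕ} {T : Set (EuclideanSpace ℝ (Fin (m + 1)))}
    (hT : RelOpen T) : MeasurableSet T := by
  obtain ⟨O, hO, rfl⟩ := hT
  exact hO.measurableSet.inter isClosed_range_halfSpace.measurableSet

theorem RelOpen.uniqueDiffOn {m : ℕ} {T : Set (EuclideanSpace ℝ (Fin (m + 1)))}
    (hT : RelOpen T) : UniqueDiffOn ℝ T := by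
  obtain ⟨O, hO, rfl⟩ := hT
  rw [inter_comm]
  exact (𝓡∂ (m + 1)).uniqueDiffOn.inter hO

theorem pderiv_congr {m : ℕ} {f g : EuclideanSpace ℝ (Fin (m + 1)) → ℝ}
    {y : EuclideanSpace ℝ (Fin (m + 1))} (h : f =ᶠ[𝓝[range (𝓡∂ (m + 1))] y] g)
    (hy : y ∈ range (𝓡∂ (m + 1))) (i : Fin (m + 1)) : pderiv f i y = pderiv g i y := by
  rw [pderiv, pderiv, h.fderivWithin_eq (h.self_of_nhdsWithin hy)]

theorem pderiv_congr_on {m : ℕ} {f g : EuclideanSpace ℝ (Fin (m + 1)) → ℝ}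
    {T : Set (EuclideanSpace ℝ (Fin (m + 1)))} (hT : RelOpen T) (h : EqOn f g T)
    {y : EuclideanSpace ℝ (Fin (m + 1))} (hy : y ∈ T) (i : Fin (m + 1)) :
    pderiv f i y = pderiv g i y :=
  pderiv_congr (mem_of_superset (hT.mem_nhdsWithin hy) h) (hT.subset_range hy) i

theorem _root_.ContDiffOn.differentiableWithinAt_range {m : ℕ}
    {f : EuclideanSpace ℝ (Fin (m + 1)) → ℝ} {T : Set (EuclideanSpace ℝ (Fin (m + 1)))}
    (hf : ContDiffOn ℝ 1 f T) (hT : RelOpen T)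
    {y : EuclideanSpace ℝ (Fin (m + 1))} (hy : y ∈ T) :
    DifferentiableWithinAt ℝ f (range (𝓡∂ (m + 1))) y :=
  ((hf.differentiableOn one_ne_zero) y hy).mono_of_mem_nhdsWithin (hT.mem_nhdsWithin hy)

theorem fderivWithin_range_eq {m : ℕ}
    {F : Type*} [NormedAddCommGroup F] [NormedSpace ℝ F]
    {f : EuclideanSpace ℝ (Fin (m + 1)) → F} {T : Set (EuclideanSpace ℝ (Fin (m + 1)))}
    (hT : RelOpen T) {y : EuclideanSpace ℝ (Fin (m + 1))} (hy : y ∈ T) :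
    fderivWithin ℝ f (range (𝓡∂ (m + 1))) y = fderivWithin ℝ f T y := by
  obtain ⟨O, hO, rfl⟩ := hT
  rw [inter_comm, fderivWithin_inter (hO.mem_nhds hy.1)]

theorem contDiffOn_pderiv {m : ℕ} {k n : ℕ∞ω}
    {f : EuclideanSpace ℝ (Fin (m + 1)) → ℝ} {T : Set (EuclideanSpace ℝ (Fin (m + 1)))}
    (hT : RelOpen T) (hf : ContDiffOn ℝ n f T) (hk : k + 1 ≤ n) (i : Fin (m + 1)) :
    ContDiffOn ℝ k (pderiv f i) T := by
  refine ContDiffOn.congr (f := fun y => fderivWithin ℝ f T y (EuclideanSpace.single i 1)) ?_ ?_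
  · exact (hf.fderivWithin hT.uniqueDiffOn hk).clm_apply contDiffOn_const
  · intro y hy
    rw [pderiv, fderivWithin_range_eq hT hy]

theorem relOpen_range {m : ℕ} : RelOpen (range (𝓡∂ (m + 1))) :=
  ⟨univ, isOpen_univ, (univ_inter _).symm⟩

/-- The inclusion of the boundary hyperplane as a linear map. -/
noncomputable def hyperplaneL (m : ℕ) :
    EuclideanSpace ℝ (Fin m) →L[ℝ] EuclideanSpace ℝ (Fin (m + 1)) :=
  LinearMap.toContinuousLinearMap
    { toFun := hyperplane
      map_add' := fun v w => by
        ext i; refine Fin.cases ?_ (fun j => ?_) i <;> simp [hyperplane]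
      map_smul' := fun c v => by
        ext i; refine Fin.cases ?_ (fun j => ?_) i <;> simp [hyperplane] }

/-- The projection to the boundary hyperplane as a linear map. -/
noncomputable def tailL (m : ℕ) :
    EuclideanSpace ℝ (Fin (m + 1)) →L[ℝ] EuclideanSpace ℝ (Fin m) :=
  LinearMap.toContinuousLinearMap
    { toFun := fun y => WithLp.toLp 2 (Fin.tail y.ofLp)
      map_add' := fun v w => by ext i; simp [Fin.tail]
      map_smul' := fun c v => by ext i; simp [Fin.tail] }

theorem tailL_apply {m : ℕ} (y : EuclideanSpace ℝ (Fin (m + 1))) (i : Fin m) :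
    tailL m y i = y i.succ := rfl

theorem hyperplane_tailL {m : ℕ} {y : EuclideanSpace ℝ (Fin (m + 1))} (hy : y 0 = 0) :
    hyperplane (tailL m y) = y := by
  ext i; refine Fin.cases ?_ (fun j => ?_) i
  · simp [hyperplane, hy]
  · simp [hyperplane, tailL_apply]

theorem tailL_hyperplane {m : ℕ} (z : EuclideanSpace ℝ (Fin m)) : tailL m (hyperplane z) = z := by
  ext i; simp [hyperplane, tailL_apply]

theorem continuous_hyperplane {m : ℕ} : Continuous (hyperplane (m := m)) :=
  (hyperplaneL m).continuous

/-- The divergence theorem in the half-space for a compactly supported vector field. The integral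
is taken over a half-cube, on whose faces other than `y₀ = 0` the field vanishes. -/
theorem integral_sum_pderiv {m : ℕ} (Y : Fin (m + 1) → EuclideanSpace ℝ (Fin (m + 1)) → ℝ)
    (hY : ∀ i, ContDiffOn ℝ 1 (Y i) (range (𝓡∂ (m + 1)))) {R : ℝ}
    (hR : ∀ i, ∀ y ∈ range (𝓡∂ (m + 1)), R ≤ ‖y‖ → Y i y = 0) :
    ∫ y in range (𝓡∂ (m + 1)), ∑ i, pderiv (Y i) i y = -∫ z, Y 0 (hyperplane z) := by
  wlog hR0 : 0 < R generalizing R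
  · exact this (R := max R 1) (fun i y hy h => hR i y hy ((le_max_left _ _).trans h))
      (by positivity)
  -- the divergence theorem for boxes is stated on `Fin (m + 1) → ℝ`
  let L := (EuclideanSpace.equiv (Fin (m + 1)) ℝ)
  set a : Fin (m + 1) → ℝ := Fin.cons 0 fun _ => -R
  set b : Fin (m + 1) → ℝ := fun _ => R
  have hab : a ≤ b := fun i => by refine Fin.cases ?_ (fun j => ?_) i <;> simp [a, b] <;> linarith
  have hnorm : ∀ (x : Fin (m + 1) → ℝ) i, |x i| ≤ ‖(WithLp.toLp 2 x : EuclideanSpace ℝ _)‖ :=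
    fun x i => by simpa using PiLp.norm_apply_le (WithLp.toLp 2 x : EuclideanSpace ℝ _) i
  have hI : Icc a b ⊆ (WithLp.toLp 2) ⁻¹' range (𝓡∂ (m + 1)) := fun x hx => by
    rw [mem_preimage, mem_range_halfSpace]; simpa [a] using hx.1 0
  have hcl : Continuous (fun x : Fin (m + 1) → ℝ => (WithLp.toLp 2 x : EuclideanSpace ℝ _)) :=
    PiLp.continuous_toLp 2 _
  have hcd : ∀ i, ContinuousOn (pderiv (Y i) i) (range (𝓡∂ (m + 1))) := fun i =>
    (contDiffOn_pderiv (k := 0) relOpen_range (hY i) (by simp) i).continuousOn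
  have hsupp : ∀ i y, y ∈ range (𝓡∂ (m + 1)) → R < ‖y‖ → pderiv (Y i) i y = 0 := by
    intro i y hy hRy
    have : Y i =ᶠ[𝓝[range (𝓡∂ (m + 1))] y] fun _ => 0 := by
      filter_upwards [self_mem_nhdsWithin, mem_nhdsWithin_of_mem_nhds
        ((isOpen_lt continuous_const continuous_norm).mem_nhds hRy)] with w hw hRw
      exact hR i w hw (le_of_lt hRw)
    rw [pderiv_congr this hy]
    simp [pderiv]
  have h1 : ∫ y in range (𝓡∂ (m + 1)), ∑ i, pderiv (Y i) i y =
      ∫ x in Icc a b, ∑ i, pderiv (Y i) i (WithLp.toLp 2 x) := by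
    rw [← (PiLp.volume_preserving_toLp (Fin (m + 1))).setIntegral_preimage_emb
      (MeasurableEquiv.toLp 2 (Fin (m + 1) → ℝ)).measurableEmbedding]
    refine setIntegral_eq_of_subset_of_forall_sdiff_eq_zero
      (f := fun x : Fin (m + 1) → ℝ => ∑ i, pderiv (Y i) i (WithLp.toLp 2 x))
      (isClosed_range_halfSpace.preimage hcl).measurableSet hI fun x hx => ?_
    refine Finset.sum_eq_zero fun i _ => hsupp i _ hx.1 ?_
    by_contra hle
    push Not at hle
    refine hx.2 ⟨fun j => ?_, fun j => ?_⟩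
    · refine Fin.cases ?_ (fun k => ?_) j
      · have := mem_range_halfSpace.1 (mem_preimage.1 hx.1); simpa [a] using this
      · simpa [a] using (abs_le.1 ((hnorm x k.succ).trans hle)).1
    · exact (abs_le.1 ((hnorm x j).trans hle)).2
  rw [h1]
  have h2 := integral_divergence_of_hasFDerivAt_off_countable' a b hab
    (fun i x => Y i (WithLp.toLp 2 x))
    (fun i x => (fderivWithin ℝ (Y i) (range (𝓡∂ (m + 1))) (WithLp.toLp 2 x)).comp
      (L.symm : (Fin (m + 1) → ℝ) →L[ℝ] EuclideanSpace ℝ (Fin (m + 1)))) ∅ countable_empty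
    (fun i => (hY i).continuousOn.comp hcl.continuousOn hI) ?_ ?_
  · have h3 : ∀ x : Fin (m + 1) → ℝ, ∑ i, pderiv (Y i) i (WithLp.toLp 2 x) =
        ∑ i, ((fderivWithin ℝ (Y i) (range (𝓡∂ (m + 1))) (WithLp.toLp 2 x)).comp
      (L.symm : (Fin (m + 1) → ℝ) →L[ℝ] EuclideanSpace ℝ (Fin (m + 1)))) (Pi.single i 1) :=
      fun x => Finset.sum_congr rfl fun i _ => rfl
    simp_rw [h3]
    rw [h2, Fin.sum_univ_succ, Finset.sum_eq_zero, add_zero, setIntegral_eq_zero_of_forall_eq_zero,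
      zero_sub]
    · congr 1
      rw [← (PiLp.volume_preserving_toLp (Fin m)).integral_comp
        (MeasurableEquiv.toLp 2 (Fin m → ℝ)).measurableEmbedding]
      have h4 : ∀ x : Fin m → ℝ, (WithLp.toLp 2 ((0 : Fin (m + 1)).insertNth (a 0) x) :
          EuclideanSpace ℝ (Fin (m + 1))) = hyperplane (WithLp.toLp 2 x) := fun x => by
        simp [hyperplane, a, Fin.insertNth_zero']
      simp_rw [h4]
      refine setIntegral_eq_integral_of_forall_compl_eq_zero fun x hx => ?_
      refine hR 0 _ (hyperplane_mem_range _) ?_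
      by_contra hlt
      push Not at hlt
      have hj : ∀ j : Fin m, |x j| ≤ R := fun j => by
        have := (hnorm (Fin.cons 0 x) j.succ).trans hlt.le
        simpa using this
      refine hx ⟨fun j => ?_, fun j => ?_⟩
      · simpa [a] using (abs_le.1 (hj j)).1
      · simpa [b] using (abs_le.1 (hj j)).2
    · intro x hx
      refine hR 0 _ ?_ ?_
      · rw [mem_range_halfSpace]; simpa [b] using hR0.le
      · refine le_trans ?_ (hnorm _ 0)
        simp [b, le_abs_self]
    · intro j _
      have hx0 : ∀ (c : ℝ) (x : Fin m → ℝ), x ∈ Icc (a ∘ j.succ.succAbove) (b ∘ j.succ.succAbove) →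
          (WithLp.toLp 2 ((j.succ).insertNth c x) : EuclideanSpace ℝ (Fin (m + 1))) ∈
            range (𝓡∂ (m + 1)) := by
        intro c x hx
        rw [mem_range_halfSpace]
        obtain ⟨n, rfl⟩ : ∃ n, m = n + 1 := ⟨m - 1, by have := j.2; omega⟩
        have h0 := hx.1 0
        have h5 : (j.succ).insertNth (α := fun _ => ℝ) c x ((j.succ).succAbove 0) = x 0 :=
          Fin.insertNth_apply_succAbove _ _ _ _
        rw [Fin.succ_succAbove_zero] at h5
        simp only [Function.comp, Fin.succ_succAbove_zero, a, Fin.cons_zero] at h0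
        simpa [h5] using h0
      rw [setIntegral_eq_zero_of_forall_eq_zero, setIntegral_eq_zero_of_forall_eq_zero, sub_zero]
      · intro x hx
        refine hR _ _ (hx0 _ x hx) (le_trans ?_ (hnorm _ j.succ))
        simp [a, le_abs_self]
      · intro x hx
        refine hR _ _ (hx0 _ x hx) (le_trans ?_ (hnorm _ j.succ))
        simp [b, le_abs_self]
  · intro x hx i
    have hx0 : (WithLp.toLp 2 x : EuclideanSpace ℝ (Fin (m + 1))) ∈
        interior (range (𝓡∂ (m + 1))) := by
      rw [range_modelWithCornersEuclideanHalfSpace, interior_halfSpace]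
      simpa [a] using (hx.1 0 (mem_univ _)).1
    have hd : HasFDerivAt (Y i) (fderivWithin ℝ (Y i) (range (𝓡∂ (m + 1))) (WithLp.toLp 2 x))
        (WithLp.toLp 2 x) :=
      (((hY i).differentiableOn one_ne_zero) _ (interior_subset hx0)).hasFDerivWithinAt.hasFDerivAt
        (mem_interior_iff_mem_nhds.1 hx0)
    exact hd.comp x L.symm.hasFDerivAt
  · refine ContinuousOn.integrableOn_compact isCompact_Icc ?_
    exact continuousOn_finsetSum _ fun i _ => (hcd i).comp hcl.continuousOn hI

end

section

open Filter
open scoped Topology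

theorem integrableOn_of_compact_support {X : Type*} [TopologicalSpace X] [MeasurableSpace X]
    [OpensMeasurableSpace X] [T2Space X] {μ : Measure X} [IsFiniteMeasureOnCompacts μ]
    {F : Type*} [NormedAddCommGroup F] {T K : Set X}
    (hT : MeasurableSet T) (hK : IsCompact K) (hKT : K ⊆ T) {g : X → F} (hg : ContinuousOn g T)
    (h0 : ∀ y ∈ T, y ∉ K → g y = 0) : IntegrableOn g T μ :=
  ((hg.mono hKT).integrableOn_compact hK).of_forall_sdiff_eq_zero hT fun y hy => h0 y hy.1 hy.2

theorem pderiv_eq_zero_of_notMem {m : ℕ} {T K : Set (EuclideanSpace ℝ (Fin (m + 1)))}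
    (hT : RelOpen T) (hK : IsClosed K) {v : EuclideanSpace ℝ (Fin (m + 1)) → ℝ}
    (hv : ∀ y ∈ T, y ∉ K → v y = 0) {y : EuclideanSpace ℝ (Fin (m + 1))} (hy : y ∈ T)
    (hyK : y ∉ K) (i : Fin (m + 1)) : pderiv v i y = 0 := by
  have : v =ᶠ[𝓝[range (𝓡∂ (m + 1))] y] fun _ => 0 := by
    filter_upwards [hT.mem_nhdsWithin hy, mem_nhdsWithin_of_mem_nhds (hK.isOpen_compl.mem_nhds hyK)]
      with w hw hwK using hv w hw hwK
  rw [pderiv_congr this (hT.subset_range hy)]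
  simp [pderiv]

theorem pderiv_mul {m : ℕ} {T : Set (EuclideanSpace ℝ (Fin (m + 1)))} (hT : RelOpen T)
    {v w : EuclideanSpace ℝ (Fin (m + 1)) → ℝ} (hv : ContDiffOn ℝ 1 v T) (hw : ContDiffOn ℝ 1 w T)
    {y : EuclideanSpace ℝ (Fin (m + 1))} (hy : y ∈ T) (i : Fin (m + 1)) :
    pderiv (fun y => v y * w y) i y = v y * pderiv w i y + pderiv v i y * w y := by
  rw [pderiv, fderivWithin_fun_mul ((𝓡∂ (m + 1)).uniqueDiffOn _ (hT.subset_range hy))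
    (hv.differentiableWithinAt_range hT hy) (hw.differentiableWithinAt_range hT hy)]
  simp [pderiv, mul_comm]

theorem pderiv_sub {m : ℕ} {T : Set (EuclideanSpace ℝ (Fin (m + 1)))} (hT : RelOpen T)
    {v w : EuclideanSpace ℝ (Fin (m + 1)) → ℝ} (hv : ContDiffOn ℝ 1 v T) (hw : ContDiffOn ℝ 1 w T)
    {y : EuclideanSpace ℝ (Fin (m + 1))} (hy : y ∈ T) (i : Fin (m + 1)) :
    pderiv (fun y => v y - w y) i y = pderiv v i y - pderiv w i y := by
  rw [pderiv, fderivWithin_fun_sub ((𝓡∂ (m + 1)).uniqueDiffOn _ (hT.subset_range hy))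
    (hv.differentiableWithinAt_range hT hy) (hw.differentiableWithinAt_range hT hy)]
  simp [pderiv]

/-- Integration by parts in a relatively open subset of the half-space, against a function with
compact support. -/
theorem green_halfSpace {m : ℕ} {T K : Set (EuclideanSpace ℝ (Fin (m + 1)))}
    (hT : RelOpen T) (hK : IsCompact K) (hKT : K ⊆ T) {v : EuclideanSpace ℝ (Fin (m + 1)) → ℝ}
    {X : Fin (m + 1) → EuclideanSpace ℝ (Fin (m + 1)) → ℝ}
    (hv : ContDiffOn ℝ 1 v T) (hX : ∀ i, ContDiffOn ℝ 1 (X i) T)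
    (hvK : ∀ y ∈ T, y ∉ K → v y = 0) :
    ∫ y in T, v y * ∑ i, pderiv (X i) i y = -(∫ y in T, ∑ i, pderiv v i y * X i y) -
      ∫ z in hyperplane ⁻¹' T, v (hyperplane z) * X 0 (hyperplane z) := by
  classical
  -- the extension of `v X` by zero is continuously differentiable on the half-space
  set Y : Fin (m + 1) → EuclideanSpace ℝ (Fin (m + 1)) → ℝ :=
    fun i => T.indicator fun y => v y * X i y with hYdef
  have hzero : ∀ i, ∀ y ∉ K, Y i y = 0 := fun i y hyK => by
    by_cases hyT : y ∈ T
    · simp [Y, hyT, hvK y hyT hyK]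
    · simp [Y, hyT]
  have hYeq : ∀ i, EqOn (Y i) (fun y => v y * X i y) T := fun i y hy => by simp [Y, hy]
  have hY : ∀ i, ContDiffOn ℝ 1 (Y i) (range (𝓡∂ (m + 1))) := by
    intro i y hy
    by_cases hyT : y ∈ T
    · refine ContDiffWithinAt.mono_of_mem_nhdsWithin ?_ (hT.mem_nhdsWithin hyT)
      exact ((hv.mul (hX i)).congr (hYeq i)) y hyT
    · have hyK : y ∉ K := fun h => hyT (hKT h)
      refine (contDiffWithinAt_const (c := (0 : ℝ))).congr_of_eventuallyEq ?_ (hzero i y hyK)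
      filter_upwards [mem_nhdsWithin_of_mem_nhds (hK.isClosed.isOpen_compl.mem_nhds hyK)] with w hw
      exact hzero i w hw
  obtain ⟨R, hR⟩ := hK.isBounded.exists_norm_le
  have hdiv := integral_sum_pderiv Y hY (R := R + 1) fun i y _ hRy => hzero i y fun hyK => by
    have := hR y hyK; linarith
  have hbdry : ∫ z, Y 0 (hyperplane z) =
      ∫ z in hyperplane ⁻¹' T, v (hyperplane z) * X 0 (hyperplane z) := by
    rw [← integral_indicator (continuous_hyperplane.measurable hT.measurableSet)]
    rfl
  have hint : ∫ y in range (𝓡∂ (m + 1)), ∑ i, pderiv (Y i) i y =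
      ∫ y in T, (v y * (∑ i, pderiv (X i) i y) + ∑ i, pderiv v i y * X i y) := by
    rw [setIntegral_eq_of_subset_of_forall_sdiff_eq_zero (s := T)
      isClosed_range_halfSpace.measurableSet hT.subset_range]
    · refine setIntegral_congr_fun hT.measurableSet fun y hy => ?_
      rw [Finset.mul_sum, ← Finset.sum_add_distrib]
      refine Finset.sum_congr rfl fun i _ => ?_
      rw [pderiv_congr_on hT (hYeq i) hy, pderiv_mul hT hv (hX i) hy]
    · intro y hy
      refine Finset.sum_eq_zero fun i _ => ?_
      exact pderiv_eq_zero_of_notMem relOpen_range hK.isClosed (fun w _ hw => hzero i w hw) hy.1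
        (fun h => hy.2 (hKT h)) i
  rw [hint, hbdry, integral_add] at hdiv
  · linarith
  · refine integrableOn_of_compact_support hT.measurableSet hK hKT ?_ ?_
    · exact hv.continuousOn.mul (continuousOn_finsetSum _ fun i _ =>
        (contDiffOn_pderiv (k := 0) hT (hX i) (by simp) i).continuousOn)
    · intro y hy hyK
      simp [hvK y hy hyK]
  · refine integrableOn_of_compact_support hT.measurableSet hK hKT ?_ ?_
    · exact continuousOn_finsetSum _ fun i _ =>
        (contDiffOn_pderiv (k := 0) hT hv (by simp) i).continuousOn.mul (hX i).continuousOn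
    · intro y hy hyK
      refine Finset.sum_eq_zero fun i _ => ?_
      rw [pderiv_eq_zero_of_notMem hT hK.isClosed hvK hy hyK, zero_mul]

/-! ### D'Alembert's formula -/

theorem measurableSet_triangle (T : ℝ) : MeasurableSet (triangle T) := by
  unfold triangle
  measurability

/-- D'Alembert's formula at `(T, T)` for the product `W(s, t) = f(t) g(s)`, whose wave operator
`(∂ₜ² - ∂ₛ²) W` is `f''(t) g(s) - f(t) g''(s)`. The inner integral over `t < s ≤ 2T - t` is the
derivative of `f'(t) ∫ g + f(t) (g(2T - t) + g(t))`. -/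
theorem dalembert_mul {f f' f'' g g' g'' : ℝ → ℝ} (hf : ∀ t, HasDerivAt f (f' t) t)
    (hf' : ∀ t, HasDerivAt f' (f'' t) t) (hf'' : Continuous f'')
    (hg : ∀ t, HasDerivAt g (g' t) t) (hg' : ∀ t, HasDerivAt g' (g'' t) t) (hg'' : Continuous g'')
    (f0 : f 0 = 0) (f'0 : f' 0 = 0) {T : ℝ} (hT : 0 < T) :
    f T * g T = 1 / 2 * ∫ q in triangle T, (f'' q.2 * g q.1 - f q.2 * g'' q.1) := by
  have cf : Continuous f := continuous_iff_continuousAt.2 fun t => (hf t).continuousAt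
  have cf' : Continuous f' := continuous_iff_continuousAt.2 fun t => (hf' t).continuousAt
  have cg : Continuous g := continuous_iff_continuousAt.2 fun t => (hg t).continuousAt
  have cg' : Continuous g' := continuous_iff_continuousAt.2 fun t => (hg' t).continuousAt
  set P : ℝ × ℝ → ℝ := fun q => f'' q.2 * g q.1 - f q.2 * g'' q.1 with hP
  have cP : Continuous P := by fun_prop
  have hsub : triangle T ⊆ Icc 0 (2 * T) ×ˢ Icc 0 (2 * T) := fun q hq => by
    obtain ⟨h1, h2, h3, h4, h5⟩ := hq
    exact ⟨⟨h5.le, by linarith⟩, ⟨h4.le, by linarith⟩⟩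
  have hint : IntegrableOn P (triangle T) :=
    (cP.continuousOn.integrableOn_compact (isCompact_Icc.prod isCompact_Icc)).mono_set hsub
  have hind : Integrable ((triangle T).indicator P) (volume.prod volume) :=
    (integrable_indicator_iff (measurableSet_triangle T)).2 hint
  set G : ℝ → ℝ := fun x => ∫ r in (0 : ℝ)..x, g r with hG
  have dG : ∀ x, HasDerivAt G (g x) x := fun x =>
    intervalIntegral.integral_hasDerivAt_right (cg.intervalIntegrable _ _)
      (cg.stronglyMeasurableAtFilter _ _) cg.continuousAt
  set Q : ℝ → ℝ := fun t => f' t * (G (2 * T - t) - G t) + f t * (g (2 * T - t) + g t) with hQ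
  set q : ℝ → ℝ := fun t => f'' t * (G (2 * T - t) - G t) - f t * (g' (2 * T - t) - g' t) with hq
  have cG : Continuous G := continuous_iff_continuousAt.2 fun t => (dG t).continuousAt
  have dQ : ∀ t, HasDerivAt Q (q t) t := by
    intro t
    have hr : HasDerivAt (fun t : ℝ => 2 * T - t) (-1) t := by
      simpa using (hasDerivAt_id t).const_sub (2 * T)
    have e1 := (hf' t).mul (((dG (2 * T - t)).comp t hr).sub (dG t))
    have e2 := (hf t).mul (((hg (2 * T - t)).comp t hr).add (hg t))
    refine (e1.add e2).congr_deriv ?_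
    simp only [hq, Function.comp, Pi.add_apply, Pi.sub_apply]
    ring
  have hFTC : ∫ t in (0 : ℝ)..T, q t = Q T - Q 0 :=
    intervalIntegral.integral_eq_sub_of_hasDerivAt (fun t _ => dQ t)
      (Continuous.intervalIntegrable (by fun_prop) _ _)
  have hinner : ∀ t, ∫ s, (triangle T).indicator P (s, t) = (Ioc 0 T).indicator q t := by
    intro t
    by_cases ht : t ∈ Ioc 0 T
    · have hset : ∀ s, (triangle T).indicator P (s, t) =
          (Ioc t (2 * T - t)).indicator (fun s => P (s, t)) s := by
        intro s
        have hiff : (s, t) ∈ triangle T ↔ s ∈ Ioc t (2 * T - t) := by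
          simp only [triangle, mem_ofPred_eq, mem_Ioc]
          constructor
          · rintro ⟨_, h2, h3, _⟩; exact ⟨h3, by linarith⟩
          · rintro ⟨h1, h2⟩
            exact ⟨by linarith [ht.1], by linarith, h1, ht.1, by linarith [ht.1]⟩
        by_cases hs : s ∈ Ioc t (2 * T - t)
        · rw [indicator_of_mem (hiff.2 hs), indicator_of_mem hs]
        · rw [indicator_of_notMem (fun h => hs (hiff.1 h)), indicator_of_notMem hs]
      simp_rw [hset]
      rw [integral_indicator measurableSet_Ioc, indicator_of_mem ht,
        ← intervalIntegral.integral_of_le (by linarith [ht.2])]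
      simp only [hP]
      rw [intervalIntegral.integral_sub (Continuous.intervalIntegrable (by fun_prop) _ _)
        (Continuous.intervalIntegrable (by fun_prop) _ _), intervalIntegral.integral_const_mul,
        intervalIntegral.integral_const_mul,
        intervalIntegral.integral_eq_sub_of_hasDerivAt (fun t _ => dG t)
          (cg.intervalIntegrable _ _),
        intervalIntegral.integral_eq_sub_of_hasDerivAt (fun t _ => hg' t)
          (hg''.intervalIntegrable _ _)]
    · rw [indicator_of_notMem ht]
      refine integral_eq_zero_of_ae (Eventually.of_forall fun s => ?_)
      refine indicator_of_notMem (fun h => ht ?_) _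
      obtain ⟨_, h2, h3, h4, _⟩ := h
      exact ⟨h4, by simp only at h2 h3; linarith⟩
  have hmain : ∫ p in triangle T, P p = Q T - Q 0 := by
    rw [← integral_indicator (measurableSet_triangle T), Measure.volume_eq_prod,
      integral_prod_symm _ hind]
    simp_rw [hinner]
    rw [integral_indicator measurableSet_Ioc, ← intervalIntegral.integral_of_le hT.le, hFTC]
  rw [hmain]
  simp only [hQ, f0, f'0]
  have : 2 * T - T = T := by ring
  rw [this]
  ring

end

section

open Filter
open scoped Topology

/-! ### The metric in a chart -/

section Chart

variable {m : ℕ} {M : Type*} [TopologicalSpace M] [ChartedSpace (EuclideanHalfSpace (m + 1)) M]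

/-- The derivative of the inverse of the chart around `x₀`, as a map from the coordinate space to
the tangent space. -/
noncomputable def symmDeriv (x₀ : M) (y : EuclideanSpace ℝ (Fin (m + 1))) :
    EuclideanSpace ℝ (Fin (m + 1)) →L[ℝ]
      TangentSpace (𝓡∂ (m + 1)) ((extChartAt (𝓡∂ (m + 1)) x₀).symm y) :=
  mfderivWithin 𝓘(ℝ, EuclideanSpace ℝ (Fin (m + 1))) (𝓡∂ (m + 1))
    (extChartAt (𝓡∂ (m + 1)) x₀).symm (range (𝓡∂ (m + 1))) y

theorem coordVec_eq (x₀ : M) (y : EuclideanSpace ℝ (Fin (m + 1))) (i : Fin (m + 1)) :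
    coordVec x₀ y i = symmDeriv x₀ y (EuclideanSpace.single i 1) := rfl

theorem relOpen_target (x₀ : M) : RelOpen (extChartAt (𝓡∂ (m + 1)) x₀).target := by
  refine ⟨(𝓡∂ (m + 1)).symm ⁻¹' (chartAt (EuclideanHalfSpace (m + 1)) x₀).target,
    (chartAt _ x₀).open_target.preimage (𝓡∂ (m + 1)).continuous_symm,
    extChartAt_target (𝓡∂ (m + 1)) x₀⟩

theorem symmDeriv_eq_sum (x₀ : M) (y v : EuclideanSpace ℝ (Fin (m + 1))) :
    symmDeriv x₀ y v = ∑ i, v i • coordVec x₀ y i := by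
  have hv : v = ∑ i, v i • EuclideanSpace.single i (1 : ℝ) := by
    ext j
    simp [Finset.sum_apply, Pi.single_apply]
  conv_lhs => rw [hv]
  rw [map_sum]
  exact Finset.sum_congr rfl fun i _ => by rw [map_smul, coordVec_eq]

section

variable [RiemannianBundle (fun x : M => TangentSpace (𝓡∂ (m + 1)) x)]

theorem inner_symmDeriv (x₀ : M) (y v w : EuclideanSpace ℝ (Fin (m + 1))) :
    inner ℝ (symmDeriv x₀ y v) (symmDeriv x₀ y w) = ∑ i, ∑ j, v i * gram x₀ y i j * w j := by
  rw [symmDeriv_eq_sum, symmDeriv_eq_sum, sum_inner]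
  refine Finset.sum_congr rfl fun i _ => ?_
  rw [inner_sum]
  refine Finset.sum_congr rfl fun j _ => ?_
  rw [real_inner_smul_left, real_inner_smul_right]
  simp only [gram, Matrix.of_apply]
  ring

theorem gram_comm (x₀ : M) (y : EuclideanSpace ℝ (Fin (m + 1))) (i j : Fin (m + 1)) :
    gram x₀ y i j = gram x₀ y j i := by
  simp only [gram, Matrix.of_apply]
  exact real_inner_comm _ _

theorem norm_symmDeriv_sq (x₀ : M) (y v : EuclideanSpace ℝ (Fin (m + 1))) :
    ‖symmDeriv x₀ y v‖ ^ 2 = ∑ i, ∑ j, v i * gram x₀ y i j * v j := by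
  rw [← inner_symmDeriv, real_inner_self_eq_norm_sq]

end

variable [IsManifold (𝓡∂ (m + 1)) ∞ M]

theorem contMDiffOn_coordVec (x₀ : M) (i : Fin (m + 1)) :
    ContMDiffOn 𝓘(ℝ, EuclideanSpace ℝ (Fin (m + 1))) ((𝓡∂ (m + 1)).tangent) ∞
      (fun y => (⟨_, coordVec x₀ y i⟩ : TangentBundle (𝓡∂ (m + 1)) M))
      (extChartAt (𝓡∂ (m + 1)) x₀).target := by
  have h1 := (contMDiffOn_extChartAt_symm (I := 𝓡∂ (m + 1)) (n := ∞)
    x₀).contMDiffOn_tangentMapWithin (m := ∞) le_rfl (relOpen_target (m := m) x₀).uniqueDiffOn.uniqueMDiffOn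
  have h2 : ContMDiffOn 𝓘(ℝ, EuclideanSpace ℝ (Fin (m + 1)))
      (𝓘(ℝ, EuclideanSpace ℝ (Fin (m + 1))).tangent) ∞
      (fun y => (⟨y, (EuclideanSpace.single i (1 : ℝ) : EuclideanSpace ℝ (Fin (m + 1)))⟩ :
        TangentBundle 𝓘(ℝ, EuclideanSpace ℝ (Fin (m + 1))) (EuclideanSpace ℝ (Fin (m + 1)))))
      (extChartAt (𝓡∂ (m + 1)) x₀).target := fun y _ =>
    contMDiffWithinAt_vectorSpace_iff_contDiffWithinAt.2 contDiffWithinAt_const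
  refine (h1.comp h2 fun y hy => hy).congr fun y hy => ?_
  simp only [Function.comp, tangentMapWithin]
  congr 1
  rw [coordVec]
  obtain ⟨O, hO, hT⟩ := relOpen_target (m := m) x₀
  rw [hT, inter_comm, mfderivWithin_inter (hO.mem_nhds (hT ▸ hy : y ∈ O ∩ _).1)]

theorem isInvertible_symmDeriv (x₀ : M)
    {y : EuclideanSpace ℝ (Fin (m + 1))} (hy : y ∈ (extChartAt (𝓡∂ (m + 1)) x₀).target) :
    (symmDeriv x₀ y).IsInvertible := isInvertible_mfderivWithin_extChartAt_symm hy

variable [RiemannianBundle (fun x : M => TangentSpace (𝓡∂ (m + 1)) x)]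

theorem exists_norm_le_symmDeriv (x₀ : M) {y : EuclideanSpace ℝ (Fin (m + 1))}
    (hy : y ∈ (extChartAt (𝓡∂ (m + 1)) x₀).target) :
    ∃ C > 0, ∀ v, ‖v‖ ≤ C * ‖symmDeriv x₀ y v‖ := by
  obtain ⟨e, he⟩ := isInvertible_symmDeriv x₀ hy
  refine ⟨‖e.symm.toContinuousLinearMap‖ + 1, by positivity, fun v => ?_⟩
  rw [← he]
  calc ‖v‖ = ‖e.symm (e v)‖ := (congrArg norm (e.symm_apply_apply v)).symm
    _ ≤ ‖e.symm.toContinuousLinearMap‖ * ‖e v‖ :=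
      e.symm.toContinuousLinearMap.le_opNorm _
    _ ≤ _ := by
      simp only [ContinuousLinearEquiv.coe_coe]
      gcongr
      linarith

theorem posDef_gram (x₀ : M) {y : EuclideanSpace ℝ (Fin (m + 1))}
    (hy : y ∈ (extChartAt (𝓡∂ (m + 1)) x₀).target) : (gram x₀ y).PosDef := by
  refine Matrix.PosDef.of_dotProduct_mulVec_pos ?_ ?_
  · ext i j
    simpa using gram_comm x₀ y j i
  · intro v hv
    have h : star v ⬝ᵥ (gram x₀ y).mulVec v = ‖symmDeriv x₀ y (WithLp.toLp 2 v)‖ ^ 2 := by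
      rw [norm_symmDeriv_sq]
      simp [dotProduct, Matrix.mulVec, Finset.mul_sum, mul_assoc]
    rw [h]
    have h2 : symmDeriv x₀ y (WithLp.toLp 2 v) ≠ 0 := by
      intro h0
      have hinj := (isInvertible_symmDeriv x₀ hy).injective
      have := hinj (h0.trans (map_zero _).symm)
      exact hv (by simpa using congrArg WithLp.ofLp this)
    positivity

theorem det_gram_pos (x₀ : M) {y : EuclideanSpace ℝ (Fin (m + 1))}
    (hy : y ∈ (extChartAt (𝓡∂ (m + 1)) x₀).target) : 0 < (gram x₀ y).det :=
  (posDef_gram x₀ hy).det_pos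

variable [IsContMDiffRiemannianBundle (𝓡∂ (m + 1)) ∞ (EuclideanSpace ℝ (Fin (m + 1)))
      (fun x : M => TangentSpace (𝓡∂ (m + 1)) x)]

theorem contDiffOn_gram (x₀ : M) (i j : Fin (m + 1)) :
    ContDiffOn ℝ ∞ (fun y => gram x₀ y i j) (extChartAt (𝓡∂ (m + 1)) x₀).target := by
  rw [← contMDiffOn_iff_contDiffOn]
  exact (contMDiffOn_coordVec x₀ i).inner_bundle (contMDiffOn_coordVec x₀ j)

end Chart

end

section

open Filter
open scoped Topology

theorem contDiffOn_det {V : Type*} [NormedAddCommGroup V] [NormedSpace ℝ V] {n : ℕ} {k : ℕ∞ω}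
    {A : V → Matrix (Fin n) (Fin n) ℝ} {T : Set V}
    (hA : ∀ i j, ContDiffOn ℝ k (fun y => A y i j) T) : ContDiffOn ℝ k (fun y => (A y).det) T := by
  simp only [Matrix.det_apply']
  exact ContDiffOn.sum fun σ _ => contDiffOn_const.mul (contDiffOn_prod fun i _ => hA _ _)

theorem contDiffOn_inv_apply {V : Type*} [NormedAddCommGroup V] [NormedSpace ℝ V] {n : ℕ} {k : ℕ∞ω}
    {A : V → Matrix (Fin n) (Fin n) ℝ} {T : Set V}
    (hA : ∀ i j, ContDiffOn ℝ k (fun y => A y i j) T) (hdet : ∀ y ∈ T, (A y).det ≠ 0)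
    (i j : Fin n) : ContDiffOn ℝ k (fun y => (A y)⁻¹ i j) T := by
  simp only [Matrix.inv_def, Matrix.smul_apply, Matrix.adjugate_apply, smul_eq_mul,
    Ring.inverse_eq_inv']
  refine ((contDiffOn_det hA).inv hdet).mul (contDiffOn_det fun i' j' => ?_)
  simp only [Matrix.updateRow_apply]
  split_ifs
  · exact contDiffOn_const
  · exact hA _ _

section Chart

variable {m : ℕ} {M : Type*} [TopologicalSpace M] [ChartedSpace (EuclideanHalfSpace (m + 1)) M]
  [IsManifold (𝓡∂ (m + 1)) ∞ M]
  [RiemannianBundle (fun x : M => TangentSpace (𝓡∂ (m + 1)) x)]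
  [IsContMDiffRiemannianBundle (𝓡∂ (m + 1)) ∞ (EuclideanSpace ℝ (Fin (m + 1)))
      (fun x : M => TangentSpace (𝓡∂ (m + 1)) x)]

theorem contDiffOn_gram_inv (x₀ : M) (i j : Fin (m + 1)) :
    ContDiffOn ℝ ∞ (fun y => (gram x₀ y)⁻¹ i j) (extChartAt (𝓡∂ (m + 1)) x₀).target :=
  contDiffOn_inv_apply (contDiffOn_gram x₀) (fun _ hy => (det_gram_pos x₀ hy).ne') i j

theorem contDiffOn_sqrt_det_gram (x₀ : M) :
    ContDiffOn ℝ ∞ (fun y => √(gram x₀ y).det) (extChartAt (𝓡∂ (m + 1)) x₀).target :=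
  (contDiffOn_det (contDiffOn_gram x₀)).sqrt fun _ hy => (det_gram_pos x₀ hy).ne'

theorem contDiffOn_gradCoord (x₀ : M) {f : M → ℝ}
    (hf : ContDiffOn ℝ ∞ (f ∘ (extChartAt (𝓡∂ (m + 1)) x₀).symm)
      (extChartAt (𝓡∂ (m + 1)) x₀).target) (i : Fin (m + 1)) :
    ContDiffOn ℝ ∞ (gradCoord x₀ f i) (extChartAt (𝓡∂ (m + 1)) x₀).target :=
  ContDiffOn.sum fun j _ => (contDiffOn_gram_inv x₀ i j).mul
    (contDiffOn_pderiv (relOpen_target x₀) hf le_rfl j)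

/-- Near a point, the coefficients of the metric in a chart vary little, so the norms which the
metric induces on the coordinate space at different points are comparable with a factor `2`. -/
theorem exists_norm_symmDeriv_le (x₀ : M) :
    ∃ δ > 0, ∀ y ∈ range (𝓡∂ (m + 1)), dist y (extChartAt (𝓡∂ (m + 1)) x₀ x₀) < δ →
      y ∈ (extChartAt (𝓡∂ (m + 1)) x₀).target ∧
      ∀ v, ‖symmDeriv x₀ y v‖ ≤ 2 * ‖symmDeriv x₀ (extChartAt (𝓡∂ (m + 1)) x₀ x₀) v‖ ∧
        ‖symmDeriv x₀ (extChartAt (𝓡∂ (m + 1)) x₀ x₀) v‖ ≤ 2 * ‖symmDeriv x₀ y v‖ := by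
  set y₀ := extChartAt (𝓡∂ (m + 1)) x₀ x₀ with hy₀
  have hy₀T : y₀ ∈ (extChartAt (𝓡∂ (m + 1)) x₀).target := mem_extChartAt_target x₀
  obtain ⟨C, hC0, hC⟩ := exists_norm_le_symmDeriv x₀ hy₀T
  -- if the coefficients change by less than `ε`, the quadratic form changes by at most one half
  set ε : ℝ := (2 * C ^ 2 * (m + 1) ^ 2)⁻¹ with hε
  have hε0 : 0 < ε := by positivity
  have hev : ∀ᶠ y in 𝓝[range (𝓡∂ (m + 1))] y₀, y ∈ (extChartAt (𝓡∂ (m + 1)) x₀).target ∧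
      ∀ i j, |gram x₀ y i j - gram x₀ y₀ i j| < ε := by
    refine Filter.Eventually.and ((relOpen_target x₀).mem_nhdsWithin hy₀T) ?_
    rw [eventually_all]
    intro i
    rw [eventually_all]
    intro j
    have := ((contDiffOn_gram x₀ i j).continuousOn y₀ hy₀T)
    rw [ContinuousWithinAt, (relOpen_target x₀).nhdsWithin_eq hy₀T] at this
    exact (Metric.tendsto_nhds.1 this) ε hε0
  obtain ⟨δ, hδ, h⟩ := Metric.mem_nhdsWithin_iff.1 hev
  refine ⟨δ, hδ, fun y hyr hyd => ?_⟩
  obtain ⟨hyT, hG⟩ := h ⟨hyd, hyr⟩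
  refine ⟨hyT, fun v => ?_⟩
  have hdiff : |‖symmDeriv x₀ y v‖ ^ 2 - ‖symmDeriv x₀ y₀ v‖ ^ 2| ≤
      1 / 2 * ‖symmDeriv x₀ y₀ v‖ ^ 2 := by
    rw [norm_symmDeriv_sq x₀ y, norm_symmDeriv_sq x₀ y₀ v, ← Finset.sum_sub_distrib,
      ← norm_symmDeriv_sq x₀ y₀ v]
    have hv : ∀ i, |v i| ≤ C * ‖symmDeriv x₀ y₀ v‖ := fun i =>
      (by simpa using PiLp.norm_apply_le v i : |v i| ≤ ‖v‖).trans (hC v)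
    calc |∑ i, (∑ j, v i * gram x₀ y i j * v j - ∑ j, v i * gram x₀ y₀ i j * v j)|
        ≤ ∑ i : Fin (m + 1), ∑ j : Fin (m + 1), (C * ‖symmDeriv x₀ y₀ v‖) * ε *
          (C * ‖symmDeriv x₀ y₀ v‖) := by
          refine (Finset.abs_sum_le_sum_abs _ _).trans (Finset.sum_le_sum fun i _ => ?_)
          rw [← Finset.sum_sub_distrib]
          refine (Finset.abs_sum_le_sum_abs _ _).trans (Finset.sum_le_sum fun j _ => ?_)
          rw [← sub_mul, ← mul_sub, abs_mul, abs_mul]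
          have h1 := hv i
          have h2 := hv j
          have h3 := (hG i j).le
          gcongr
      _ = _ := by
          simp only [Finset.sum_const, Finset.card_univ, Fintype.card_fin, nsmul_eq_mul, hε]
          push_cast
          field_simp
  have h1 := abs_le.1 hdiff
  constructor
  · refine abs_le_of_sq_le_sq' ?_ (by positivity) |>.2
    nlinarith [sq_nonneg ‖symmDeriv x₀ y₀ v‖]
  · refine abs_le_of_sq_le_sq' ?_ (by positivity) |>.2
    nlinarith [sq_nonneg ‖symmDeriv x₀ y v‖]

end Chart

/-- Near a point, the Riemannian distance is at most the length of the coordinate segment. -/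
theorem exists_edist_symm_le {m : ℕ} {M : Type*} [EMetricSpace M]
    [ChartedSpace (EuclideanHalfSpace (m + 1)) M] [IsManifold (𝓡∂ (m + 1)) ∞ M]
    [RiemannianBundle (fun x : M => TangentSpace (𝓡∂ (m + 1)) x)]
    [IsRiemannianManifold (𝓡∂ (m + 1)) M] (x₀ : M) {δ : ℝ}
    (h : ∀ y ∈ range (𝓡∂ (m + 1)), dist y (extChartAt (𝓡∂ (m + 1)) x₀ x₀) < δ →
      y ∈ (extChartAt (𝓡∂ (m + 1)) x₀).target ∧
      ∀ v, ‖symmDeriv x₀ y v‖ ≤ 2 * ‖symmDeriv x₀ (extChartAt (𝓡∂ (m + 1)) x₀ x₀) v‖)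
    {y z : EuclideanSpace ℝ (Fin (m + 1))} (hy : y ∈ range (𝓡∂ (m + 1)))
    (hz : z ∈ range (𝓡∂ (m + 1))) (hyδ : dist y (extChartAt (𝓡∂ (m + 1)) x₀ x₀) < δ)
    (hzδ : dist z (extChartAt (𝓡∂ (m + 1)) x₀ x₀) < δ) :
    edist ((extChartAt (𝓡∂ (m + 1)) x₀).symm y) ((extChartAt (𝓡∂ (m + 1)) x₀).symm z) ≤
      ENNReal.ofReal (2 * ‖symmDeriv x₀ (extChartAt (𝓡∂ (m + 1)) x₀ x₀) (z - y)‖) := by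
  set y₀ := extChartAt (𝓡∂ (m + 1)) x₀ x₀ with hy₀
  rw [IsRiemannianManifold.out (I := 𝓡∂ (m + 1))]
  let η := ContinuousAffineMap.lineMap (R := ℝ) y z
  set γ := (extChartAt (𝓡∂ (m + 1)) x₀).symm ∘ η with hγ
  have hη : ∀ t ∈ Icc (0 : ℝ) 1, η t ∈ range (𝓡∂ (m + 1)) ∧ dist (η t) y₀ < δ := by
    have hsub : η '' Icc (0 : ℝ) 1 ⊆ Metric.ball y₀ δ ∩ range (𝓡∂ (m + 1)) := by
      simp only [η, ContinuousAffineMap.coe_lineMap_eq, ← segment_eq_image_lineMap]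
      exact ((convex_ball _ _).inter (𝓡∂ (m + 1)).convex_range).segment_subset ⟨hyδ, hy⟩ ⟨hzδ, hz⟩
    intro t ht
    exact ⟨(hsub (mem_image_of_mem _ ht)).2, (hsub (mem_image_of_mem _ ht)).1⟩
  have hηT : Icc (0 : ℝ) 1 ⊆ η ⁻¹' (extChartAt (𝓡∂ (m + 1)) x₀).target :=
    fun t ht => (h _ (hη t ht).1 (hη t ht).2).1
  have η_smooth : ContMDiffOn 𝓘(ℝ, ℝ) 𝓘(ℝ, EuclideanSpace ℝ (Fin (m + 1))) 1 η (Icc 0 1) := by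
    apply ContMDiff.contMDiffOn
    rw [contMDiff_iff_contDiff]
    exact ContinuousAffineMap.contDiff _
  have hle : riemannianEDist (𝓡∂ (m + 1)) ((extChartAt (𝓡∂ (m + 1)) x₀).symm y)
      ((extChartAt (𝓡∂ (m + 1)) x₀).symm z) ≤ pathELength (𝓡∂ (m + 1)) γ 0 1 := by
    apply riemannianEDist_le_pathELength _ _ _ zero_le_one
    · exact (contMDiffOn_extChartAt_symm x₀).comp η_smooth hηT
    · simp [γ, η, ContinuousAffineMap.coe_lineMap_eq]
    · simp [γ, η, ContinuousAffineMap.coe_lineMap_eq]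
  refine hle.trans ?_
  rw [pathELength_eq_lintegral_mfderivWithin_Icc]
  have hvol : ENNReal.ofReal (2 * ‖symmDeriv x₀ y₀ (z - y)‖) =
      ∫⁻ _ in Icc (0 : ℝ) 1, ENNReal.ofReal (2 * ‖symmDeriv x₀ y₀ (z - y)‖) := by simp
  rw [hvol]
  refine setLIntegral_mono' measurableSet_Icc fun t ht => ?_
  have hcomp : mfderivWithin 𝓘(ℝ, ℝ) (𝓡∂ (m + 1)) γ (Icc 0 1) t =
      (mfderivWithin 𝓘(ℝ, EuclideanSpace ℝ (Fin (m + 1))) (𝓡∂ (m + 1))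
        (extChartAt (𝓡∂ (m + 1)) x₀).symm (range (𝓡∂ (m + 1))) (η t)) ∘L
        (mfderivWithin 𝓘(ℝ, ℝ) 𝓘(ℝ, EuclideanSpace ℝ (Fin (m + 1))) η (Icc 0 1) t) := by
    apply mfderivWithin_comp
    · exact mdifferentiableWithinAt_extChartAt_symm (hηT ht)
    · exact η_smooth.mdifferentiableOn one_ne_zero t ht
    · exact hηT.trans (preimage_mono (extChartAt_target_subset_range x₀))
    · rw [uniqueMDiffWithinAt_iff_uniqueDiffWithinAt]
      exact uniqueDiffOn_Icc zero_lt_one t ht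
  have hd : mfderivWithin 𝓘(ℝ, ℝ) 𝓘(ℝ, EuclideanSpace ℝ (Fin (m + 1))) η (Icc 0 1) t (1 : ℝ) =
      z - y := by
    rw [mfderivWithin_eq_fderivWithin,
      fderivWithin_eq_fderiv (uniqueDiffOn_Icc zero_lt_one _ ht) η.differentiableAt]
    rw [ContinuousAffineMap.fderiv]
    change (AffineMap.lineMap y z : ℝ →ᵃ[ℝ] EuclideanSpace ℝ (Fin (m + 1))).linear 1 = z - y
    simp
  have hval : mfderivWithin 𝓘(ℝ, ℝ) (𝓡∂ (m + 1)) γ (Icc 0 1) t (1 : ℝ) =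
      symmDeriv x₀ (η t) (z - y) := by
    rw [hcomp, ← hd]
    rfl
  refine (le_of_eq (congrArg (fun v => ‖v‖ₑ) hval)).trans ?_
  rw [← ofReal_norm]
  exact ENNReal.ofReal_le_ofReal ((h _ (hη t ht).1 (hη t ht).2).2 _)

end

section

open Filter
open scoped Topology

/-! ### Calculus in the half-space and in time -/

section SpaceTime

variable {m : ℕ}

/-- The one-sided time derivative of a function on the half-space times `[0, ∞)`. -/
noncomputable def timeDeriv (w : EuclideanSpace ℝ (Fin (m + 1)) × ℝ → ℝ)
    (p : EuclideanSpace ℝ (Fin (m + 1)) × ℝ) : ℝ :=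
  fderivWithin ℝ w (range (𝓡∂ (m + 1)) ×ˢ Ici 0) p (0, 1)

/-- The one-sided partial derivative in direction `i` of a function on the half-space times
`[0, ∞)`. -/
noncomputable def spaceDeriv (w : EuclideanSpace ℝ (Fin (m + 1)) × ℝ → ℝ) (i : Fin (m + 1))
    (p : EuclideanSpace ℝ (Fin (m + 1)) × ℝ) : ℝ :=
  fderivWithin ℝ w (range (𝓡∂ (m + 1)) ×ˢ Ici 0) p (EuclideanSpace.single i 1, 0)

theorem uniqueDiffOn_spaceTime :
    UniqueDiffOn ℝ (range (𝓡∂ (m + 1)) ×ˢ Ici (0 : ℝ)) :=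
  (𝓡∂ (m + 1)).uniqueDiffOn.prod (uniqueDiffOn_Ici 0)

theorem mem_nhdsWithin_spaceTime {T : Set (EuclideanSpace ℝ (Fin (m + 1)))} (hT : RelOpen T)
    {p : EuclideanSpace ℝ (Fin (m + 1)) × ℝ} (hp : p ∈ T ×ˢ Ici (0 : ℝ)) :
    T ×ˢ Ici (0 : ℝ) ∈ 𝓝[range (𝓡∂ (m + 1)) ×ˢ Ici 0] p := by
  rw [nhdsWithin_prod_eq]
  exact prod_mem_prod (hT.mem_nhdsWithin hp.1) self_mem_nhdsWithin

theorem range_subset_closure_interior :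
    range (𝓡∂ (m + 1)) ⊆ closure (interior (range (𝓡∂ (m + 1)))) :=
  (𝓡∂ (m + 1)).range_subset_closure_interior

variable {T : Set (EuclideanSpace ℝ (Fin (m + 1)))}
  {w : EuclideanSpace ℝ (Fin (m + 1)) × ℝ → ℝ}

theorem contDiffOn_fderivWithin_spaceTime (hT : RelOpen T)
    (hw : ContDiffOn ℝ ∞ w (T ×ˢ Ici 0)) :
    ContDiffOn ℝ ∞ (fderivWithin ℝ w (range (𝓡∂ (m + 1)) ×ˢ Ici 0)) (T ×ˢ Ici 0) := by
  intro p hp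
  have h1 : ContDiffWithinAt ℝ ∞ w (range (𝓡∂ (m + 1)) ×ˢ Ici 0) p :=
    (hw p hp).mono_of_mem_nhdsWithin (mem_nhdsWithin_spaceTime hT hp)
  exact (h1.fderivWithin_right uniqueDiffOn_spaceTime (m := ∞) (by simp)
    ⟨hT.subset_range hp.1, hp.2⟩).mono (prod_mono hT.subset_range le_rfl)

theorem contDiffOn_timeDeriv (hT : RelOpen T) (hw : ContDiffOn ℝ ∞ w (T ×ˢ Ici 0)) :
    ContDiffOn ℝ ∞ (timeDeriv w) (T ×ˢ Ici 0) :=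
  (contDiffOn_fderivWithin_spaceTime hT hw).clm_apply contDiffOn_const

theorem contDiffOn_spaceDeriv (hT : RelOpen T) (hw : ContDiffOn ℝ ∞ w (T ×ˢ Ici 0))
    (i : Fin (m + 1)) : ContDiffOn ℝ ∞ (spaceDeriv w i) (T ×ˢ Ici 0) :=
  (contDiffOn_fderivWithin_spaceTime hT hw).clm_apply contDiffOn_const

theorem hasFDerivWithinAt_spaceTime (hT : RelOpen T) (hw : ContDiffOn ℝ ∞ w (T ×ˢ Ici 0))
    {p : EuclideanSpace ℝ (Fin (m + 1)) × ℝ} (hp : p ∈ T ×ˢ Ici (0 : ℝ)) :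
    HasFDerivWithinAt w (fderivWithin ℝ w (range (𝓡∂ (m + 1)) ×ˢ Ici 0) p)
      (range (𝓡∂ (m + 1)) ×ˢ Ici 0) p :=
  (((hw p hp).mono_of_mem_nhdsWithin
    (mem_nhdsWithin_spaceTime hT hp)).differentiableWithinAt (by simp)).hasFDerivWithinAt

theorem hasDerivWithinAt_timeDeriv (hT : RelOpen T) (hw : ContDiffOn ℝ ∞ w (T ×ˢ Ici 0))
    {y : EuclideanSpace ℝ (Fin (m + 1))} (hy : y ∈ T) {t : ℝ} (ht : 0 ≤ t) :
    HasDerivWithinAt (fun τ => w (y, τ)) (timeDeriv w (y, t)) (Ici 0) t := by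
  have h1 : HasDerivWithinAt (fun τ : ℝ => (y, τ)) (0, 1) (Ici 0) t :=
    (hasDerivWithinAt_const t _ y).prodMk (hasDerivWithinAt_id t _)
  exact (hasFDerivWithinAt_spaceTime hT hw (p := (y, t)) ⟨hy, ht⟩).comp_hasDerivWithinAt t h1
    fun τ hτ => ⟨hT.subset_range hy, hτ⟩

theorem contDiffOn_slice (hw : ContDiffOn ℝ ∞ w (T ×ˢ Ici 0)) {t : ℝ} (ht : 0 ≤ t) :
    ContDiffOn ℝ ∞ (fun y => w (y, t)) T :=
  hw.comp (contDiffOn_id.prodMk contDiffOn_const) fun _ hy => ⟨hy, ht⟩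

theorem pderiv_slice (hT : RelOpen T) (hw : ContDiffOn ℝ ∞ w (T ×ˢ Ici 0))
    {y : EuclideanSpace ℝ (Fin (m + 1))} (hy : y ∈ T) {t : ℝ} (ht : 0 ≤ t) (i : Fin (m + 1)) :
    pderiv (fun y => w (y, t)) i y = spaceDeriv w i (y, t) := by
  have h1 : HasFDerivWithinAt (fun y' : EuclideanSpace ℝ (Fin (m + 1)) => (y', t))
      (ContinuousLinearMap.inl ℝ _ ℝ) (range (𝓡∂ (m + 1))) y :=
    (hasFDerivAt_prodMk_left y t).hasFDerivWithinAt
  have h2 := (hasFDerivWithinAt_spaceTime hT hw (p := (y, t)) ⟨hy, ht⟩).comp y h1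
    fun y' hy' => mk_mem_prod hy' (mem_Ici.2 ht)
  rw [pderiv]
  have h3 := h2.fderivWithin ((𝓡∂ (m + 1)).uniqueDiffOn _ (hT.subset_range hy))
  rw [show (fun y => w (y, t)) = w ∘ fun y' => (y', t) from rfl, h3]
  simp [spaceDeriv]

theorem spaceDeriv_timeDeriv (hT : RelOpen T) (hw : ContDiffOn ℝ ∞ w (T ×ˢ Ici 0))
    {p : EuclideanSpace ℝ (Fin (m + 1)) × ℝ} (hp : p ∈ T ×ˢ Ici (0 : ℝ)) (i : Fin (m + 1)) :
    spaceDeriv (timeDeriv w) i p = timeDeriv (spaceDeriv w i) p := by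
  set S := range (𝓡∂ (m + 1)) ×ˢ Ici (0 : ℝ) with hS
  have hpS : p ∈ S := ⟨hT.subset_range hp.1, hp.2⟩
  have hu : UniqueDiffWithinAt ℝ S p := uniqueDiffOn_spaceTime p hpS
  have hcl : p ∈ closure (interior S) := by
    rw [hS, interior_prod_eq, closure_prod_eq, interior_Ici, closure_Ioi]
    exact ⟨range_subset_closure_interior hpS.1, hpS.2⟩
  have h1 : ContDiffWithinAt ℝ ∞ w S p :=
    (hw p hp).mono_of_mem_nhdsWithin (mem_nhdsWithin_spaceTime hT hp)
  have hsymm := h1.isSymmSndFDerivWithinAt (by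
    rw [minSmoothness_of_isRCLikeNormedField]
    exact WithTop.coe_le_coe.2 le_top)
    uniqueDiffOn_spaceTime hcl hpS
  have hd : DifferentiableWithinAt ℝ (fderivWithin ℝ w S) S p :=
    (((contDiffOn_fderivWithin_spaceTime hT hw) p hp).mono_of_mem_nhdsWithin
      (mem_nhdsWithin_spaceTime hT hp)).differentiableWithinAt (by simp)
  have h2 : ∀ a b, fderivWithin ℝ (fun q => fderivWithin ℝ w S q a) S p b =
      fderivWithin ℝ (fderivWithin ℝ w S) S p b a := fun a b => by
    rw [fderivWithin_clm_apply hu hd (differentiableWithinAt_const a)]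
    simp
  change fderivWithin ℝ (fun q => fderivWithin ℝ w S q (0, 1)) S p (EuclideanSpace.single i 1, 0) =
    fderivWithin ℝ (fun q => fderivWithin ℝ w S q (EuclideanSpace.single i 1, 0)) S p (0, 1)
  rw [h2, h2]
  exact hsymm _ _

end SpaceTime

theorem RelOpen.subset_closure_interior {m : ℕ} {T : Set (EuclideanSpace ℝ (Fin (m + 1)))}
    (hT : RelOpen T) : T ⊆ closure (interior T) := by
  obtain ⟨O, hO, rfl⟩ := hT
  intro y hy
  rw [interior_inter, hO.interior_eq]
  exact hO.inter_closure ⟨hy.1, range_subset_closure_interior hy.2⟩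

theorem eqOn_zero_of_setIntegral_nonpos {m : ℕ} {T : Set (EuclideanSpace ℝ (Fin (m + 1)))}
    (hT : RelOpen T) {g : EuclideanSpace ℝ (Fin (m + 1)) → ℝ} (hg : ContinuousOn g T)
    (hg0 : ∀ y ∈ T, 0 ≤ g y) (hint : IntegrableOn g T) (h : ∫ y in T, g y ≤ 0) :
    ∀ y ∈ T, g y = 0 := by
  have h0 : ∫ y in T, g y = 0 := le_antisymm h (setIntegral_nonneg hT.measurableSet hg0)
  have hae := (setIntegral_eq_zero_iff_of_nonneg_ae
    ((ae_restrict_iff' hT.measurableSet).2 (Eventually.of_forall hg0)) hint).1 h0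
  exact Measure.eqOn_of_ae_eq hae hg continuousOn_const hT.subset_closure_interior

/-- The derivative of the cutoff `x ↦ (min x 0)²`. -/
theorem hasDerivAt_min_sq (x : ℝ) : HasDerivAt (fun x : ℝ => min x 0 ^ 2) (2 * min x 0) x := by
  rcases lt_trichotomy x 0 with hx | rfl | hx
  · rw [min_eq_left hx.le]
    have h1 : HasDerivAt (fun x : ℝ => x ^ 2) (2 * x) x := by simpa using hasDerivAt_pow 2 x
    refine h1.congr_of_eventuallyEq ?_
    filter_upwards [Iio_mem_nhds hx] with z hz
    rw [min_eq_left (le_of_lt hz)]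
  · rw [hasDerivAt_iff_isLittleO_nhds_zero]
    simp only [zero_add, min_self, mul_zero, smul_zero, sub_zero, ne_eq, OfNat.ofNat_ne_zero,
      not_false_eq_true, zero_pow]
    have : (fun h : ℝ => h ^ 2) =o[𝓝 0] fun h => h := by
      simpa using Asymptotics.isLittleO_pow_pow (𝕜 := ℝ) (m := 1) (n := 2) (by norm_num)
    refine Asymptotics.IsBigO.trans_isLittleO (Asymptotics.IsBigO.of_bound 1 ?_) this
    refine Eventually.of_forall fun h => ?_
    rw [one_mul, Real.norm_eq_abs, Real.norm_eq_abs, abs_pow, abs_pow]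
    gcongr 1
    rcases le_total h 0 with hh | hh
    · rw [min_eq_left hh]
    · rw [min_eq_right hh]; simp
  · rw [min_eq_right hx.le, mul_zero]
    refine (hasDerivAt_const x (0 : ℝ)).congr_of_eventuallyEq ?_
    filter_upwards [Ioi_mem_nhds hx] with z hz
    rw [min_eq_right (le_of_lt hz)]
    simp

theorem contDiff_min_sq : ContDiff ℝ 1 (fun x : ℝ => min x 0 ^ 2) := by
  rw [contDiff_one_iff_deriv]
  refine ⟨fun x => (hasDerivAt_min_sq x).differentiableAt, ?_⟩
  rw [show deriv (fun x : ℝ => min x 0 ^ 2) = fun x => 2 * min x 0 from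
    funext fun x => (hasDerivAt_min_sq x).deriv]
  fun_prop

end

section

open Filter
open scoped Topology

/-! ### The energy in a backward cone -/

section Energy

variable {m : ℕ} {T K : Set (EuclideanSpace ℝ (Fin (m + 1)))}
  {A : Fin (m + 1) → Fin (m + 1) → EuclideanSpace ℝ (Fin (m + 1)) → ℝ}
  {s φ : EuclideanSpace ℝ (Fin (m + 1)) → ℝ}

theorem pderiv_min_sq (hT : RelOpen T) (hφ : ContDiffOn ℝ 1 φ T) (c : ℝ)
    {y : EuclideanSpace ℝ (Fin (m + 1))} (hy : y ∈ T) (i : Fin (m + 1)) :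
    pderiv (fun y => min (φ y - c) 0 ^ 2) i y = 2 * min (φ y - c) 0 * pderiv φ i y := by
  have h1 := ((hφ.differentiableWithinAt_range hT hy).hasFDerivWithinAt.sub_const c)
  have h2 := (hasDerivAt_min_sq (φ y - c)).comp_hasFDerivWithinAt y h1
  rw [pderiv, show (fun y => min (φ y - c) 0 ^ 2) = (fun x : ℝ => min x 0 ^ 2) ∘ fun y => φ y - c
    from rfl, h2.fderivWithin ((𝓡∂ (m + 1)).uniqueDiffOn _ (hT.subset_range hy))]
  simp [pderiv]

/-- The energy flux inequality at a fixed time, on the slice `φ < r²` of a backward cone. Here `f`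
is the solution, `a` and `b` are its first and second time derivatives, and the integrand is the
time derivative of the energy density, cut off outside of the slice. The divergence theorem turns
the terms which have no sign into `-2 a ⟨∇φ, ∇f⟩`, which the shrinking of the slice dominates. -/
theorem integral_energy_flux_nonpos (hT : RelOpen T) (hK : IsCompact K) (hKT : K ⊆ T)
    (hA : ∀ i j, ContDiffOn ℝ ∞ (A i j) T) (hAs : ∀ i j y, A i j y = A j i y)
    (hs : ContDiffOn ℝ ∞ s T) (hs0 : ∀ y ∈ T, 0 < s y) (hφ : ContDiffOn ℝ ∞ φ T)
    (hpos : ∀ y ∈ T, ∀ ξ : Fin (m + 1) → ℝ, 0 ≤ ∑ i, ξ i * ∑ j, A i j y * ξ j)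
    (hspeed : ∀ y ∈ K, ∀ ξ : Fin (m + 1) → ℝ, |∑ i, pderiv φ i y * ∑ j, A i j y * ξ j| ≤
      4 * √(φ y) * √(∑ i, ξ i * ∑ j, A i j y * ξ j))
    {r : ℝ} (hr : 0 ≤ r) (hφK : ∀ y ∈ T, y ∉ K → r ^ 2 ≤ φ y)
    {f a b : EuclideanSpace ℝ (Fin (m + 1)) → ℝ} (hf : ContDiffOn ℝ ∞ f T)
    (ha : ContDiffOn ℝ ∞ a T)
    (hwave : ∀ y ∈ T, s y * b y =
      ∑ i, pderiv (fun y' => s y' * ∑ j, A i j y' * pderiv f j y') i y)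
    (hbdry : ∀ z, hyperplane z ∈ K →
      ∑ j, A 0 j (hyperplane z) * pderiv f j (hyperplane z) = 0) :
    ∫ y in T, (min (φ y - r ^ 2) 0 * (4 * r * s y *
        (a y ^ 2 + ∑ i, pderiv f i y * ∑ j, A i j y * pderiv f j y)) +
      min (φ y - r ^ 2) 0 ^ 2 * (s y *
        (a y * b y + ∑ i, pderiv f i y * ∑ j, A i j y * pderiv a j y))) ≤ 0 := by
  set X : Fin (m + 1) → EuclideanSpace ℝ (Fin (m + 1)) → ℝ :=
    fun i y => s y * ∑ j, A i j y * pderiv f j y with hXdef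
  set χ : EuclideanSpace ℝ (Fin (m + 1)) → ℝ := fun y => min (φ y - r ^ 2) 0 ^ 2 with hχdef
  set v : EuclideanSpace ℝ (Fin (m + 1)) → ℝ := fun y => χ y * a y with hvdef
  have hdf : ∀ i, ContDiffOn ℝ ∞ (pderiv f i) T := fun i => contDiffOn_pderiv hT hf (by simp) i
  have hda : ∀ i, ContDiffOn ℝ ∞ (pderiv a i) T := fun i => contDiffOn_pderiv hT ha (by simp) i
  have hdφ : ∀ i, ContDiffOn ℝ ∞ (pderiv φ i) T := fun i => contDiffOn_pderiv hT hφ (by simp) i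
  have hX : ∀ i, ContDiffOn ℝ ∞ (X i) T := fun i =>
    hs.mul (ContDiffOn.sum fun j _ => (hA i j).mul (hdf j))
  have hφ1 : ContDiffOn ℝ 1 φ T := hφ.of_le (by simp)
  have hχ1 : ContDiffOn ℝ 1 χ T :=
    contDiff_min_sq.comp_contDiffOn (hφ1.sub contDiffOn_const)
  have ha1 : ContDiffOn ℝ 1 a T := ha.of_le (by simp)
  have hX1 : ∀ i, ContDiffOn ℝ 1 (X i) T := fun i => (hX i).of_le (by simp)
  have hv : ContDiffOn ℝ 1 v T := hχ1.mul ha1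
  have hmin0 : ∀ y ∈ T, y ∉ K → min (φ y - r ^ 2) 0 = 0 := fun y hy hyK =>
    min_eq_right (by linarith [hφK y hy hyK])
  have hvK : ∀ y ∈ T, y ∉ K → v y = 0 := fun y hy hyK => by
    simp [hvdef, hχdef, hmin0 y hy hyK]
  have hgreen := green_halfSpace hT hK hKT hv hX1 hvK
  have hb0 : ∫ z in hyperplane ⁻¹' T, v (hyperplane z) * X 0 (hyperplane z) = 0 := by
    refine setIntegral_eq_zero_of_forall_eq_zero fun z hz => ?_
    by_cases hzK : hyperplane z ∈ K
    · simp [hXdef, hbdry z hzK]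
    · simp [hvK _ hz hzK]
  rw [hb0, sub_zero] at hgreen
  have hcv : ContinuousOn v T := hv.continuousOn
  have hcX : ∀ i, ContinuousOn (X i) T := fun i => (hX i).continuousOn
  have hcdX : ∀ i, ContinuousOn (pderiv (X i) i) T := fun i =>
    (contDiffOn_pderiv (k := 0) hT (hX1 i) (by simp) i).continuousOn
  have hcdv : ∀ i, ContinuousOn (pderiv v i) T := fun i =>
    (contDiffOn_pderiv (k := 0) hT hv (by simp) i).continuousOn
  have hcm : ContinuousOn (fun y => min (φ y - r ^ 2) 0) T :=
    (continuous_id.min continuous_const).comp_continuousOn (hφ.continuousOn.sub continuousOn_const)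
  have hi1 : IntegrableOn (fun y => v y * ∑ i, pderiv (X i) i y) T :=
    integrableOn_of_compact_support hT.measurableSet hK hKT
      (hcv.mul (continuousOn_finsetSum _ fun i _ => hcdX i))
      fun y hy hyK => by simp [hvK y hy hyK]
  have hi2 : IntegrableOn (fun y => ∑ i, pderiv v i y * X i y) T :=
    integrableOn_of_compact_support hT.measurableSet hK hKT
      (continuousOn_finsetSum _ fun i _ => (hcdv i).mul (hcX i))
      fun y hy hyK => Finset.sum_eq_zero fun i _ => by
        rw [pderiv_eq_zero_of_notMem hT hK.isClosed hvK hy hyK, zero_mul]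
  set R : EuclideanSpace ℝ (Fin (m + 1)) → ℝ := fun y => min (φ y - r ^ 2) 0 *
    (4 * r * s y * (a y ^ 2 + ∑ i, pderiv f i y * ∑ j, A i j y * pderiv f j y) -
      2 * (a y * s y) * ∑ i, pderiv φ i y * ∑ j, A i j y * pderiv f j y) with hRdef
  have hi3 : IntegrableOn R T := by
    refine integrableOn_of_compact_support hT.measurableSet hK hKT ?_
      fun y hy hyK => by simp [hRdef, hmin0 y hy hyK]
    have e1 : ∀ i, ContinuousOn (fun y => ∑ j, A i j y * pderiv f j y) T := fun i =>
      continuousOn_finsetSum _ fun j _ => (hA i j).continuousOn.mul (hdf j).continuousOn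
    refine hcm.mul (ContinuousOn.sub ?_ ?_)
    · exact (continuousOn_const.mul hs.continuousOn).mul ((ha.continuousOn.pow 2).add
        (continuousOn_finsetSum _ fun i _ => (hdf i).continuousOn.mul (e1 i)))
    · exact (continuousOn_const.mul (ha.continuousOn.mul hs.continuousOn)).mul
        (continuousOn_finsetSum _ fun i _ => (hdφ i).continuousOn.mul (e1 i))
  have hsplit : ∫ y in T, (min (φ y - r ^ 2) 0 * (4 * r * s y *
        (a y ^ 2 + ∑ i, pderiv f i y * ∑ j, A i j y * pderiv f j y)) +
      min (φ y - r ^ 2) 0 ^ 2 * (s y *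
        (a y * b y + ∑ i, pderiv f i y * ∑ j, A i j y * pderiv a j y))) =
      ∫ y in T, ((v y * ∑ i, pderiv (X i) i y) + (∑ i, pderiv v i y * X i y) + R y) := by
    refine setIntegral_congr_fun hT.measurableSet fun y hy => ?_
    have e1 : ∑ i, pderiv (X i) i y = s y * b y := (hwave y hy).symm
    have e2 : ∑ i, pderiv v i y * X i y =
        2 * min (φ y - r ^ 2) 0 * (a y * s y) *
          (∑ i, pderiv φ i y * ∑ j, A i j y * pderiv f j y) +
        χ y * s y * ∑ i, pderiv a i y * ∑ j, A i j y * pderiv f j y := by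
      rw [Finset.mul_sum, Finset.mul_sum, ← Finset.sum_add_distrib]
      refine Finset.sum_congr rfl fun i _ => ?_
      rw [hvdef, pderiv_mul hT hχ1 ha1 hy, hχdef, pderiv_min_sq hT hφ1 _ hy]
      simp only [hXdef]
      ring
    have e3 : ∑ i, pderiv f i y * ∑ j, A i j y * pderiv a j y =
        ∑ i, pderiv a i y * ∑ j, A i j y * pderiv f j y := by
      simp_rw [Finset.mul_sum]
      rw [Finset.sum_comm]
      refine Finset.sum_congr rfl fun i _ => Finset.sum_congr rfl fun j _ => ?_
      rw [hAs j i]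
      ring
    simp only [e1, e2, e3]
    simp only [hRdef, hvdef, hχdef]
    ring
  have hi12 : IntegrableOn (fun y => (v y * ∑ i, pderiv (X i) i y) + ∑ i, pderiv v i y * X i y) T :=
    hi1.add hi2
  rw [hsplit, integral_add hi12 hi3, integral_add hi1 hi2, hgreen, neg_add_cancel,
    zero_add]
  refine setIntegral_nonpos hT.measurableSet fun y hy => ?_
  by_cases hlt : φ y - r ^ 2 < 0
  · refine mul_nonpos_of_nonpos_of_nonneg (min_le_right _ _) ?_
    have hyK : y ∈ K := by
      by_contra hyK
      linarith [hφK y hy hyK]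
    have hsp := hspeed y hyK fun j => pderiv f j y
    have hq := hpos y hy fun j => pderiv f j y
    set q := ∑ i, pderiv f i y * ∑ j, A i j y * pderiv f j y
    set d := ∑ i, pderiv φ i y * ∑ j, A i j y * pderiv f j y
    have hsq : √(φ y) ≤ r := by
      rw [Real.sqrt_le_left hr]; linarith
    have hs1 := hs0 y hy
    have hd : |d| ≤ 4 * r * √q := hsp.trans (by gcongr)
    have hq2 : √q ^ 2 = q := Real.sq_sqrt hq
    have h3 : 2 * (a y * s y) * d ≤ 2 * (|a y| * s y) * (4 * r * √q) := by
      calc 2 * (a y * s y) * d ≤ |2 * (a y * s y) * d| := le_abs_self _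
        _ = 2 * (|a y| * s y) * |d| := by
          rw [abs_mul, abs_mul, abs_mul, abs_of_pos hs1]; norm_num
        _ ≤ _ := by gcongr
    have h4 : 2 * |a y| * √q ≤ a y ^ 2 + q := by
      have := two_mul_le_add_sq (|a y|) (√q)
      rwa [sq_abs, hq2] at this
    have h5 : 2 * (|a y| * s y) * (4 * r * √q) ≤ 4 * r * s y * (a y ^ 2 + q) := by
      calc _ = 4 * r * s y * (2 * |a y| * √q) := by ring
        _ ≤ _ := by gcongr
    linarith
  · rw [hRdef]
    simp only
    rw [min_eq_right (not_lt.1 hlt), zero_mul]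

end Energy

end

section

open Filter
open scoped Topology

section Energy

variable {m : ℕ} {T K : Set (EuclideanSpace ℝ (Fin (m + 1)))}
  {A : Fin (m + 1) → Fin (m + 1) → EuclideanSpace ℝ (Fin (m + 1)) → ℝ}
  {s φ : EuclideanSpace ℝ (Fin (m + 1)) → ℝ}
  {w : EuclideanSpace ℝ (Fin (m + 1)) × ℝ → ℝ}

/-- A solution of the wave equation with homogeneous Neumann condition whose Cauchy data at time
`t₀` vanish where `φ < ρ²` has vanishing velocity in the cone `φ < (ρ - 2 (t - t₀))²`. -/
theorem timeDeriv_eq_zero_of_cone (hT : RelOpen T) (hK : IsCompact K) (hKT : K ⊆ T)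
    (hA : ∀ i j, ContDiffOn ℝ ∞ (A i j) T) (hAs : ∀ i j y, A i j y = A j i y)
    (hs : ContDiffOn ℝ ∞ s T) (hs0 : ∀ y ∈ T, 0 < s y) (hφ : ContDiffOn ℝ ∞ φ T)
    (hpos : ∀ y ∈ T, ∀ ξ : Fin (m + 1) → ℝ, 0 ≤ ∑ i, ξ i * ∑ j, A i j y * ξ j)
    (hspeed : ∀ y ∈ K, ∀ ξ : Fin (m + 1) → ℝ, |∑ i, pderiv φ i y * ∑ j, A i j y * ξ j| ≤
      4 * √(φ y) * √(∑ i, ξ i * ∑ j, A i j y * ξ j))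
    (hw : ContDiffOn ℝ ∞ w (T ×ˢ Ici 0)) {t₀ h ρ : ℝ} (ht₀ : 0 ≤ t₀) (hρ : 2 * h ≤ ρ)
    (hφK : ∀ y ∈ T, y ∉ K → ρ ^ 2 ≤ φ y)
    (hwave : ∀ y ∈ T, ∀ t, 0 < t → s y * timeDeriv (timeDeriv w) (y, t) =
      ∑ i, pderiv (fun y' => s y' * ∑ j, A i j y' * pderiv (fun y => w (y, t)) j y') i y)
    (hbdry : ∀ z, hyperplane z ∈ K → ∀ t ∈ Ioc t₀ (t₀ + h),
      ∑ j, A 0 j (hyperplane z) * pderiv (fun y => w (y, t)) j (hyperplane z) = 0)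
    (hinit : ∀ y ∈ T, φ y < ρ ^ 2 → w (y, t₀) = 0 ∧ timeDeriv w (y, t₀) = 0) :
    ∀ y ∈ T, ∀ t ∈ Icc t₀ (t₀ + h), φ y < (ρ - 2 * (t - t₀)) ^ 2 → timeDeriv w (y, t) = 0 := by
  intro y₁ hy₁ τ hτ hφτ
  set r : ℝ → ℝ := fun t => ρ - 2 * (t - t₀) with hr
  have hr0 : ∀ t ∈ Icc t₀ (t₀ + h), 0 ≤ r t := fun t ht => by
    simp only [hr]; linarith [ht.2]
  have hrρ : ∀ t ∈ Icc t₀ (t₀ + h), r t ^ 2 ≤ ρ ^ 2 := fun t ht => by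
    have := hr0 t ht
    have h2 : r t ≤ ρ := by simp only [hr]; linarith [ht.1]
    gcongr
  have hwt := contDiffOn_timeDeriv hT hw
  have hwtt := contDiffOn_timeDeriv hT hwt
  have hwx := contDiffOn_spaceDeriv hT hw
  have hwxt := fun i => contDiffOn_timeDeriv hT (hwx i)
  set q : EuclideanSpace ℝ (Fin (m + 1)) × ℝ → ℝ := fun p =>
    ∑ i, spaceDeriv w i p * ∑ j, A i j p.1 * spaceDeriv w j p with hq
  set q' : EuclideanSpace ℝ (Fin (m + 1)) × ℝ → ℝ := fun p =>
    ∑ i, spaceDeriv w i p * ∑ j, A i j p.1 * timeDeriv (spaceDeriv w j) p with hq'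
  -- twice the energy density, cut off outside of the cone, and half of its time derivative
  set G : EuclideanSpace ℝ (Fin (m + 1)) × ℝ → ℝ := fun p =>
    min (φ p.1 - r p.2 ^ 2) 0 ^ 2 * (s p.1 * (timeDeriv w p ^ 2 + q p)) with hG
  set G' : EuclideanSpace ℝ (Fin (m + 1)) × ℝ → ℝ := fun p =>
    min (φ p.1 - r p.2 ^ 2) 0 * (4 * r p.2 * s p.1 * (timeDeriv w p ^ 2 + q p)) +
      min (φ p.1 - r p.2 ^ 2) 0 ^ 2 *
        (s p.1 * (timeDeriv w p * timeDeriv (timeDeriv w) p + q' p)) with hG'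
  have hmT : MapsTo Prod.fst (T ×ˢ Ici (0 : ℝ)) T := fun p hp => hp.1
  have cA : ∀ i j, ContinuousOn (fun p : EuclideanSpace ℝ (Fin (m + 1)) × ℝ => A i j p.1)
      (T ×ˢ Ici 0) := fun i j => (hA i j).continuousOn.comp continuousOn_fst hmT
  have cs : ContinuousOn (fun p : EuclideanSpace ℝ (Fin (m + 1)) × ℝ => s p.1) (T ×ˢ Ici 0) :=
    hs.continuousOn.comp continuousOn_fst hmT
  have cφ : ContinuousOn (fun p : EuclideanSpace ℝ (Fin (m + 1)) × ℝ => φ p.1) (T ×ˢ Ici 0) :=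
    hφ.continuousOn.comp continuousOn_fst hmT
  have cr : ContinuousOn (fun p : EuclideanSpace ℝ (Fin (m + 1)) × ℝ => r p.2) (T ×ˢ Ici 0) := by
    simp only [hr]; fun_prop
  have cmin : ContinuousOn (fun p : EuclideanSpace ℝ (Fin (m + 1)) × ℝ =>
      min (φ p.1 - r p.2 ^ 2) 0) (T ×ˢ Ici 0) :=
    (continuous_id.min continuous_const).comp_continuousOn (cφ.sub (cr.pow 2))
  have cq : ContinuousOn q (T ×ˢ Ici 0) := continuousOn_finsetSum _ fun i _ =>
    (hwx i).continuousOn.mul (continuousOn_finsetSum _ fun j _ =>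
      (cA i j).mul (hwx j).continuousOn)
  have cq' : ContinuousOn q' (T ×ˢ Ici 0) := continuousOn_finsetSum _ fun i _ =>
    (hwx i).continuousOn.mul (continuousOn_finsetSum _ fun j _ =>
      (cA i j).mul (hwxt j).continuousOn)
  have cG : ContinuousOn G (T ×ˢ Ici 0) :=
    (cmin.pow 2).mul (cs.mul ((hwt.continuousOn.pow 2).add cq))
  have cG' : ContinuousOn G' (T ×ˢ Ici 0) :=
    (cmin.mul (((continuousOn_const.mul cr).mul cs).mul ((hwt.continuousOn.pow 2).add cq))).add
      ((cmin.pow 2).mul (cs.mul ((hwt.continuousOn.mul hwtt.continuousOn).add cq')))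
  have dG : ∀ y ∈ T, ∀ t, 0 < t → HasDerivAt (fun t => G (y, t)) (2 * G' (y, t)) t := by
    intro y hy t ht
    have hnhds := Ici_mem_nhds ht
    have d1 := (hasDerivWithinAt_timeDeriv hT hwt hy ht.le).hasDerivAt hnhds
    have d2 := fun i => (hasDerivWithinAt_timeDeriv hT (hwx i) hy ht.le).hasDerivAt hnhds
    have d3 : HasDerivAt (fun t => q (y, t)) (2 * q' (y, t)) t := by
      have e1 := HasDerivAt.fun_sum (u := Finset.univ) fun i _ => (d2 i).mul
        (HasDerivAt.fun_sum (u := Finset.univ) fun j _ => (d2 j).const_mul (A i j y))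
      refine e1.congr_deriv ?_
      simp only [hq']
      rw [Finset.sum_add_distrib, two_mul]
      congr 1
      simp_rw [Finset.mul_sum]
      rw [Finset.sum_comm]
      refine Finset.sum_congr rfl fun i _ => Finset.sum_congr rfl fun j _ => ?_
      rw [hAs j i]
      ring
    have dr : HasDerivAt r (-2) t := by
      have := ((((hasDerivAt_id t).sub_const t₀).const_mul 2).const_sub ρ)
      simpa [hr] using this
    have d4 : HasDerivAt (fun t => min (φ y - r t ^ 2) 0 ^ 2)
        (2 * min (φ y - r t ^ 2) 0 * (4 * r t)) t := by
      have e1 := (hasDerivAt_min_sq (φ y - r t ^ 2)).comp t ((dr.pow 2).const_sub (φ y))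
      refine e1.congr_deriv ?_
      push_cast
      ring
    have e2 := d4.mul (((d1.pow 2).add d3).const_mul (s y))
    refine e2.congr_deriv ?_
    simp only [hG', Pi.add_apply, Pi.pow_apply]
    ring
  have hG0 : ∀ y ∈ T, G (y, t₀) = 0 := by
    intro y hy
    have hrt : r t₀ = ρ := by simp [hr]
    simp only [hG, hrt]
    by_cases hlt : φ y < ρ ^ 2
    · have hw0 : ∀ i, spaceDeriv w i (y, t₀) = 0 := fun i => by
        rw [← pderiv_slice hT hw hy ht₀]
        have : (fun y => w (y, t₀)) =ᶠ[𝓝[range (𝓡∂ (m + 1))] y] fun _ => 0 := by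
          have hev : ∀ᶠ y' in 𝓝[range (𝓡∂ (m + 1))] y, φ y' < ρ ^ 2 := by
            have := hφ.continuousOn y hy
            rw [ContinuousWithinAt, hT.nhdsWithin_eq hy] at this
            exact this.eventually (gt_mem_nhds hlt)
          filter_upwards [hev, hT.mem_nhdsWithin hy] with y' h1 h2 using (hinit y' h2 h1).1
        rw [pderiv_congr this (hT.subset_range hy)]
        simp [pderiv]
      simp [hq, hw0, (hinit y hy hlt).2]
    · rw [min_eq_right (by linarith)]
      simp
  have hmin0 : ∀ t ∈ Icc t₀ (t₀ + h), ∀ y ∈ T, y ∉ K → min (φ y - r t ^ 2) 0 = 0 :=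
    fun t ht y hy hyK => min_eq_right (by linarith [hφK y hy hyK, hrρ t ht])
  have hflux : ∀ t ∈ Ioc t₀ τ, ∫ y in K, G' (y, t) ≤ 0 := by
    intro t ht
    have ht' : t ∈ Icc t₀ (t₀ + h) := ⟨ht.1.le, ht.2.trans hτ.2⟩
    have ht0 : 0 < t := ht₀.trans_lt ht.1
    have hmain := integral_energy_flux_nonpos hT hK hKT hA hAs hs hs0 hφ hpos hspeed (hr0 t ht')
      (fun y hy hyK => (hrρ t ht').trans (hφK y hy hyK)) (contDiffOn_slice hw ht0.le)
      (contDiffOn_slice hwt ht0.le) (b := fun y => timeDeriv (timeDeriv w) (y, t))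
      (fun y hy => hwave y hy t ht0) (fun z hz => hbdry z hz t ⟨ht.1, ht'.2⟩)
    refine le_of_eq_of_le ?_ hmain
    rw [setIntegral_eq_of_subset_of_forall_sdiff_eq_zero hT.measurableSet hKT]
    · refine setIntegral_congr_fun hK.measurableSet fun y hyK => ?_
      have hy := hKT hyK
      simp only [hG', hq, hq', ← pderiv_slice hT hw hy ht0.le]
      simp only [← spaceDeriv_timeDeriv hT hw (p := (y, t)) ⟨hy, ht0.le⟩,
        ← pderiv_slice hT hwt hy ht0.le]
    · intro y hy
      simp [hmin0 t ht' y hy.1 hy.2]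
  have hFTC : ∀ y ∈ K, ∫ t in Ioc t₀ τ, G' (y, t) = 1 / 2 * G (y, τ) := by
    intro y hy
    have hyT := hKT hy
    have hsub : MapsTo (fun t : ℝ => (y, t)) (Icc t₀ τ) (T ×ˢ Ici 0) :=
      fun t ht => ⟨hyT, ht₀.trans ht.1⟩
    have hcy : Continuous fun t : ℝ => (y, t) := by fun_prop
    have e1 := intervalIntegral.integral_eq_sub_of_hasDerivAt_of_le hτ.1
      (cG.comp hcy.continuousOn hsub) (fun t ht => dG y hyT t (ht₀.trans_lt ht.1))
      (((cG'.comp hcy.continuousOn hsub).const_smul (2 : ℝ)).intervalIntegrable_of_Icc hτ.1)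
    rw [intervalIntegral.integral_of_le hτ.1, integral_const_mul] at e1
    simp only [Function.comp, hG0 y hyT, sub_zero] at e1
    linarith
  -- exchange the integrals over space and time, and use the flux inequality at each time
  have hle : ∫ y in K, 1 / 2 * G (y, τ) ≤ 0 := by
    rw [← setIntegral_congr_fun hK.measurableSet hFTC, integral_integral_swap]
    · exact setIntegral_nonpos measurableSet_Ioc hflux
    · rw [Measure.prod_restrict]
      refine IntegrableOn.mono_set (t := K ×ˢ Icc t₀ τ) ?_ (prod_mono le_rfl Ioc_subset_Icc_self)
      exact (cG'.mono (prod_mono hKT fun t ht => ht₀.trans ht.1)).integrableOn_compact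
        (hK.prod isCompact_Icc)
  have hcτ : ContinuousOn (fun y => 1 / 2 * G (y, τ)) T :=
    continuousOn_const.mul (cG.comp (by fun_prop) fun y hy => ⟨hy, ht₀.trans hτ.1⟩)
  have hGK : ∀ y ∈ T, y ∉ K → 1 / 2 * G (y, τ) = 0 := fun y hy hyK => by
    simp [hG, hmin0 τ hτ y hy hyK]
  have hle' : ∫ y in T, 1 / 2 * G (y, τ) ≤ 0 := by
    rwa [setIntegral_eq_of_subset_of_forall_sdiff_eq_zero hT.measurableSet hKT
      fun y hy => hGK y hy.1 hy.2]
  have hqpos : ∀ y ∈ T, 0 ≤ q (y, τ) := fun y hy => hpos y hy fun j => spaceDeriv w j (y, τ)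
  have hzero := eqOn_zero_of_setIntegral_nonpos hT hcτ
    (fun y hy => by
      have := hs0 y hy
      have := hqpos y hy
      simp only [hG]
      positivity)
    (integrableOn_of_compact_support hT.measurableSet hK hKT hcτ hGK) hle' y₁ hy₁
  have hs1 := hs0 y₁ hy₁
  have hq1 := hqpos y₁ hy₁
  have hneg : min (φ y₁ - r τ ^ 2) 0 ≠ 0 := by
    have : φ y₁ - r τ ^ 2 < 0 := sub_neg.2 hφτ
    rw [min_eq_left this.le]
    exact this.ne
  simp only [hG] at hzero
  have h1 : timeDeriv w (y₁, τ) ^ 2 + q (y₁, τ) = 0 := by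
    have : 1 / 2 * (min (φ y₁ - r τ ^ 2) 0 ^ 2 * s y₁) *
      (timeDeriv w (y₁, τ) ^ 2 + q (y₁, τ)) = 0 := by linarith
    rcases mul_eq_zero.1 this with h2 | h2
    · exact absurd h2 (by positivity)
    · exact h2
  exact pow_eq_zero_iff two_ne_zero |>.1 (by nlinarith [sq_nonneg (timeDeriv w (y₁, τ))])

end Energy

end

section

open Filter
open scoped Topology

/-! ### Solutions in a chart -/

section Boundary

variable {m : ℕ} {M : Type*} [TopologicalSpace M] [ChartedSpace (EuclideanHalfSpace (m + 1)) M]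

theorem contDiffOn_comp_time {u : M × ℝ → ℝ}
    (hu : ContMDiffOn ((𝓡∂ (m + 1)).prod 𝓘(ℝ, ℝ)) 𝓘(ℝ, ℝ) ∞ u (univ ×ˢ Ici 0)) (x : M) :
    ContDiffOn ℝ ∞ (fun t => u (x, t)) (Ici 0) := by
  rw [← contMDiffOn_iff_contDiffOn]
  exact hu.comp (contMDiff_const.prodMk contMDiff_id).contMDiffOn fun t ht => ⟨mem_univ _, ht⟩

variable [IsManifold (𝓡∂ (m + 1)) ∞ M]

theorem mem_boundary_iff {x₀ x : M} (hx : x ∈ (extChartAt (𝓡∂ (m + 1)) x₀).source) :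
    x ∈ (𝓡∂ (m + 1)).boundary M ↔ extChartAt (𝓡∂ (m + 1)) x₀ x 0 = 0 := by
  rw [extChartAt_source] at hx
  have h1 := (𝓡∂ (m + 1)).isInteriorPoint_iff_of_mem_atlas (n := ∞) (by simp)
    (chart_mem_atlas (EuclideanHalfSpace (m + 1)) x₀) hx
  have h2 : extChartAt (𝓡∂ (m + 1)) x₀ x ∈ (extChartAt (𝓡∂ (m + 1)) x₀).target :=
    (extChartAt (𝓡∂ (m + 1)) x₀).map_source (by rwa [extChartAt_source])
  change (𝓡∂ (m + 1)).IsInteriorPoint x ↔ _ at h1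
  rw [← not_iff_not, ← (𝓡∂ (m + 1)).compl_interior, mem_compl_iff, not_not]
  refine h1.trans ?_
  change extChartAt (𝓡∂ (m + 1)) x₀ x ∈ interior (extChartAt (𝓡∂ (m + 1)) x₀).target ↔ _
  obtain ⟨O, hO, hT⟩ := relOpen_target (m := m) x₀
  rw [hT] at h2 ⊢
  rw [interior_inter, hO.interior_eq, interior_range_modelWithCornersEuclideanHalfSpace]
  have h3 := mem_range_halfSpace.1 h2.2
  exact ⟨fun h => h.2.ne', fun h => ⟨h2.1, lt_of_le_of_ne h3 (Ne.symm h)⟩⟩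

theorem symm_mem_boundary_iff {x₀ : M} {y : EuclideanSpace ℝ (Fin (m + 1))}
    (hy : y ∈ (extChartAt (𝓡∂ (m + 1)) x₀).target) :
    (extChartAt (𝓡∂ (m + 1)) x₀).symm y ∈ (𝓡∂ (m + 1)).boundary M ↔ y 0 = 0 := by
  rw [mem_boundary_iff ((extChartAt (𝓡∂ (m + 1)) x₀).map_target hy),
    (extChartAt (𝓡∂ (m + 1)) x₀).right_inv hy]

theorem contDiffOn_comp_symm {u : M × ℝ → ℝ}
    (hu : ContMDiffOn ((𝓡∂ (m + 1)).prod 𝓘(ℝ, ℝ)) 𝓘(ℝ, ℝ) ∞ u (univ ×ˢ Ici 0)) (x₀ : M) :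
    ContDiffOn ℝ ∞ (fun p : EuclideanSpace ℝ (Fin (m + 1)) × ℝ =>
      u ((extChartAt (𝓡∂ (m + 1)) x₀).symm p.1, p.2))
      ((extChartAt (𝓡∂ (m + 1)) x₀).target ×ˢ Ici 0) := by
  rw [← contMDiffOn_iff_contDiffOn]
  refine hu.comp ?_ fun p hp => ⟨mem_univ _, hp.2⟩
  exact ContMDiffOn.prodMk ((contMDiffOn_extChartAt_symm x₀).comp
    contDiff_fst.contMDiff.contMDiffOn fun p hp => hp.1) contDiff_snd.contMDiff.contMDiffOn

theorem contDiffOn_comp_symm_slice {u : M × ℝ → ℝ}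
    (hu : ContMDiffOn ((𝓡∂ (m + 1)).prod 𝓘(ℝ, ℝ)) 𝓘(ℝ, ℝ) ∞ u (univ ×ˢ Ici 0)) (x₀ : M)
    {t : ℝ} (ht : 0 ≤ t) :
    ContDiffOn ℝ ∞ ((fun x => u (x, t)) ∘ (extChartAt (𝓡∂ (m + 1)) x₀).symm)
      (extChartAt (𝓡∂ (m + 1)) x₀).target :=
  contDiffOn_slice (contDiffOn_comp_symm hu x₀) ht

end Boundary

section Chart

variable {m : ℕ} {M : Type*} [TopologicalSpace M] [ChartedSpace (EuclideanHalfSpace (m + 1)) M]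
  [RiemannianBundle (fun x : M => TangentSpace (𝓡∂ (m + 1)) x)]

theorem gram_inv_comm (x₀ : M) (y : EuclideanSpace ℝ (Fin (m + 1))) (i j : Fin (m + 1)) :
    (gram x₀ y)⁻¹ i j = (gram x₀ y)⁻¹ j i := by
  have h1 : (gram x₀ y).transpose = gram x₀ y := by
    ext i j; exact gram_comm x₀ y j i
  have h2 : ((gram x₀ y)⁻¹).transpose = (gram x₀ y)⁻¹ := by
    rw [Matrix.transpose_nonsing_inv, h1]
  conv_lhs => rw [← h2]
  rfl

variable [IsManifold (𝓡∂ (m + 1)) ∞ M]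

theorem gram_inv_diag_pos (x₀ : M) {y : EuclideanSpace ℝ (Fin (m + 1))}
    (hy : y ∈ (extChartAt (𝓡∂ (m + 1)) x₀).target) (i : Fin (m + 1)) :
    0 < (gram x₀ y)⁻¹ i i :=
  (posDef_gram x₀ hy).inv.diag_pos

/-- The inverse metric is the square of the norm of the vector dual to a covector. -/
theorem sum_gram_inv_eq_norm_sq (x₀ : M) {y : EuclideanSpace ℝ (Fin (m + 1))}
    (hy : y ∈ (extChartAt (𝓡∂ (m + 1)) x₀).target) (ξ : Fin (m + 1) → ℝ) :
    ∑ i, ξ i * ∑ j, (gram x₀ y)⁻¹ i j * ξ j =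
      ‖symmDeriv x₀ y (WithLp.toLp 2 ((gram x₀ y)⁻¹.mulVec ξ))‖ ^ 2 := by
  have h0 : (gram x₀ y).mulVec ((gram x₀ y)⁻¹.mulVec ξ) = ξ := by
    rw [Matrix.mulVec_mulVec, Matrix.mul_nonsing_inv _ (det_gram_pos x₀ hy).ne'.isUnit,
      Matrix.one_mulVec]
  rw [norm_symmDeriv_sq]
  refine Finset.sum_congr rfl fun i _ => ?_
  have h1 : ξ i = ∑ j, gram x₀ y i j * (gram x₀ y)⁻¹.mulVec ξ j := congrFun h0.symm i
  have h2 : ∑ j, (gram x₀ y)⁻¹.mulVec ξ i * gram x₀ y i j * (gram x₀ y)⁻¹.mulVec ξ j =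
      (gram x₀ y)⁻¹.mulVec ξ i * ξ i := by
    simp_rw [mul_assoc]
    rw [← Finset.mul_sum, ← h1]
  exact (mul_comm _ _).trans h2.symm

variable {F u : M × ℝ → ℝ}

theorem IsSolution.sqrt_det_mul_timeDeriv (hu : IsSolution m F u) (x₀ : M)
    {y : EuclideanSpace ℝ (Fin (m + 1))} (hy : y ∈ (extChartAt (𝓡∂ (m + 1)) x₀).target)
    {t : ℝ} (ht : 0 < t) :
    √(gram x₀ y).det * timeDeriv (timeDeriv fun p : EuclideanSpace ℝ (Fin (m + 1)) × ℝ =>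
      u ((extChartAt (𝓡∂ (m + 1)) x₀).symm p.1, p.2)) (y, t) =
    ∑ i, pderiv (fun y' => √(gram x₀ y').det * gradCoord x₀ (fun x => u (x, t)) i y') i y := by
  set w := fun p : EuclideanSpace ℝ (Fin (m + 1)) × ℝ =>
      u ((extChartAt (𝓡∂ (m + 1)) x₀).symm p.1, p.2) with hw
  have hT := relOpen_target (m := m) x₀
  have hws := contDiffOn_comp_symm hu.smooth x₀
  have h1 := hu.wave x₀ _ ((extChartAt (𝓡∂ (m + 1)) x₀).map_target hy) t ht
  rw [(extChartAt (𝓡∂ (m + 1)) x₀).right_inv hy, laplacian] at h1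
  have hd : ∀ τ, 0 < τ → HasDerivAt (fun τ => w (y, τ)) (timeDeriv w (y, τ)) τ := fun τ hτ =>
    (hasDerivWithinAt_timeDeriv hT hws hy hτ.le).hasDerivAt (Ici_mem_nhds hτ)
  have h2 : iteratedDeriv 2 (fun τ => u ((extChartAt (𝓡∂ (m + 1)) x₀).symm y, τ)) t =
      timeDeriv (timeDeriv w) (y, t) := by
    rw [iteratedDeriv_succ, iteratedDeriv_one]
    have : deriv (fun τ => u ((extChartAt (𝓡∂ (m + 1)) x₀).symm y, τ)) =ᶠ[𝓝 t]
        fun τ => timeDeriv w (y, τ) := by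
      filter_upwards [Ioi_mem_nhds ht] with τ hτ using (hd τ hτ).deriv
    rw [this.deriv_eq]
    exact ((hasDerivWithinAt_timeDeriv hT (contDiffOn_timeDeriv hT hws) hy ht.le).hasDerivAt
      (Ici_mem_nhds ht)).deriv
  rw [← h2, h1, ← mul_assoc, mul_inv_cancel₀ (Real.sqrt_ne_zero'.2 (det_gram_pos x₀ hy)), one_mul]

theorem IsSolution.gradCoord_zero (hu : IsSolution m F u) (x₀ : M)
    {y : EuclideanSpace ℝ (Fin (m + 1))} (hy : y ∈ (extChartAt (𝓡∂ (m + 1)) x₀).target)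
    (hy0 : y 0 = 0) {t : ℝ} (ht : 0 < t) :
    gradCoord x₀ (fun x => u (x, t)) 0 y =
      -(√((gram x₀ y)⁻¹ 0 0) * F ((extChartAt (𝓡∂ (m + 1)) x₀).symm y, t)) := by
  have h1 := hu.neumann x₀ _ ((extChartAt (𝓡∂ (m + 1)) x₀).map_target hy)
    ((symm_mem_boundary_iff hy).2 hy0) t ht
  rw [(extChartAt (𝓡∂ (m + 1)) x₀).right_inv hy, normalDeriv] at h1
  rw [← h1]
  have := Real.sqrt_ne_zero'.2 (gram_inv_diag_pos x₀ hy 0)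
  field_simp

end Chart

end

section

open Filter
open scoped Topology

/-! ### Local uniqueness -/

theorem sum_pderiv_mul {m : ℕ} (φ : EuclideanSpace ℝ (Fin (m + 1)) → ℝ)
    (y : EuclideanSpace ℝ (Fin (m + 1))) (n : Fin (m + 1) → ℝ) :
    ∑ i, pderiv φ i y * n i = fderivWithin ℝ φ (range (𝓡∂ (m + 1))) y (WithLp.toLp 2 n) := by
  have hv : WithLp.toLp 2 n = ∑ i, n i • EuclideanSpace.single i (1 : ℝ) := by
    ext j
    simp [Finset.sum_apply, Pi.single_apply]
  rw [hv, map_sum]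
  exact Finset.sum_congr rfl fun i _ => by rw [map_smul, smul_eq_mul, mul_comm]; rfl

section

variable {m : ℕ} {M : Type*} [TopologicalSpace M] [ChartedSpace (EuclideanHalfSpace (m + 1)) M]
  [RiemannianBundle (fun x : M => TangentSpace (𝓡∂ (m + 1)) x)]

theorem contDiff_norm_symmDeriv_sq (x₀ : M) (y₀ q : EuclideanSpace ℝ (Fin (m + 1))) :
    ContDiff ℝ ∞ fun y => ‖symmDeriv x₀ y₀ (y - q)‖ ^ 2 := by
  simp_rw [norm_symmDeriv_sq]
  refine ContDiff.sum fun i _ => ContDiff.sum fun j _ => ?_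
  have h : ∀ i, ContDiff ℝ ∞ fun y : EuclideanSpace ℝ (Fin (m + 1)) => (y - q) i := fun i => by
    simp only [PiLp.sub_apply]
    fun_prop
  exact ((h i).mul contDiff_const).mul (h j)

theorem fderivWithin_norm_symmDeriv_sq (x₀ : M) (y₀ q v : EuclideanSpace ℝ (Fin (m + 1)))
    {y : EuclideanSpace ℝ (Fin (m + 1))} (hy : y ∈ range (𝓡∂ (m + 1))) :
    fderivWithin ℝ (fun y => ‖symmDeriv x₀ y₀ (y - q)‖ ^ 2) (range (𝓡∂ (m + 1))) y v =
      2 * inner ℝ (symmDeriv x₀ y₀ (y - q)) (symmDeriv x₀ y₀ v) := by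
  have hd : DifferentiableAt ℝ (fun y => ‖symmDeriv x₀ y₀ (y - q)‖ ^ 2) y :=
    (contDiff_norm_symmDeriv_sq x₀ y₀ q).differentiable (by simp) y
  rw [fderivWithin_eq_fderiv ((𝓡∂ (m + 1)).uniqueDiffOn y hy) hd, ← hd.lineDeriv_eq_fderiv]
  rw [lineDeriv]
  have h : (fun t : ℝ => ‖symmDeriv x₀ y₀ (y + t • v - q)‖ ^ 2) = fun t =>
      ‖symmDeriv x₀ y₀ (y - q)‖ ^ 2 +
        t * (2 * inner ℝ (symmDeriv x₀ y₀ (y - q)) (symmDeriv x₀ y₀ v)) +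
        t ^ 2 * ‖symmDeriv x₀ y₀ v‖ ^ 2 := by
    funext t
    rw [show y + t • v - q = (y - q) + t • v by abel, map_add, map_smul, norm_add_sq_real,
      real_inner_smul_right, norm_smul, mul_pow, Real.norm_eq_abs, sq_abs]
    ring
  rw [h]
  have h1 : HasDerivAt (fun t : ℝ => ‖symmDeriv x₀ y₀ (y - q)‖ ^ 2 +
        t * (2 * inner ℝ (symmDeriv x₀ y₀ (y - q)) (symmDeriv x₀ y₀ v)) +
        t ^ 2 * ‖symmDeriv x₀ y₀ v‖ ^ 2)
      (1 * (2 * inner ℝ (symmDeriv x₀ y₀ (y - q)) (symmDeriv x₀ y₀ v)) +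
        (2 : ℕ) * 0 ^ (2 - 1) * 1 * ‖symmDeriv x₀ y₀ v‖ ^ 2) 0 :=
    (((hasDerivAt_id (0 : ℝ)).mul_const _).const_add _).add
      (((hasDerivAt_id (0 : ℝ)).pow 2).mul_const _)
  rw [h1.deriv]
  simp

end

section

variable {m : ℕ} {M : Type*} [EMetricSpace M] [ChartedSpace (EuclideanHalfSpace (m + 1)) M]
  [IsManifold (𝓡∂ (m + 1)) ∞ M]
  [RiemannianBundle (fun x : M => TangentSpace (𝓡∂ (m + 1)) x)]
  [IsContMDiffRiemannianBundle (𝓡∂ (m + 1)) ∞ (EuclideanSpace ℝ (Fin (m + 1)))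
    (fun x : M => TangentSpace (𝓡∂ (m + 1)) x)]
  [IsRiemannianManifold (𝓡∂ (m + 1)) M]

/-- Finite speed of propagation over short times: near a point `p`, the solution at the end of a
time step `h` depends only on the Cauchy data and the Neumann data within distance `6 h`. The
constant is far from optimal, but independent of the point. -/
theorem exists_forall_eq_zero_of_closedEBall (p : M) :
    ∃ U ∈ 𝓝 p, ∃ h₀ > 0, ∀ x ∈ U, ∀ h, 0 < h → h < h₀ → ∀ F u : M × ℝ → ℝ, IsSolution m F u →
      ∀ t₀, 0 ≤ t₀ → (∀ z, edist x z ≤ ENNReal.ofReal (6 * h) →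
        (u (z, t₀) = 0 ∧ derivWithin (fun τ => u (z, τ)) (Ici 0) t₀ = 0) ∧
        (z ∈ (𝓡∂ (m + 1)).boundary M → ∀ t ∈ Ioc t₀ (t₀ + h), F (z, t) = 0)) →
      u (x, t₀ + h) = 0 ∧ derivWithin (fun τ => u (x, τ)) (Ici 0) (t₀ + h) = 0 := by
  obtain ⟨δ, hδ, hcmp⟩ := exists_norm_symmDeriv_le (m := m) p
  set y₀ := extChartAt (𝓡∂ (m + 1)) p p with hy₀
  have hy₀T : y₀ ∈ (extChartAt (𝓡∂ (m + 1)) p).target := mem_extChartAt_target p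
  obtain ⟨C, hC0, hC⟩ := exists_norm_le_symmDeriv p hy₀T
  -- the bound on `h` keeps the ball of radius `3 h` around `x`, in the norm of the metric at `p`,
  -- inside the region of the chart where the metric is comparable to its value at `p`
  have hT := relOpen_target (m := m) p
  refine ⟨(extChartAt (𝓡∂ (m + 1)) p).source ∩
    extChartAt (𝓡∂ (m + 1)) p ⁻¹' Metric.ball y₀ (δ / 2), ?_, δ / (6 * C), by positivity, ?_⟩
  · exact inter_mem (extChartAt_source_mem_nhds p)
      ((continuousAt_extChartAt p).preimage_mem_nhds (Metric.ball_mem_nhds _ (by positivity)))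
  rintro x ⟨hxs, hxq⟩ h hh hh₀ F u hu t₀ ht₀ hdata
  set q := extChartAt (𝓡∂ (m + 1)) p x with hq
  have hqT : q ∈ (extChartAt (𝓡∂ (m + 1)) p).target := (extChartAt _ p).map_source hxs
  have hxq' : (extChartAt (𝓡∂ (m + 1)) p).symm q = x := (extChartAt _ p).left_inv hxs
  have hqd : dist q y₀ < δ / 2 := hxq
  set φ : EuclideanSpace ℝ (Fin (m + 1)) → ℝ := fun y => ‖symmDeriv p y₀ (y - q)‖ ^ 2 with hφ
  -- the cone of speed `2` with radius `3 h` at time `t₀` still has radius `h` at time `t₀ + h`; its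
  -- base lies in the Riemannian ball of radius `6 h`
  set ρ := 3 * h with hρ
  have hφc := contDiff_norm_symmDeriv_sq p y₀ q
  set K := {y | φ y ≤ ρ ^ 2} ∩ range (𝓡∂ (m + 1)) with hKdef
  have hφρ : ∀ y, φ y ≤ ρ ^ 2 → ‖symmDeriv p y₀ (y - q)‖ ≤ ρ := fun y hy =>
    (abs_le_of_sq_le_sq' hy (by positivity)).2
  have hKd : ∀ y, φ y ≤ ρ ^ 2 → dist y y₀ < δ := by
    intro y hy
    have h1 : dist y q ≤ C * ρ := by
      rw [dist_eq_norm]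
      exact (hC _).trans (by have := hφρ y hy; gcongr)
    have h2 : C * ρ < δ / 2 := by
      rw [lt_div_iff₀ (by positivity)] at hh₀
      simp only [hρ]; linarith
    linarith [dist_triangle y q y₀]
  have hKT : K ⊆ (extChartAt (𝓡∂ (m + 1)) p).target := fun y hy => (hcmp y hy.2 (hKd y hy.1)).1
  have hKc : IsCompact K := by
    refine Metric.isCompact_of_isClosed_isBounded
      ((isClosed_le hφc.continuous continuous_const).inter isClosed_range_halfSpace) ?_
    exact Metric.isBounded_ball.subset fun y hy => (hKd y hy.1 : y ∈ Metric.ball y₀ δ)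
  have hKe : ∀ y ∈ K, edist x ((extChartAt (𝓡∂ (m + 1)) p).symm y) ≤ ENNReal.ofReal (6 * h) := by
    intro y hy
    rw [← hxq']
    refine (exists_edist_symm_le p (fun y hy hyd => ⟨(hcmp y hy hyd).1, fun v =>
      ((hcmp y hy hyd).2 v).1⟩) (hT.subset_range hqT) hy.2 (by linarith) (hKd y hy.1)).trans ?_
    refine ENNReal.ofReal_le_ofReal ?_
    have := hφρ y hy.1
    simp only [hρ] at this
    linarith
  have hws := contDiffOn_comp_symm hu.smooth p
  set w := fun p' : EuclideanSpace ℝ (Fin (m + 1)) × ℝ =>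
      u ((extChartAt (𝓡∂ (m + 1)) p).symm p'.1, p'.2) with hw
  have hwd : ∀ y ∈ (extChartAt (𝓡∂ (m + 1)) p).target, ∀ t, 0 ≤ t →
      derivWithin (fun τ => u ((extChartAt (𝓡∂ (m + 1)) p).symm y, τ)) (Ici 0) t =
        timeDeriv w (y, t) := fun y hy t ht =>
    (hasDerivWithinAt_timeDeriv hT hws hy ht).derivWithin (uniqueDiffOn_Ici 0 t ht)
  have key := timeDeriv_eq_zero_of_cone (A := fun i j y => (gram p y)⁻¹ i j)
    (s := fun y => √(gram p y).det) (φ := φ) (w := w) (t₀ := t₀) (h := h) (ρ := ρ) hT hKc hKT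
    (fun i j => contDiffOn_gram_inv p i j) (fun i j y => gram_inv_comm p y i j)
    (contDiffOn_sqrt_det_gram p) (fun y hy => Real.sqrt_pos.2 (det_gram_pos p hy))
    hφc.contDiffOn (fun y hy ξ => by rw [sum_gram_inv_eq_norm_sq p hy]; positivity)
    ?_ hws ht₀ (by simp only [hρ]; linarith) ?_ ?_ ?_ ?_
  · have hz : ∀ t ∈ Icc t₀ (t₀ + h), timeDeriv w (q, t) = 0 := by
      intro t ht
      refine key q hqT t ht ?_
      simp only [hφ, sub_self, map_zero, norm_zero, ne_eq, OfNat.ofNat_ne_zero, not_false_eq_true,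
        zero_pow]
      have : 0 < ρ - 2 * (t - t₀) := by simp only [hρ]; linarith [ht.2]
      positivity
    constructor
    · have h1 := constant_of_has_deriv_right_zero (f := fun τ => w (q, τ)) (a := t₀) (b := t₀ + h)
        (fun t ht => ((hasDerivWithinAt_timeDeriv hT hws hqT
          (ht₀.trans ht.1)).continuousWithinAt).mono fun τ hτ => ht₀.trans hτ.1)
        (fun t ht => by
          have h2 := hasDerivWithinAt_timeDeriv hT hws hqT (ht₀.trans ht.1)
          rw [hz t ⟨ht.1, ht.2.le⟩] at h2
          exact h2.mono fun τ hτ => (ht₀.trans ht.1).trans hτ)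
        (t₀ + h) ⟨by linarith, le_rfl⟩
      simp only [hw, hxq'] at h1
      rw [h1]
      exact (hdata x (by simp)).1.1
    · have h2 := hwd q hqT (t₀ + h) (by linarith)
      rw [hxq'] at h2
      rw [h2]
      exact hz _ ⟨by linarith, le_rfl⟩
  -- Cauchy-Schwarz for the metric at `p`, which is comparable to the metric at `y`
  · intro y hy ξ
    have h1 := sum_pderiv_mul φ y (fun i => ∑ j, (gram p y)⁻¹ i j * ξ j)
    rw [h1, fderivWithin_norm_symmDeriv_sq p y₀ q _ hy.2, sum_gram_inv_eq_norm_sq p (hKT hy),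
      Real.sqrt_sq (norm_nonneg _), Real.sqrt_sq (norm_nonneg _), abs_mul, abs_two]
    set n := WithLp.toLp 2 ((gram p y)⁻¹.mulVec ξ) with hn
    have h3 := abs_real_inner_le_norm (symmDeriv p y₀ (y - q)) (symmDeriv p y₀ n)
    have h4 := ((hcmp y hy.2 (hKd y hy.1)).2 n).2
    have h5 := mul_le_mul_of_nonneg_left h4 (norm_nonneg (symmDeriv p y₀ (y - q)))
    change 2 * |inner ℝ (symmDeriv p y₀ (y - q)) (symmDeriv p y₀ n)| ≤ _
    linarith
  · intro y hy hyK
    by_contra hlt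
    exact hyK ⟨(not_le.1 hlt).le, hT.subset_range hy⟩
  · intro y hy t ht
    exact hu.sqrt_det_mul_timeDeriv p hy ht
  · intro z hz t ht
    have h1 := hu.gradCoord_zero p (hKT hz) (by simp [hyperplane]) (ht₀.trans_lt ht.1)
    have h2 := (hdata _ (hKe _ hz)).2 ((symm_mem_boundary_iff (hKT hz)).2
      (by simp [hyperplane])) t ht
    rw [h2, mul_zero, neg_zero] at h1
    exact h1
  · intro y hy hφy
    have h1 := (hdata _ (hKe y ⟨hφy.le, hT.subset_range hy⟩)).1
    exact ⟨h1.1, by rw [← hwd y hy t₀ ht₀]; exact h1.2⟩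

end

end

section

open Filter Metric
open scoped ENNReal NNReal Topology

/-! ### Domain of dependence -/

section Sub

variable {m : ℕ} {M : Type*} [TopologicalSpace M] [ChartedSpace (EuclideanHalfSpace (m + 1)) M]
  [RiemannianBundle (fun x : M => TangentSpace (𝓡∂ (m + 1)) x)]

theorem gradCoord_sub (x₀ : M) {f g : M → ℝ}
    (hf : ContDiffOn ℝ ∞ (f ∘ (extChartAt (𝓡∂ (m + 1)) x₀).symm)
      (extChartAt (𝓡∂ (m + 1)) x₀).target)
    (hg : ContDiffOn ℝ ∞ (g ∘ (extChartAt (𝓡∂ (m + 1)) x₀).symm)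
      (extChartAt (𝓡∂ (m + 1)) x₀).target) (i : Fin (m + 1))
    {y : EuclideanSpace ℝ (Fin (m + 1))} (hy : y ∈ (extChartAt (𝓡∂ (m + 1)) x₀).target) :
    gradCoord x₀ (fun x => f x - g x) i y = gradCoord x₀ f i y - gradCoord x₀ g i y := by
  simp only [gradCoord]
  rw [← Finset.sum_sub_distrib]
  refine Finset.sum_congr rfl fun j _ => ?_
  rw [← mul_sub, ← pderiv_sub (relOpen_target x₀) (hf.of_le (by simp)) (hg.of_le (by simp)) hy]
  rfl

variable [IsManifold (𝓡∂ (m + 1)) ∞ M]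

variable [IsContMDiffRiemannianBundle (𝓡∂ (m + 1)) ∞ (EuclideanSpace ℝ (Fin (m + 1)))
    (fun x : M => TangentSpace (𝓡∂ (m + 1)) x)]

theorem IsSolution.sub {F H u v : M × ℝ → ℝ} (hu : IsSolution m F u) (hv : IsSolution m H v) :
    IsSolution m (fun p => F p - H p) (fun p => u p - v p) where
  smooth := hu.smooth.sub hv.smooth
  wave x₀ x hx t ht := by
    have hc : ∀ {w : M × ℝ → ℝ}, ContDiffOn ℝ ∞ (fun t => w (x, t)) (Ici 0) →
        ContDiffAt ℝ (2 : ℕ) (fun t => w (x, t)) t := fun h =>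
      (h.contDiffAt (Ici_mem_nhds ht)).of_le (WithTop.coe_le_coe.2 le_top)
    rw [iteratedDeriv_fun_sub (hc (contDiffOn_comp_time hu.smooth x))
      (hc (contDiffOn_comp_time hv.smooth x)), hu.wave x₀ x hx t ht, hv.wave x₀ x hx t ht]
    have hy := (extChartAt (𝓡∂ (m + 1)) x₀).map_source hx
    have hfu := contDiffOn_comp_symm_slice hu.smooth x₀ ht.le
    have hfv := contDiffOn_comp_symm_slice hv.smooth x₀ ht.le
    simp only [laplacian]
    rw [← mul_sub, ← Finset.sum_sub_distrib]
    congr 1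
    refine Finset.sum_congr rfl fun i _ => ?_
    rw [← pderiv_sub (relOpen_target x₀)
      (((contDiffOn_sqrt_det_gram x₀).mul (contDiffOn_gradCoord x₀ hfu i)).of_le (by simp))
      (((contDiffOn_sqrt_det_gram x₀).mul (contDiffOn_gradCoord x₀ hfv i)).of_le (by simp)) hy]
    refine pderiv_congr_on (relOpen_target x₀) (fun y hy => ?_) hy i
    rw [gradCoord_sub x₀ hfu hfv i hy, mul_sub]
  neumann x₀ x hx hxb t ht := by
    have hy := (extChartAt (𝓡∂ (m + 1)) x₀).map_source hx
    rw [← hu.neumann x₀ x hx hxb t ht, ← hv.neumann x₀ x hx hxb t ht, normalDeriv, normalDeriv,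
      normalDeriv, gradCoord_sub x₀ (contDiffOn_comp_symm_slice hu.smooth x₀ ht.le)
      (contDiffOn_comp_symm_slice hv.smooth x₀ ht.le) 0 hy]
    ring
  initial_value x := by simp [hu.initial_value, hv.initial_value]
  initial_velocity x := by
    have hc : ∀ {w : M × ℝ → ℝ}, ContDiffOn ℝ ∞ (fun t => w (x, t)) (Ici 0) →
        DifferentiableWithinAt ℝ (fun t => w (x, t)) (Ici 0) 0 := fun h =>
      h.differentiableOn (by simp) 0 self_mem_Ici
    rw [derivWithin_fun_sub (hc (contDiffOn_comp_time hu.smooth x))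
      (hc (contDiffOn_comp_time hv.smooth x)), hu.initial_velocity, hv.initial_velocity, sub_zero]

end Sub

section

variable {m : ℕ} {M : Type*} [EMetricSpace M] [CompleteSpace M]
  [ChartedSpace (EuclideanHalfSpace (m + 1)) M] [IsManifold (𝓡∂ (m + 1)) ∞ M]
  [RiemannianBundle (fun x : M => TangentSpace (𝓡∂ (m + 1)) x)]
  [IsContMDiffRiemannianBundle (𝓡∂ (m + 1)) ∞ (EuclideanSpace ℝ (Fin (m + 1)))
    (fun x : M => TangentSpace (𝓡∂ (m + 1)) x)]
  [IsRiemannianManifold (𝓡∂ (m + 1)) M] {F u : M × ℝ → ℝ}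

/-- Finite speed of propagation. The ball around `p` is compact by completeness, so the time step
of `exists_forall_eq_zero_of_closedEBall` can be chosen uniformly on it. -/
theorem IsSolution.eq_zero_of_forall_edist_le (hu : IsSolution m F u) {p : M} {T : ℝ} (hT : 0 < T)
    (hF : ∀ z ∈ (𝓡∂ (m + 1)).boundary M, edist p z ≤ ENNReal.ofReal (6 * T) →
      ∀ t ∈ Ioc 0 T, F (z, t) = 0) : u (p, T) = 0 := by
  have : LocallyCompactSpace M := Manifold.locallyCompact_of_finiteDimensional (𝓡∂ (m + 1))
  have hB : IsCompact (closedEBall p ((6 * T).toNNReal : ℝ≥0∞)) :=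
    isCompact_closedEBall (fun x y a b => exists_edist_le_and_edist_lt (I := 𝓡∂ (m + 1))) _ _
  obtain ⟨h₀, hh₀, hstep⟩ : ∃ h₀ > 0, ∀ x ∈ closedEBall p ((6 * T).toNNReal : ℝ≥0∞), ∀ h, 0 < h →
      h < h₀ → ∀ t₀, 0 ≤ t₀ → (∀ z, edist x z ≤ ENNReal.ofReal (6 * h) →
        (u (z, t₀) = 0 ∧ derivWithin (fun τ => u (z, τ)) (Ici 0) t₀ = 0) ∧
        (z ∈ (𝓡∂ (m + 1)).boundary M → ∀ t ∈ Ioc t₀ (t₀ + h), F (z, t) = 0)) →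
      u (x, t₀ + h) = 0 ∧ derivWithin (fun τ => u (x, τ)) (Ici 0) (t₀ + h) = 0 := by
    refine hB.induction_on ⟨1, one_pos, by simp⟩
      (fun s t hst ⟨h₀, hh₀, H⟩ => ⟨h₀, hh₀, fun x hx => H x (hst hx)⟩) ?_ ?_
    · rintro s t ⟨h₁, hh₁, H₁⟩ ⟨h₂, hh₂, H₂⟩
      refine ⟨min h₁ h₂, lt_min hh₁ hh₂, fun x hx h h0 hh => ?_⟩
      rcases hx with hx | hx
      · exact H₁ x hx h h0 (hh.trans_le (min_le_left _ _))
      · exact H₂ x hx h h0 (hh.trans_le (min_le_right _ _))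
    · intro q _
      obtain ⟨U, hU, h₀, hh₀, H⟩ := exists_forall_eq_zero_of_closedEBall (m := m) q
      exact ⟨U, mem_nhdsWithin_of_mem_nhds hU, h₀, hh₀, fun x hx h h0 hh => H x hx h h0 hh F u hu⟩
  obtain ⟨N, hN⟩ := exists_nat_gt (T / h₀)
  have hN0 : (0 : ℝ) < N := (div_pos hT hh₀).trans hN
  set h := T / N with hh
  have hh0 : 0 < h := div_pos hT hN0
  have hhlt : h < h₀ := by
    rw [hh, div_lt_iff₀ hN0, mul_comm]; rwa [div_lt_iff₀ hh₀] at hN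
  have hNh : N * h = T := by rw [hh]; field_simp
  -- the radius of the ball on which the solution is known to vanish shrinks by `6 h` in each step
  have key : ∀ k : ℕ, k ≤ N → ∀ z, edist p z ≤ ENNReal.ofReal (6 * (T - k * h)) →
      u (z, k * h) = 0 ∧ derivWithin (fun τ => u (z, τ)) (Ici 0) (k * h) = 0 := by
    intro k
    induction k with
    | zero =>
      intro _ z _
      simpa using ⟨hu.initial_value z, hu.initial_velocity z⟩
    | succ k ih =>
      intro hk z hz
      have hk' : ((k + 1 : ℕ) : ℝ) * h ≤ T := by
        rw [← hNh]
        have : ((k + 1 : ℕ) : ℝ) ≤ N := by exact_mod_cast hk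
        gcongr
      push_cast at hk' hz ⊢
      have hkh : 0 ≤ k * h := by positivity
      have hz' : z ∈ closedEBall p ((6 * T).toNNReal : ℝ≥0∞) := by
        rw [mem_closedEBall, edist_comm]
        refine hz.trans (ENNReal.ofReal_le_ofReal ?_)
        linarith
      rw [add_one_mul]
      refine hstep z hz' h hh0 hhlt (k * h) hkh fun z' hzz' => ?_
      have hpz' : edist p z' ≤ ENNReal.ofReal (6 * (T - k * h)) := by
        refine (edist_triangle p z z').trans ((add_le_add hz hzz').trans ?_)
        rw [← ENNReal.ofReal_add (by linarith) (by linarith)]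
        exact ENNReal.ofReal_le_ofReal (by linarith)
      refine ⟨ih (by omega) z' hpz', fun hzb t ht => hF z' hzb (hpz'.trans
        (ENNReal.ofReal_le_ofReal (by linarith))) t ⟨by linarith [ht.1], by linarith [ht.2]⟩⟩
  have := (key N le_rfl p (by simp [hNh])).1
  rwa [hNh] at this

theorem IsSolution.unique {v : M × ℝ → ℝ} (hu : IsSolution m F u) (hv : IsSolution m F v) (x : M)
    {t : ℝ} (ht : 0 ≤ t) : u (x, t) = v (x, t) := by
  rcases ht.eq_or_lt with rfl | ht
  · rw [hu.initial_value, hv.initial_value]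
  · exact sub_eq_zero.1 ((hu.sub hv).eq_zero_of_forall_edist_le ht fun _ _ _ _ _ => sub_self _)

/-- By uniqueness, the solution chosen in the definition of the response operator is irrelevant. -/
theorem IsSolution.response_eq (hu : IsSolution m F u) {x : M}
    (hx : x ∈ (𝓡∂ (m + 1)).boundary M) {t : ℝ} (ht : 0 < t) : response m F (x, t) = u (x, t) := by
  have h : ∃ u, IsSolution m F u := ⟨u, hu⟩
  rw [response, dif_pos h, indicator_of_mem (by exact ⟨hx, ht⟩)]
  exact h.choose_spec.unique hu x ht.le

/-- The source vanishes near time `0`, and hence so does the solution. -/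
theorem IsSolution.exists_eq_zero_of_le (hF : IsBoundarySource m F) (hu : IsSolution m F u) :
    ∃ τ > 0, (∀ x ∈ (𝓡∂ (m + 1)).boundary M, ∀ t ≤ τ, F (x, t) = 0) ∧
      ∀ x, ∀ t ∈ Icc 0 τ, u (x, t) = 0 := by
  obtain ⟨K, hK, hKb, hKF⟩ := hF.compactSupport
  obtain ⟨τ, hτ, hτK⟩ : ∃ τ > 0, ∀ q ∈ K, τ < q.2 := by
    rcases K.eq_empty_or_nonempty with rfl | hne
    · exact ⟨1, one_pos, by simp⟩
    · obtain ⟨q, hq, hmin⟩ := hK.exists_isMinOn hne continuous_snd.continuousOn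
      have h0 : 0 < q.2 := (hKb hq).2
      exact ⟨q.2 / 2, half_pos h0, fun q' hq' => (half_lt_self h0).trans_le (hmin hq')⟩
  have hF0 : ∀ x ∈ (𝓡∂ (m + 1)).boundary M, ∀ t ≤ τ, F (x, t) = 0 := fun x hx t ht =>
    hKF _ ⟨hx, mem_univ _⟩ fun hq => (hτK _ hq).not_ge ht
  refine ⟨τ, hτ, hF0, fun x t ht => ?_⟩
  rcases ht.1.eq_or_lt with rfl | h0
  · exact hu.initial_value x
  · exact hu.eq_zero_of_forall_edist_le h0 fun z hz _ s hs => hF0 z hz s (hs.2.trans ht.2)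

/-- Up to any fixed time, the solution is supported in a compact set. -/
theorem IsSolution.exists_isCompact (hF : IsBoundarySource m F) (hu : IsSolution m F u) (T : ℝ) :
    ∃ K : Set M, IsCompact K ∧ ∀ x ∉ K, ∀ t ∈ Icc 0 T, u (x, t) = 0 := by
  have : LocallyCompactSpace M := Manifold.locallyCompact_of_finiteDimensional (𝓡∂ (m + 1))
  obtain ⟨K, hK, hKb, hKF⟩ := hF.compactSupport
  obtain ⟨K', hK', h⟩ := exists_isCompact_of_edist_le
    (fun x y a b => exists_edist_le_and_edist_lt (I := 𝓡∂ (m + 1)) (x := x) (y := y))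
    (hK.image continuous_fst) (6 * T).toNNReal
  refine ⟨K', hK', fun x hx t ht => ?_⟩
  rcases ht.1.eq_or_lt with rfl | h0
  · exact hu.initial_value x
  · refine hu.eq_zero_of_forall_edist_le h0 fun z hz hxz s _ => hKF _ ⟨hz, mem_univ _⟩ fun hq => ?_
    refine hx (h z (mem_image_of_mem Prod.fst hq) x (hxz.trans ?_))
    exact ENNReal.ofReal_le_ofReal (by linarith [ht.2])

end

end

section

open Filter
open scoped ENNReal Topology

/-! ### Gluing of measures given in charts -/

section Gluing

variable {X V : Type*} [MeasurableSpace X] [MeasurableSpace V]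

/-- The supremum of a family of measures which agree on the overlaps of sets that carry them
restricts to each of them. -/
theorem restrict_iSup_eq {ι : Type*} {μ : ι → Measure X} {U : ι → Set X}
    (hU : ∀ i, MeasurableSet (U i)) (hc : ∀ i, μ i (U i)ᶜ = 0)
    (h : ∀ i j A, MeasurableSet A → A ⊆ U i → A ⊆ U j → μ i A = μ j A) (i : ι) :
    (⨆ j, μ j).restrict (U i) = μ i := by
  have hr : ∀ j, (μ j).restrict (U j) = μ j := fun j =>
    Measure.restrict_eq_self_of_ae_mem (by rw [ae_iff]; exact hc j)
  apply le_antisymm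
  · have hle : (⨆ j, μ j) ≤ μ i + (⨆ j, μ j).restrict (U i)ᶜ := by
      refine iSup_le fun j => Measure.le_iff.2 fun A hA => ?_
      rw [← measure_inter_add_sdiff A (hU i), Measure.add_apply, Measure.restrict_apply hA]
      refine add_le_add ?_ ?_
      · have h1 : μ j (A ∩ U i) = μ j (A ∩ U i ∩ U j) := by
          conv_lhs => rw [← hr j, Measure.restrict_apply (hA.inter (hU i))]
        rw [h1, h j i _ ((hA.inter (hU i)).inter (hU j)) inter_subset_right
          (inter_subset_left.trans inter_subset_right)]
        exact measure_mono (inter_subset_left.trans inter_subset_left)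
      · exact le_iSup (fun j => μ j) j _
    refine (Measure.restrict_mono le_rfl hle).trans ?_
    rw [Measure.restrict_add, Measure.restrict_restrict (hU i), inter_compl_self,
      Measure.restrict_empty, add_zero]
    exact Measure.restrict_le_self
  · conv_lhs => rw [← hr i]
    exact Measure.restrict_mono le_rfl (le_iSup (fun j => μ j) i)

/-- The value of the image of a density on a measurable set. The map `Ψ` is measurable only on `T`,
so the preimage need not be a measurable set. -/
theorem map_withDensity_apply {ν : Measure V} [SFinite ν] {T : Set V} (hT : MeasurableSet T)
    {Ψ : V → X} (hΨ : AEMeasurable Ψ (ν.restrict T)) (ρ : V → ℝ≥0∞) {A : Set X}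
    (hA : MeasurableSet A) :
    Measure.map Ψ ((ν.restrict T).withDensity ρ) A = ∫⁻ y in Ψ ⁻¹' A ∩ T, ρ y ∂ν := by
  rw [Measure.map_apply_of_aemeasurable
    (hΨ.mono_ac (withDensity_absolutelyContinuous _ _)) hA, withDensity_apply',
    Measure.restrict_restrict' hT]

theorem map_withDensity_apply_compl_eq_zero {ν : Measure V} [SFinite ν] {T : Set V}
    (hT : MeasurableSet T) {Ψ : V → X} (hΨ : AEMeasurable Ψ (ν.restrict T)) (ρ : V → ℝ≥0∞)
    {A : Set X} (hA : MeasurableSet A) (h : MapsTo Ψ T A) :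
    Measure.map Ψ ((ν.restrict T).withDensity ρ) Aᶜ = 0 := by
  rw [map_withDensity_apply hT hΨ ρ hA.compl,
    show Ψ ⁻¹' Aᶜ ∩ T = ∅ from eq_empty_of_forall_notMem fun y hy => hy.1 (h hy.2)]
  simp

end Gluing

/-- Two measures given by densities in charts `Ψ₀` and `Ψ₁`, with inverses `Φ₀` and `Φ₁`, agree on
the overlap if the densities are related by the Jacobian determinant of `Φ₁ ∘ Ψ₀`. -/
theorem map_withDensity_apply_eq {X V : Type*} [TopologicalSpace X] [MeasurableSpace X]
    [BorelSpace X] [NormedAddCommGroup V] [NormedSpace ℝ V] [FiniteDimensional ℝ V]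
    [MeasurableSpace V] [BorelSpace V] {ν : Measure V} [ν.IsAddHaarMeasure] {T₀ T₁ : Set V}
    (hT₀ : MeasurableSet T₀) (hT₁ : MeasurableSet T₁) {Ψ₀ Ψ₁ : V → X} {Φ₀ Φ₁ : X → V}
    (hΨ₀ : ContinuousOn Ψ₀ T₀) (hΨ₁ : ContinuousOn Ψ₁ T₁) (hΦ₀ : LeftInvOn Φ₀ Ψ₀ T₀)
    (hΦ₁ : LeftInvOn Φ₁ Ψ₁ T₁) {ρ₀ ρ₁ : V → ℝ≥0∞} {A : Set X} (hA : MeasurableSet A)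
    (hA₀ : A ⊆ Ψ₀ '' T₀) (hA₁ : A ⊆ Ψ₁ '' T₁) {J : V → V →L[ℝ] V}
    (hJ : ∀ y ∈ T₀, Ψ₀ y ∈ A → HasFDerivWithinAt (Φ₁ ∘ Ψ₀) (J y) T₀ y)
    (hρ : ∀ y ∈ T₀, Ψ₀ y ∈ A →
      ENNReal.ofReal |(J y).det| * ρ₁ (Φ₁ (Ψ₀ y)) = ρ₀ y) :
    Measure.map Ψ₀ ((ν.restrict T₀).withDensity ρ₀) A =
      Measure.map Ψ₁ ((ν.restrict T₁).withDensity ρ₁) A := by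
  rw [map_withDensity_apply hT₀ (hΨ₀.aemeasurable hT₀) _ hA,
    map_withDensity_apply hT₁ (hΨ₁.aemeasurable hT₁) _ hA]
  have himg : (Φ₁ ∘ Ψ₀) '' (Ψ₀ ⁻¹' A ∩ T₀) = Ψ₁ ⁻¹' A ∩ T₁ := by
    ext z
    constructor
    · rintro ⟨y, ⟨hyA, hy⟩, rfl⟩
      obtain ⟨z, hz, hzy⟩ := hA₁ hyA
      simp only [Function.comp, mem_inter_iff, mem_preimage]
      rw [← hzy, hΦ₁ hz]
      exact ⟨by rw [hzy]; exact hyA, hz⟩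
    · rintro ⟨hzA, hz⟩
      obtain ⟨y, hy, hyz⟩ := hA₀ hzA
      exact ⟨y, ⟨by rw [mem_preimage, hyz]; exact hzA, hy⟩,
        by simp only [Function.comp, hyz, hΦ₁ hz]⟩
  have hinj : InjOn (Φ₁ ∘ Ψ₀) (Ψ₀ ⁻¹' A ∩ T₀) := by
    rintro y ⟨hyA, hy⟩ y' ⟨hyA', hy'⟩ h
    obtain ⟨z, hz, hzy⟩ := hA₁ hyA
    obtain ⟨z', hz', hzy'⟩ := hA₁ hyA'
    simp only [Function.comp, ← hzy, ← hzy', hΦ₁ hz, hΦ₁ hz'] at h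
    rw [← hΦ₀ hy, ← hΦ₀ hy', ← hzy, ← hzy', h]
  have hm : MeasurableSet (Ψ₀ ⁻¹' A ∩ T₀) := by
    have h := hT₀.subtype_image ((continuousOn_iff_continuous_domRestrict.1 hΨ₀).measurable hA)
    convert h using 1
    ext y
    simp [and_comm]
  -- the change of variables formula
  rw [← himg, lintegral_image_eq_lintegral_abs_det_fderiv_mul ν hm
    (fun y hy => (hJ y hy.2 hy.1).mono inter_subset_right) hinj]
  exact (setLIntegral_congr_fun hm fun y hy => hρ y hy.2 hy.1).symm

/-- The Gram determinant is multiplied by the square of the determinant under a linear change of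
variables. -/
theorem det_eq_sq_det_mul_det {k : ℕ} {G G' : Matrix (Fin k) (Fin k) ℝ}
    {L : EuclideanSpace ℝ (Fin k) →L[ℝ] EuclideanSpace ℝ (Fin k)}
    (h : ∀ i j, G' i j = ∑ a, ∑ b, L (EuclideanSpace.single i 1) a * G a b *
      L (EuclideanSpace.single j 1) b) : G'.det = L.det ^ 2 * G.det := by
  set N : Matrix (Fin k) (Fin k) ℝ := Matrix.of fun a i => L (EuclideanSpace.single i 1) a with hN
  have hNL : N.det = L.det := by
    rw [ContinuousLinearMap.det,
      ← LinearMap.det_toMatrix (EuclideanSpace.basisFun (Fin k) ℝ).toBasis]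
    congr 1
  have hG : G' = N.transpose * G * N := by
    ext i j
    rw [h, Matrix.mul_apply, Finset.sum_comm]
    refine Finset.sum_congr rfl fun b _ => ?_
    rw [Matrix.mul_apply, Finset.sum_mul]
    rfl
  rw [hG, Matrix.det_mul, Matrix.det_mul, Matrix.det_transpose, hNL]
  ring

theorem ofReal_abs_mul_ofReal_sqrt {d g g' : ℝ} (h : g' = d ^ 2 * g) :
    ENNReal.ofReal |d| * ENNReal.ofReal √g = ENNReal.ofReal √g' := by
  rw [← ENNReal.ofReal_mul (abs_nonneg d), h, Real.sqrt_mul (sq_nonneg d), Real.sqrt_sq_eq_abs]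

end

section

open Filter
open scoped ENNReal Topology

/-! ### Changes of charts -/

section Transition

variable {m : ℕ} {M : Type*} [TopologicalSpace M] [ChartedSpace (EuclideanHalfSpace (m + 1)) M]

variable (m) in
/-- The change of coordinates from the chart around `x₀` to the chart around `x₁`. -/
noncomputable def chartChange (x₀ x₁ : M) :
    EuclideanSpace ℝ (Fin (m + 1)) → EuclideanSpace ℝ (Fin (m + 1)) :=
  extChartAt (𝓡∂ (m + 1)) x₁ ∘ (extChartAt (𝓡∂ (m + 1)) x₀).symm

variable (m) in
/-- The coordinates, in the chart around `x₀`, of the points which lie in the domains of the charts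
around `x₀` and `x₁`. -/
def chartOverlap (x₀ x₁ : M) : Set (EuclideanSpace ℝ (Fin (m + 1))) :=
  (extChartAt (𝓡∂ (m + 1)) x₀).target ∩
    (extChartAt (𝓡∂ (m + 1)) x₀).symm ⁻¹' (extChartAt (𝓡∂ (m + 1)) x₁).source

theorem continuousOn_symm_hyperplane (x₀ : M) :
    ContinuousOn (fun z : EuclideanSpace ℝ (Fin m) =>
      (extChartAt (𝓡∂ (m + 1)) x₀).symm (hyperplane z))
      (hyperplane ⁻¹' (extChartAt (𝓡∂ (m + 1)) x₀).target) :=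
  (continuousOn_extChartAt_symm x₀).comp continuous_hyperplane.continuousOn fun _ hz => hz

theorem measurableSet_hyperplane_preimage_target (x₀ : M) :
    MeasurableSet (hyperplane ⁻¹' (extChartAt (𝓡∂ (m + 1)) x₀).target) :=
  continuous_hyperplane.measurable (relOpen_target x₀).measurableSet

theorem relOpen_chartOverlap (x₀ x₁ : M) : RelOpen (chartOverlap m x₀ x₁) := by
  obtain ⟨O, hO, hT⟩ := relOpen_target (m := m) x₀
  obtain ⟨O', hO', h⟩ := (continuousOn_iff'.1 (continuousOn_extChartAt_symm (I := 𝓡∂ (m + 1)) x₀))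
    _ (isOpen_extChartAt_source (I := 𝓡∂ (m + 1)) x₁)
  refine ⟨O' ∩ O, hO'.inter hO, ?_⟩
  rw [chartOverlap, inter_comm, h, hT, inter_assoc]

theorem symm_chartChange {x₀ x₁ : M} {y : EuclideanSpace ℝ (Fin (m + 1))}
    (hy : y ∈ chartOverlap m x₀ x₁) : (extChartAt (𝓡∂ (m + 1)) x₁).symm (chartChange m x₀ x₁ y) =
      (extChartAt (𝓡∂ (m + 1)) x₀).symm y :=
  (extChartAt (𝓡∂ (m + 1)) x₁).left_inv hy.2

theorem chartChange_mem {x₀ x₁ : M} {y : EuclideanSpace ℝ (Fin (m + 1))}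
    (hy : y ∈ chartOverlap m x₀ x₁) :
    chartChange m x₀ x₁ y ∈ (extChartAt (𝓡∂ (m + 1)) x₁).target :=
  (extChartAt (𝓡∂ (m + 1)) x₁).map_source hy.2

variable [IsManifold (𝓡∂ (m + 1)) ∞ M]

theorem source_inter_boundary_eq_image (x₀ : M) :
    (extChartAt (𝓡∂ (m + 1)) x₀).source ∩ (𝓡∂ (m + 1)).boundary M =
      (fun z : EuclideanSpace ℝ (Fin m) => (extChartAt (𝓡∂ (m + 1)) x₀).symm (hyperplane z)) ''
        (hyperplane ⁻¹' (extChartAt (𝓡∂ (m + 1)) x₀).target) := by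
  ext x
  constructor
  · rintro ⟨hx, hxb⟩
    have h0 := hyperplane_tailL ((mem_boundary_iff hx).1 hxb)
    refine ⟨tailL m (extChartAt (𝓡∂ (m + 1)) x₀ x), ?_, ?_⟩
    · rw [mem_preimage, h0]
      exact (extChartAt (𝓡∂ (m + 1)) x₀).map_source hx
    · simp only [h0]
      exact (extChartAt (𝓡∂ (m + 1)) x₀).left_inv hx
  · rintro ⟨z, hz, rfl⟩
    exact ⟨(extChartAt (𝓡∂ (m + 1)) x₀).map_target hz, (symm_mem_boundary_iff hz).2 rfl⟩

theorem contDiffOn_chartChange (x₀ x₁ : M) :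
    ContDiffOn ℝ ∞ (chartChange m x₀ x₁) (chartOverlap m x₀ x₁) := by
  have := contDiffOn_ext_coord_change (I := 𝓡∂ (m + 1)) (n := ∞) x₁ x₀
  rwa [PartialEquiv.trans_source] at this

theorem hasFDerivWithinAt_chartChange {x₀ x₁ : M} {y : EuclideanSpace ℝ (Fin (m + 1))}
    (hy : y ∈ chartOverlap m x₀ x₁) :
    HasFDerivWithinAt (chartChange m x₀ x₁)
      (fderivWithin ℝ (chartChange m x₀ x₁) (range (𝓡∂ (m + 1))) y) (range (𝓡∂ (m + 1))) y := by
  have h := (contDiffOn_chartChange x₀ x₁).differentiableOn (by simp) y hy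
  have h2 : DifferentiableWithinAt ℝ (chartChange m x₀ x₁) (range (𝓡∂ (m + 1))) y :=
    h.mono_of_mem_nhdsWithin ((relOpen_chartOverlap x₀ x₁).mem_nhdsWithin hy)
  exact h2.hasFDerivWithinAt

theorem chartChange_hyperplane_zero {x₀ x₁ : M} {y : EuclideanSpace ℝ (Fin (m + 1))}
    (hy : y ∈ chartOverlap m x₀ x₁) (hy0 : y 0 = 0) : chartChange m x₀ x₁ y 0 = 0 :=
  (symm_mem_boundary_iff (chartChange_mem hy)).1
    (by rw [symm_chartChange hy]; exact (symm_mem_boundary_iff hy.1).2 hy0)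

/-- The chain rule for the inverses of the charts. Both sides are vectors of the coordinate space,
to which all tangent spaces are definitionally equal. -/
theorem symmDeriv_eq_comp {x₀ x₁ : M} {y : EuclideanSpace ℝ (Fin (m + 1))}
    (hy : y ∈ chartOverlap m x₀ x₁) (v : EuclideanSpace ℝ (Fin (m + 1))) :
    (symmDeriv x₀ y v : EuclideanSpace ℝ (Fin (m + 1))) = symmDeriv x₁ (chartChange m x₀ x₁ y)
      (fderivWithin ℝ (chartChange m x₀ x₁) (range (𝓡∂ (m + 1))) y v) := by
  have hyr := (relOpen_chartOverlap x₀ x₁).subset_range hy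
  have h1 : HasMFDerivWithinAt 𝓘(ℝ, EuclideanSpace ℝ (Fin (m + 1))) (𝓡∂ (m + 1))
      (extChartAt (𝓡∂ (m + 1)) x₁).symm (range (𝓡∂ (m + 1))) (chartChange m x₀ x₁ y)
      (symmDeriv x₁ (chartChange m x₀ x₁ y)) :=
    (mdifferentiableWithinAt_extChartAt_symm (chartChange_mem hy)).hasMFDerivWithinAt
  have h2 : HasMFDerivWithinAt 𝓘(ℝ, EuclideanSpace ℝ (Fin (m + 1)))
      𝓘(ℝ, EuclideanSpace ℝ (Fin (m + 1))) (chartChange m x₀ x₁) (chartOverlap m x₀ x₁) y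
      (fderivWithin ℝ (chartChange m x₀ x₁) (range (𝓡∂ (m + 1))) y) :=
    ((hasFDerivWithinAt_chartChange hy).mono
      (relOpen_chartOverlap x₀ x₁).subset_range).hasMFDerivWithinAt
  have h3 := h1.comp y h2 fun z hz =>
    (relOpen_target (m := m) x₁).subset_range (chartChange_mem hz)
  have h4 : HasMFDerivWithinAt 𝓘(ℝ, EuclideanSpace ℝ (Fin (m + 1))) (𝓡∂ (m + 1))
      (extChartAt (𝓡∂ (m + 1)) x₀).symm (chartOverlap m x₀ x₁) y (symmDeriv x₀ y) :=
    ((mdifferentiableWithinAt_extChartAt_symm hy.1).hasMFDerivWithinAt).mono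
      (relOpen_chartOverlap x₀ x₁).subset_range
  have h5 : HasMFDerivWithinAt 𝓘(ℝ, EuclideanSpace ℝ (Fin (m + 1))) (𝓡∂ (m + 1))
      ((extChartAt (𝓡∂ (m + 1)) x₁).symm ∘ chartChange m x₀ x₁) (chartOverlap m x₀ x₁) y
      (symmDeriv x₀ y) :=
    h4.congr_of_eventuallyEq (eventually_of_mem self_mem_nhdsWithin fun z hz => symm_chartChange hz)
      (symm_chartChange hy)
  have h6 := ((relOpen_chartOverlap x₀ x₁).uniqueDiffOn.uniqueMDiffOn y hy).eq h3 h5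
  exact (congrArg (fun L : EuclideanSpace ℝ (Fin (m + 1)) →L[ℝ] EuclideanSpace ℝ (Fin (m + 1)) =>
    L v) h6).symm

/-- The derivative of a change of charts maps vectors tangent to the boundary to such vectors. -/
theorem fderivWithin_chartChange_hyperplane_zero {x₀ x₁ : M} {z : EuclideanSpace ℝ (Fin m)}
    (hy : hyperplane z ∈ chartOverlap m x₀ x₁) (v : EuclideanSpace ℝ (Fin m)) :
    fderivWithin ℝ (chartChange m x₀ x₁) (range (𝓡∂ (m + 1))) (hyperplane z) (hyperplane v) 0 =
      0 := by
  have h1 := (hasFDerivWithinAt_chartChange hy).comp_hasFDerivAt z (f := hyperplaneL m)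
    (hyperplaneL m).hasFDerivAt (Eventually.of_forall fun z' => hyperplane_mem_range z')
  have h2 := (EuclideanSpace.proj (𝕜 := ℝ) (0 : Fin (m + 1))).hasFDerivAt.comp z h1
  obtain ⟨O, hO, hT⟩ := relOpen_chartOverlap (m := m) x₀ x₁
  have h3 : (EuclideanSpace.proj (𝕜 := ℝ) (0 : Fin (m + 1))) ∘ (chartChange m x₀ x₁ ∘ hyperplaneL m)
      =ᶠ[𝓝 z] fun _ => 0 := by
    have hO' : O ∈ 𝓝 (hyperplaneL m z) := hO.mem_nhds (hT ▸ hy : hyperplane z ∈ O ∩ _).1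
    filter_upwards [(hyperplaneL m).continuous.continuousAt.preimage_mem_nhds hO'] with z' hz'
    exact chartChange_hyperplane_zero (hT ▸ ⟨hz', hyperplane_mem_range z'⟩) rfl
  -- the zeroth component of the change of charts vanishes on the hyperplane
  have h4 := h2.unique ((hasFDerivAt_const (0 : ℝ) z).congr_of_eventuallyEq h3)
  exact congrArg (fun L => L v) h4

variable [RiemannianBundle (fun x : M => TangentSpace (𝓡∂ (m + 1)) x)]

theorem inner_symmDeriv_eq_comp {x₀ x₁ : M} {y : EuclideanSpace ℝ (Fin (m + 1))}
    (hy : y ∈ chartOverlap m x₀ x₁) (v w : EuclideanSpace ℝ (Fin (m + 1))) :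
    inner ℝ (symmDeriv x₀ y v) (symmDeriv x₀ y w) =
      inner ℝ (symmDeriv x₁ (chartChange m x₀ x₁ y)
          (fderivWithin ℝ (chartChange m x₀ x₁) (range (𝓡∂ (m + 1))) y v))
        (symmDeriv x₁ (chartChange m x₀ x₁ y)
          (fderivWithin ℝ (chartChange m x₀ x₁) (range (𝓡∂ (m + 1))) y w)) := by
  -- the two base points are equal, but not definitionally, so the fibre metrics are compared by
  -- heterogeneous equality
  have key : ∀ {p q : M}, p = q → ∀ (a b : TangentSpace (𝓡∂ (m + 1)) p)
      (a' b' : TangentSpace (𝓡∂ (m + 1)) q), HEq a a' → HEq b b' → inner ℝ a b = inner ℝ a' b' := by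
    rintro p _ rfl a b _ _ ⟨⟩ ⟨⟩; rfl
  exact key (symm_chartChange hy).symm _ _ _ _ (heq_of_eq (symmDeriv_eq_comp hy v))
    (heq_of_eq (symmDeriv_eq_comp hy w))

theorem gram_eq_sum {x₀ x₁ : M} {y : EuclideanSpace ℝ (Fin (m + 1))}
    (hy : y ∈ chartOverlap m x₀ x₁) (i j : Fin (m + 1)) :
    gram x₀ y i j = ∑ a, ∑ b,
      fderivWithin ℝ (chartChange m x₀ x₁) (range (𝓡∂ (m + 1))) y (EuclideanSpace.single i 1) a *
        gram x₁ (chartChange m x₀ x₁ y) a b *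
      fderivWithin ℝ (chartChange m x₀ x₁) (range (𝓡∂ (m + 1))) y
        (EuclideanSpace.single j 1) b := by
  rw [← inner_symmDeriv, ← inner_symmDeriv_eq_comp hy]
  rfl

end Transition

/-! ### The Riemannian volume and the surface measure -/

section Volume

variable {m : ℕ} {M : Type*} [TopologicalSpace M] [MeasurableSpace M] [BorelSpace M]
  [ChartedSpace (EuclideanHalfSpace (m + 1)) M]

theorem aemeasurable_symm (x₀ : M) : AEMeasurable (extChartAt (𝓡∂ (m + 1)) x₀).symm
    ((volume : Measure (EuclideanSpace ℝ (Fin (m + 1)))).restrict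
      (extChartAt (𝓡∂ (m + 1)) x₀).target) :=
  (continuousOn_extChartAt_symm x₀).aemeasurable (relOpen_target x₀).measurableSet

theorem aemeasurable_symm_hyperplane (x₀ : M) :
    AEMeasurable (fun z : EuclideanSpace ℝ (Fin m) =>
      (extChartAt (𝓡∂ (m + 1)) x₀).symm (hyperplane z))
      ((volume : Measure (EuclideanSpace ℝ (Fin m))).restrict
        (hyperplane ⁻¹' (extChartAt (𝓡∂ (m + 1)) x₀).target)) :=
  (continuousOn_symm_hyperplane x₀).aemeasurable (measurableSet_hyperplane_preimage_target x₀)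

variable [IsManifold (𝓡∂ (m + 1)) ∞ M]

theorem measurableSet_source_inter_boundary (x₀ : M) :
    MeasurableSet ((extChartAt (𝓡∂ (m + 1)) x₀).source ∩ (𝓡∂ (m + 1)).boundary M) :=
  (isOpen_extChartAt_source x₀).measurableSet.inter
    ((𝓡∂ (m + 1)).isClosed_boundary (n := ∞) (by simp)).measurableSet

variable [RiemannianBundle (fun x : M => TangentSpace (𝓡∂ (m + 1)) x)]

/-- The Riemannian volume is given in every chart by its density there. -/
theorem volumeMeasure_restrict_source (x₀ : M) :
    (volumeMeasure m M).restrict (extChartAt (𝓡∂ (m + 1)) x₀).source =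
      chartVolume (m := m) x₀ := by
  refine restrict_iSup_eq (μ := fun x₀ : M => chartVolume (m := m) x₀)
    (U := fun x₀ => (extChartAt (𝓡∂ (m + 1)) x₀).source)
    (fun x => (isOpen_extChartAt_source x).measurableSet) (fun x => ?_) (fun x₀ x₁ A hA h0 h1 => ?_)
    x₀
  · exact map_withDensity_apply_compl_eq_zero (relOpen_target x).measurableSet (aemeasurable_symm x)
      _ (isOpen_extChartAt_source x).measurableSet (extChartAt (𝓡∂ (m + 1)) x).mapsTo_symm
  · have himg : ∀ x : M, (extChartAt (𝓡∂ (m + 1)) x).source =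
        (extChartAt (𝓡∂ (m + 1)) x).symm '' (extChartAt (𝓡∂ (m + 1)) x).target :=
      fun x => (extChartAt (𝓡∂ (m + 1)) x).symm_image_target_eq_source.symm
    refine map_withDensity_apply_eq (Φ₀ := extChartAt (𝓡∂ (m + 1)) x₀)
      (Φ₁ := extChartAt (𝓡∂ (m + 1)) x₁)
      (J := fderivWithin ℝ (chartChange m x₀ x₁) (range (𝓡∂ (m + 1))))
      (relOpen_target x₀).measurableSet (relOpen_target x₁).measurableSet
      (continuousOn_extChartAt_symm x₀) (continuousOn_extChartAt_symm x₁)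
      (fun y hy => (extChartAt (𝓡∂ (m + 1)) x₀).right_inv hy)
      (fun y hy => (extChartAt (𝓡∂ (m + 1)) x₁).right_inv hy) hA
      (by rw [← himg]; exact h0) (by rw [← himg]; exact h1) ?_ ?_
    · intro y hy hyA
      exact (hasFDerivWithinAt_chartChange ⟨hy, h1 hyA⟩).mono (relOpen_target x₀).subset_range
    · intro y hy hyA
      exact ofReal_abs_mul_ofReal_sqrt (det_eq_sq_det_mul_det fun i j =>
        gram_eq_sum ⟨hy, h1 hyA⟩ i j)

/-- As boundary points are mapped to boundary points, the derivative of a change of charts respects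
the hyperplane, and the surface densities transform like volume densities in one dimension less. -/
theorem surfaceMeasure_restrict_source (x₀ : M) :
    (surfaceMeasure m M).restrict
      ((extChartAt (𝓡∂ (m + 1)) x₀).source ∩ (𝓡∂ (m + 1)).boundary M) =
      chartSurface (m := m) x₀ := by
  refine restrict_iSup_eq (μ := fun x₀ : M => chartSurface (m := m) x₀)
    (U := fun x₀ => (extChartAt (𝓡∂ (m + 1)) x₀).source ∩ (𝓡∂ (m + 1)).boundary M)
    measurableSet_source_inter_boundary (fun x => ?_) (fun x₀ x₁ A hA h0 h1 => ?_) x₀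
  · refine map_withDensity_apply_compl_eq_zero (measurableSet_hyperplane_preimage_target x)
      (aemeasurable_symm_hyperplane x) _ (measurableSet_source_inter_boundary x) ?_
    rw [source_inter_boundary_eq_image]
    exact mapsTo_image _ _
  · refine map_withDensity_apply_eq (Φ₀ := fun x => tailL m (extChartAt (𝓡∂ (m + 1)) x₀ x))
      (Φ₁ := fun x => tailL m (extChartAt (𝓡∂ (m + 1)) x₁ x))
      (J := fun z => (tailL m).comp ((fderivWithin ℝ (chartChange m x₀ x₁) (range (𝓡∂ (m + 1)))
        (hyperplane z)).comp (hyperplaneL m)))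
      (measurableSet_hyperplane_preimage_target x₀) (measurableSet_hyperplane_preimage_target x₁)
      (continuousOn_symm_hyperplane x₀) (continuousOn_symm_hyperplane x₁)
      (fun z hz => by
        simp only [(extChartAt (𝓡∂ (m + 1)) x₀).right_inv hz, tailL_hyperplane])
      (fun z hz => by
        simp only [(extChartAt (𝓡∂ (m + 1)) x₁).right_inv hz, tailL_hyperplane]) hA
      (by rw [← source_inter_boundary_eq_image]; exact h0)
      (by rw [← source_inter_boundary_eq_image]; exact h1) ?_ ?_
    · intro z hz hzA
      exact (tailL m).hasFDerivAt.comp_hasFDerivWithinAt z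
        ((hasFDerivWithinAt_chartChange ⟨hz, (h1 hzA).1⟩).comp z
          (hyperplaneL m).hasFDerivWithinAt fun z' _ => hyperplane_mem_range z')
    · intro z hz hzA
      have hy : hyperplane z ∈ chartOverlap m x₀ x₁ := ⟨hz, (h1 hzA).1⟩
      have h2 : hyperplane (tailL m (chartChange m x₀ x₁ (hyperplane z))) =
          chartChange m x₀ x₁ (hyperplane z) :=
        hyperplane_tailL (chartChange_hyperplane_zero hy rfl)
      refine ofReal_abs_mul_ofReal_sqrt (det_eq_sq_det_mul_det fun i j => ?_)
      have h3 : ∀ i : Fin m, EuclideanSpace.single i.succ (1 : ℝ) =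
          hyperplane (EuclideanSpace.single i (1 : ℝ)) := fun i => by
        ext j
        refine Fin.cases ?_ (fun j => ?_) j <;>
          simp [hyperplane, Pi.single_apply, (Fin.succ_ne_zero _).symm]
      rw [Matrix.submatrix_apply, gram_eq_sum hy]
      simp only [h3, Fin.sum_univ_succ, fderivWithin_chartChange_hyperplane_zero hy, zero_mul,
        mul_zero, Finset.sum_const_zero, zero_add]
      refine Finset.sum_congr rfl fun a _ => Finset.sum_congr rfl fun b _ => ?_
      have h4 : gram x₁ (chartChange m x₀ x₁ (hyperplane z)) a.succ b.succ =
          (gram x₁ (hyperplane (tailL m (extChartAt (𝓡∂ (m + 1)) x₁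
            ((extChartAt (𝓡∂ (m + 1)) x₀).symm (hyperplane z)))))).submatrix
              Fin.succ Fin.succ a b := by
        rw [← h2]; rfl
      rw [h4]
      rfl

/-- The surface measure is carried by the boundary. -/
theorem surfaceMeasure_boundary_compl :
    surfaceMeasure m M ((𝓡∂ (m + 1)).boundary M)ᶜ = 0 := by
  have hb := ((𝓡∂ (m + 1)).isClosed_boundary (M := M) (n := ∞) (by simp)).measurableSet
  have h : surfaceMeasure m M ≤ (surfaceMeasure m M).restrict ((𝓡∂ (m + 1)).boundary M) := by
    refine iSup_le fun x₀ => ?_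
    rw [← surfaceMeasure_restrict_source x₀]
    exact Measure.restrict_mono_set _ inter_subset_right
  refine le_antisymm ((h _).trans ?_) bot_le
  rw [Measure.restrict_apply hb.compl, compl_inter_self, measure_empty]

end Volume

end

section

open Filter
open scoped Topology

theorem integrable_of_continuousOn_compact {X : Type*} [TopologicalSpace X] [T2Space X]
    [MeasurableSpace X] [BorelSpace X] {μ : Measure X} [IsFiniteMeasureOnCompacts μ] {K : Set X}
    (hK : IsCompact K) {g : X → ℝ} (hg : ContinuousOn g K) (h0 : ∀ᵐ x ∂μ, x ∉ K → g x = 0) :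
    Integrable g μ :=
  (hg.integrableOn_compact hK).integrable_of_ae_notMem_eq_zero h0

theorem map_withDensity_image_lt_top {X V : Type*} [TopologicalSpace X] [MeasurableSpace X]
    [BorelSpace X] [TopologicalSpace V] [T2Space V] [MeasurableSpace V] [BorelSpace V]
    {ν : Measure V} [SFinite ν] [IsFiniteMeasureOnCompacts ν] {T K : Set V} (hT : MeasurableSet T)
    {Ψ : V → X} (hΨ : ContinuousOn Ψ T) {ρ : V → ℝ} (hρ : ContinuousOn ρ T) (hK : IsCompact K)
    {A : Set X} (hA : MeasurableSet A) (hAK : Ψ ⁻¹' A ∩ T ⊆ K) (hKT : K ⊆ T) :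
    Measure.map Ψ ((ν.restrict T).withDensity fun y => ENNReal.ofReal (ρ y)) A < ⊤ := by
  rw [map_withDensity_apply hT (hΨ.aemeasurable hT) _ hA]
  refine (lintegral_mono_set hAK).trans_lt ?_
  exact ((hρ.mono hKT).integrableOn_compact hK).lintegral_lt_top

section

variable {m : ℕ} {M : Type*} [TopologicalSpace M]
  [ChartedSpace (EuclideanHalfSpace (m + 1)) M]

/-- Every point has an open neighbourhood which corresponds, in the chart, to a subset of a compact
subset of the target. -/
theorem exists_isOpen_subset_compact (x₀ : M) :
    ∃ A : Set M, IsOpen A ∧ x₀ ∈ A ∧ A ⊆ (extChartAt (𝓡∂ (m + 1)) x₀).source ∧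
      ∃ K, IsCompact K ∧ K ⊆ (extChartAt (𝓡∂ (m + 1)) x₀).target ∧
        (extChartAt (𝓡∂ (m + 1)) x₀).symm ⁻¹' A ∩ (extChartAt (𝓡∂ (m + 1)) x₀).target ⊆ K := by
  obtain ⟨O, hO, hT⟩ := relOpen_target (m := m) x₀
  have h0 : extChartAt (𝓡∂ (m + 1)) x₀ x₀ ∈ O :=
    (hT ▸ mem_extChartAt_target x₀ : extChartAt (𝓡∂ (m + 1)) x₀ x₀ ∈ O ∩ _).1
  obtain ⟨r, hr, hball⟩ := Metric.nhds_basis_closedBall.mem_iff.1 (hO.mem_nhds h0)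
  refine ⟨(extChartAt (𝓡∂ (m + 1)) x₀).source ∩ extChartAt (𝓡∂ (m + 1)) x₀ ⁻¹'
    Metric.ball (extChartAt (𝓡∂ (m + 1)) x₀ x₀) r, ?_, ?_, inter_subset_left,
    Metric.closedBall (extChartAt (𝓡∂ (m + 1)) x₀ x₀) r ∩ range (𝓡∂ (m + 1)), ?_, ?_, ?_⟩
  · exact (continuousOn_extChartAt x₀).isOpen_inter_preimage (isOpen_extChartAt_source x₀)
      Metric.isOpen_ball
  · exact ⟨mem_extChartAt_source x₀, Metric.mem_ball_self hr⟩
  · exact (isCompact_closedBall _ _).inter_right isClosed_range_halfSpace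
  · rw [hT]
    exact inter_subset_inter_left _ hball
  · rintro y ⟨⟨-, hy⟩, hyT⟩
    rw [mem_preimage, (extChartAt (𝓡∂ (m + 1)) x₀).right_inv hyT] at hy
    exact ⟨Metric.ball_subset_closedBall hy, (hT ▸ hyT : y ∈ O ∩ _).2⟩

variable [IsManifold (𝓡∂ (m + 1)) ∞ M]
  [RiemannianBundle (fun x : M => TangentSpace (𝓡∂ (m + 1)) x)]

/-- The inverse metric component `g⁰⁰` compares the volume density with the surface density. -/
theorem sqrt_det_mul_sqrt_inv (x₀ : M) {y : EuclideanSpace ℝ (Fin (m + 1))}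
    (hy : y ∈ (extChartAt (𝓡∂ (m + 1)) x₀).target) :
    √(gram x₀ y).det * √((gram x₀ y)⁻¹ 0 0) =
      √((gram x₀ y).submatrix Fin.succ Fin.succ).det := by
  have h := det_gram_pos x₀ hy
  rw [← Real.sqrt_mul h.le, Matrix.inv_def, Matrix.smul_apply,
    Matrix.adjugate_fin_succ_eq_det_submatrix, Ring.inverse_eq_inv']
  congr 1
  simp only [smul_eq_mul, Fin.val_zero, add_zero, pow_zero, one_mul, ← mul_assoc,
    mul_inv_cancel₀ h.ne']
  rfl

variable [IsContMDiffRiemannianBundle (𝓡∂ (m + 1)) ∞ (EuclideanSpace ℝ (Fin (m + 1)))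
    (fun x : M => TangentSpace (𝓡∂ (m + 1)) x)]

theorem continuousOn_sqrt_det_gram_hyperplane (x₀ : M) : ContinuousOn
    (fun z : EuclideanSpace ℝ (Fin m) =>
      √((gram x₀ (hyperplane z)).submatrix Fin.succ Fin.succ).det)
    (hyperplane ⁻¹' (extChartAt (𝓡∂ (m + 1)) x₀).target) := by
  have h : ContDiffOn ℝ ∞ (fun y => ((gram x₀ y).submatrix Fin.succ Fin.succ).det)
      (extChartAt (𝓡∂ (m + 1)) x₀).target :=
    contDiffOn_det fun i j => contDiffOn_gram x₀ _ _
  exact Real.continuous_sqrt.comp_continuousOn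
    (h.continuousOn.comp continuous_hyperplane.continuousOn fun _ hz => hz)

variable [MeasurableSpace M] [BorelSpace M]

theorem isLocallyFiniteMeasure_volumeMeasure : IsLocallyFiniteMeasure (volumeMeasure m M) := by
  refine ⟨fun x₀ => ?_⟩
  obtain ⟨A, hA, hx, hAs, K, hK, hKT, hAK⟩ := exists_isOpen_subset_compact (m := m) x₀
  refine ⟨A, hA.mem_nhds hx, ?_⟩
  have h : volumeMeasure m M A = chartVolume (m := m) x₀ A := by
    rw [← volumeMeasure_restrict_source x₀, Measure.restrict_apply hA.measurableSet,
      inter_eq_left.2 hAs]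
  rw [h]
  exact map_withDensity_image_lt_top (ν := volume) (relOpen_target x₀).measurableSet
    (continuousOn_extChartAt_symm x₀) (contDiffOn_sqrt_det_gram x₀).continuousOn hK hA.measurableSet
    hAK hKT

theorem isLocallyFiniteMeasure_surfaceMeasure : IsLocallyFiniteMeasure (surfaceMeasure m M) := by
  refine ⟨fun x₀ => ?_⟩
  obtain ⟨A, hA, hx, hAs, K, hK, hKT, hAK⟩ := exists_isOpen_subset_compact (m := m) x₀
  refine ⟨A, hA.mem_nhds hx, ?_⟩
  have h : surfaceMeasure m M A = chartSurface (m := m) x₀ A := by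
    rw [← surfaceMeasure_restrict_source x₀, Measure.restrict_apply hA.measurableSet]
    have hb : (𝓡∂ (m + 1)).boundary M ∈ ae (surfaceMeasure m M) := surfaceMeasure_boundary_compl
    rw [← inter_assoc, inter_eq_left.2 hAs]
    refine (measure_congr ?_).symm
    filter_upwards [hb] with x hx
    exact propext ⟨fun h => h.1, fun h => ⟨h, hx⟩⟩
  rw [h]
  have hK' : IsCompact (hyperplane ⁻¹' K : Set (EuclideanSpace ℝ (Fin m))) := by
    have h1 : (hyperplane ⁻¹' K : Set (EuclideanSpace ℝ (Fin m))) ⊆ tailL m '' K := fun z hz =>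
      ⟨hyperplane z, hz, tailL_hyperplane z⟩
    exact (hK.image (tailL m).continuous).of_isClosed_subset
      (hK.isClosed.preimage continuous_hyperplane) h1
  exact map_withDensity_image_lt_top (ν := volume) (measurableSet_hyperplane_preimage_target x₀)
    (continuousOn_symm_hyperplane x₀) (continuousOn_sqrt_det_gram_hyperplane x₀) hK'
    hA.measurableSet (fun z hz => hAK hz) fun z hz => hKT hz

theorem integral_volumeMeasure_eq (x₀ : M) {g : M → ℝ}
    (hg : ContinuousOn g (extChartAt (𝓡∂ (m + 1)) x₀).source)
    (h0 : ∀ x ∉ (extChartAt (𝓡∂ (m + 1)) x₀).source, g x = 0) :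
    ∫ x, g x ∂volumeMeasure m M = ∫ y in (extChartAt (𝓡∂ (m + 1)) x₀).target,
      √(gram x₀ y).det * g ((extChartAt (𝓡∂ (m + 1)) x₀).symm y) := by
  rw [← setIntegral_eq_integral_of_forall_compl_eq_zero h0]
  have hm : AEStronglyMeasurable g (chartVolume (m := m) x₀) := by
    rw [← volumeMeasure_restrict_source x₀]
    exact hg.aestronglyMeasurable (isOpen_extChartAt_source x₀).measurableSet
  have hT := (relOpen_target (m := m) x₀).measurableSet
  rw [volumeMeasure_restrict_source x₀, chartVolume, integral_map
    ((aemeasurable_symm x₀).mono_ac (withDensity_absolutelyContinuous _ _)) hm,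
    integral_withDensity_eq_integral_toReal_smul₀
      ((contDiffOn_sqrt_det_gram x₀).continuousOn.aemeasurable hT).ennreal_ofReal
      (Eventually.of_forall fun _ => ENNReal.ofReal_lt_top)]
  simp [ENNReal.toReal_ofReal, Real.sqrt_nonneg]

theorem integral_surfaceMeasure_eq (x₀ : M) {g : M → ℝ}
    (hg : ContinuousOn g ((extChartAt (𝓡∂ (m + 1)) x₀).source ∩ (𝓡∂ (m + 1)).boundary M))
    (h0 : ∀ x ∉ (extChartAt (𝓡∂ (m + 1)) x₀).source, g x = 0) :
    ∫ x, g x ∂surfaceMeasure m M =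
      ∫ z in hyperplane ⁻¹' (extChartAt (𝓡∂ (m + 1)) x₀).target,
        √((gram x₀ (hyperplane z)).submatrix Fin.succ Fin.succ).det *
          g ((extChartAt (𝓡∂ (m + 1)) x₀).symm (hyperplane z)) := by
  have hb : (𝓡∂ (m + 1)).boundary M ∈ ae (surfaceMeasure m M) := surfaceMeasure_boundary_compl
  rw [← setIntegral_eq_integral_of_ae_compl_eq_zero
    (s := (extChartAt (𝓡∂ (m + 1)) x₀).source ∩ (𝓡∂ (m + 1)).boundary M)
    (by filter_upwards [hb] with x hx hxs using h0 x fun h => hxs ⟨h, hx⟩)]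
  have hm : AEStronglyMeasurable g (chartSurface (m := m) x₀) := by
    rw [← surfaceMeasure_restrict_source x₀]
    exact hg.aestronglyMeasurable (measurableSet_source_inter_boundary x₀)
  have hT := measurableSet_hyperplane_preimage_target (m := m) x₀
  rw [surfaceMeasure_restrict_source x₀, chartSurface, integral_map
    ((aemeasurable_symm_hyperplane x₀).mono_ac (withDensity_absolutelyContinuous _ _)) hm,
    integral_withDensity_eq_integral_toReal_smul₀
      ((continuousOn_sqrt_det_gram_hyperplane x₀).aemeasurable hT).ennreal_ofReal
      (Eventually.of_forall fun _ => ENNReal.ofReal_lt_top)]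
  simp [ENNReal.toReal_ofReal, Real.sqrt_nonneg]

end

end

section

open Filter
open scoped Topology

/-! ### The pairing of gradients -/

/-- The pairing of covectors by the inverse metric is invariant under linear changes of
variables. -/
theorem dotProduct_inv_mulVec_eq {n : Type*} [Fintype n] [DecidableEq n] {G G₁ N : Matrix n n ℝ}
    (hG : G.det ≠ 0) (h : G = N.transpose * G₁ * N) {p q p₁ q₁ : n → ℝ}
    (hp : p = N.transpose.mulVec p₁) (hq : q = N.transpose.mulVec q₁) :
    p ⬝ᵥ G⁻¹.mulVec q = p₁ ⬝ᵥ G₁⁻¹.mulVec q₁ := by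
  have hN : IsUnit N.det := by
    refine isUnit_iff_ne_zero.2 fun h0 => hG ?_
    rw [h, Matrix.det_mul, h0, mul_zero]
  have hN' : IsUnit N.transpose.det := by rwa [Matrix.det_transpose]
  have h1 : N * G⁻¹ * N.transpose = G₁⁻¹ := by
    rw [h, Matrix.mul_inv_rev, Matrix.mul_inv_rev, ← Matrix.mul_assoc, Matrix.mul_nonsing_inv _ hN,
      Matrix.one_mul, Matrix.mul_assoc, Matrix.nonsing_inv_mul _ hN', Matrix.mul_one]
  rw [← h1, hp, hq, ← Matrix.mulVec_mulVec, ← Matrix.mulVec_mulVec, Matrix.mulVec_transpose,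
    Matrix.dotProduct_mulVec p₁ N]

section

variable {m : ℕ} {M : Type*} [TopologicalSpace M] [ChartedSpace (EuclideanHalfSpace (m + 1)) M]

variable (m) in
/-- The pairing `⟨∇v, ∇f⟩` of the gradients of two functions, computed at each point in the
preferred chart around this point. -/
noncomputable def gradPairing [RiemannianBundle (fun x : M => TangentSpace (𝓡∂ (m + 1)) x)]
    (v f : M → ℝ) (x : M) : ℝ :=
  ∑ i, pderiv (v ∘ (extChartAt (𝓡∂ (m + 1)) x).symm) i (extChartAt (𝓡∂ (m + 1)) x x) *
    gradCoord x f i (extChartAt (𝓡∂ (m + 1)) x x)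

theorem gradPairing_comm [RiemannianBundle (fun x : M => TangentSpace (𝓡∂ (m + 1)) x)]
    (v f : M → ℝ) (x : M) : gradPairing m v f x = gradPairing m f v x := by
  simp only [gradPairing, gradCoord, Finset.mul_sum]
  rw [Finset.sum_comm]
  refine Finset.sum_congr rfl fun i _ => Finset.sum_congr rfl fun j _ => ?_
  rw [gram_inv_comm]
  ring

variable [IsManifold (𝓡∂ (m + 1)) ∞ M]

theorem contDiffOn_comp_symm_of_contMDiff {v : M → ℝ} (hv : ContMDiff (𝓡∂ (m + 1)) 𝓘(ℝ, ℝ) ∞ v)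
    (x₀ : M) : ContDiffOn ℝ ∞ (v ∘ (extChartAt (𝓡∂ (m + 1)) x₀).symm)
      (extChartAt (𝓡∂ (m + 1)) x₀).target := by
  rw [← contMDiffOn_iff_contDiffOn]
  exact hv.comp_contMDiffOn (contMDiffOn_extChartAt_symm x₀)

/-- The chain rule for the coordinate expressions of a function in two charts. -/
theorem pderiv_comp_symm_eq {v : M → ℝ} (hv : ContMDiff (𝓡∂ (m + 1)) 𝓘(ℝ, ℝ) ∞ v) {x₀ x₁ : M}
    {y : EuclideanSpace ℝ (Fin (m + 1))} (hy : y ∈ chartOverlap m x₀ x₁) (i : Fin (m + 1)) :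
    pderiv (v ∘ (extChartAt (𝓡∂ (m + 1)) x₀).symm) i y =
      ∑ a, fderivWithin ℝ (chartChange m x₀ x₁) (range (𝓡∂ (m + 1))) y
        (EuclideanSpace.single i 1) a *
          pderiv (v ∘ (extChartAt (𝓡∂ (m + 1)) x₁).symm) a (chartChange m x₀ x₁ y) := by
  have hO := relOpen_chartOverlap (m := m) x₀ x₁
  have h1 : EqOn (v ∘ (extChartAt (𝓡∂ (m + 1)) x₀).symm)
      ((v ∘ (extChartAt (𝓡∂ (m + 1)) x₁).symm) ∘ chartChange m x₀ x₁) (chartOverlap m x₀ x₁) :=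
    fun z hz => congrArg v (symm_chartChange hz).symm
  have h2 := ((contDiffOn_comp_symm_of_contMDiff hv x₁).of_le
    (by simp : (1 : ℕ∞ω) ≤ ∞)).differentiableWithinAt_range (relOpen_target x₁) (chartChange_mem hy)
  have h3 := (h2.hasFDerivWithinAt.comp y ((hasFDerivWithinAt_chartChange hy).mono hO.subset_range)
    fun z hz => (relOpen_target (m := m) x₁).subset_range
      (chartChange_mem hz)).congr_of_eventuallyEq
    (eventually_of_mem self_mem_nhdsWithin h1) (h1 hy)
  have h4 := h3.mono_of_mem_nhdsWithin (s := range (𝓡∂ (m + 1))) (hO.mem_nhdsWithin hy)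
  rw [pderiv, h4.fderivWithin ((𝓡∂ (m + 1)).uniqueDiffOn y (hO.subset_range hy))]
  simp_rw [mul_comm (fderivWithin ℝ (chartChange m x₀ x₁) (range (𝓡∂ (m + 1))) y
    (EuclideanSpace.single i 1) _)]
  rw [sum_pderiv_mul]
  rfl

variable [RiemannianBundle (fun x : M => TangentSpace (𝓡∂ (m + 1)) x)]

/-- The pairing of gradients is given by the same formula in every chart. -/
theorem gradPairing_eq {v f : M → ℝ} (hv : ContMDiff (𝓡∂ (m + 1)) 𝓘(ℝ, ℝ) ∞ v)
    (hf : ContMDiff (𝓡∂ (m + 1)) 𝓘(ℝ, ℝ) ∞ f) {x₀ x : M}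
    (hx : x ∈ (extChartAt (𝓡∂ (m + 1)) x₀).source) :
    gradPairing m v f x =
      ∑ i, pderiv (v ∘ (extChartAt (𝓡∂ (m + 1)) x₀).symm) i (extChartAt (𝓡∂ (m + 1)) x₀ x) *
        gradCoord x₀ f i (extChartAt (𝓡∂ (m + 1)) x₀ x) := by
  have hxx := (extChartAt (𝓡∂ (m + 1)) x₀).left_inv hx
  set y := extChartAt (𝓡∂ (m + 1)) x₀ x with hy
  have hyT : y ∈ (extChartAt (𝓡∂ (m + 1)) x₀).target := (extChartAt (𝓡∂ (m + 1)) x₀).map_source hx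
  have hyO : y ∈ chartOverlap m x₀ x :=
    ⟨hyT, by rw [mem_preimage, hxx]; exact mem_extChartAt_source x⟩
  have hc : chartChange m x₀ x y = extChartAt (𝓡∂ (m + 1)) x x := by
    rw [chartChange, Function.comp, hxx]
  rw [gradPairing, ← hc]
  have := dotProduct_inv_mulVec_eq (G := gram x₀ y) (G₁ := gram x (chartChange m x₀ x y))
    (N := Matrix.of fun a i => fderivWithin ℝ (chartChange m x₀ x) (range (𝓡∂ (m + 1))) y
      (EuclideanSpace.single i 1) a)
    (p := fun i => pderiv (v ∘ (extChartAt (𝓡∂ (m + 1)) x₀).symm) i y)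
    (q := fun i => pderiv (f ∘ (extChartAt (𝓡∂ (m + 1)) x₀).symm) i y)
    (p₁ := fun i => pderiv (v ∘ (extChartAt (𝓡∂ (m + 1)) x).symm) i (chartChange m x₀ x y))
    (q₁ := fun i => pderiv (f ∘ (extChartAt (𝓡∂ (m + 1)) x).symm) i (chartChange m x₀ x y))
    (det_gram_pos x₀ hyT).ne' ?_ (funext fun i => pderiv_comp_symm_eq hv hyO i)
    (funext fun i => pderiv_comp_symm_eq hf hyO i)
  · exact this.symm
  · ext i j
    rw [gram_eq_sum hyO, Matrix.mul_apply, Finset.sum_comm]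
    refine Finset.sum_congr rfl fun b _ => ?_
    rw [Matrix.mul_apply, Finset.sum_mul]
    rfl

theorem gradPairing_sum {ι : Type*} (s : Finset ι) {v : ι → M → ℝ} (f : M → ℝ)
    (hv : ∀ k ∈ s, ContMDiff (𝓡∂ (m + 1)) 𝓘(ℝ, ℝ) ∞ (v k)) (x : M) :
    gradPairing m (fun x => ∑ k ∈ s, v k x) f x = ∑ k ∈ s, gradPairing m (v k) f x := by
  simp only [gradPairing]
  rw [Finset.sum_comm]
  refine Finset.sum_congr rfl fun i _ => ?_
  rw [← Finset.sum_mul]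
  congr 1
  have hy : extChartAt (𝓡∂ (m + 1)) x x ∈ (extChartAt (𝓡∂ (m + 1)) x).target :=
    mem_extChartAt_target x
  simp only [pderiv]
  rw [show (fun x => ∑ k ∈ s, v k x) ∘ (extChartAt (𝓡∂ (m + 1)) x).symm =
    fun y => ∑ k ∈ s, (v k ∘ (extChartAt (𝓡∂ (m + 1)) x).symm) y from rfl,
    fderivWithin_fun_sum ((𝓡∂ (m + 1)).uniqueDiffOn _ ((relOpen_target x).subset_range hy))
      fun k hk => ((contDiffOn_comp_symm_of_contMDiff (hv k hk) x).of_le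
        (by simp : (1 : ℕ∞ω) ≤ ∞)).differentiableWithinAt_range (relOpen_target x) hy]
  simp

variable [IsContMDiffRiemannianBundle (𝓡∂ (m + 1)) ∞ (EuclideanSpace ℝ (Fin (m + 1)))
    (fun x : M => TangentSpace (𝓡∂ (m + 1)) x)]

theorem continuous_gradPairing {v f : M → ℝ} (hv : ContMDiff (𝓡∂ (m + 1)) 𝓘(ℝ, ℝ) ∞ v)
    (hf : ContMDiff (𝓡∂ (m + 1)) 𝓘(ℝ, ℝ) ∞ f) : Continuous (gradPairing m v f) := by
  refine continuous_iff_continuousAt.2 fun x₀ => ?_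
  have hc : ContinuousOn (fun y => ∑ i, pderiv (v ∘ (extChartAt (𝓡∂ (m + 1)) x₀).symm) i y *
      gradCoord x₀ f i y) (extChartAt (𝓡∂ (m + 1)) x₀).target :=
    continuousOn_finsetSum _ fun i _ =>
      (contDiffOn_pderiv (k := ∞) (relOpen_target x₀) (contDiffOn_comp_symm_of_contMDiff hv x₀)
        le_rfl i).continuousOn.mul
      (contDiffOn_gradCoord x₀ (contDiffOn_comp_symm_of_contMDiff hf x₀) i).continuousOn
  have h2 : ContinuousOn (gradPairing m v f) (extChartAt (𝓡∂ (m + 1)) x₀).source :=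
    (hc.comp (continuousOn_extChartAt x₀) (extChartAt (𝓡∂ (m + 1)) x₀).mapsTo).congr
      fun x hx => gradPairing_eq hv hf hx
  exact h2.continuousAt (extChartAt_source_mem_nhds x₀)

end

end

section

open Filter
open scoped Topology

/-! ### Green's formula -/

section

variable {m : ℕ} {M : Type*} [TopologicalSpace M] [ChartedSpace (EuclideanHalfSpace (m + 1)) M]
  [RiemannianBundle (fun x : M => TangentSpace (𝓡∂ (m + 1)) x)]

theorem gradPairing_eq_zero {v : M → ℝ} (f : M → ℝ) {K : Set M} (hK : IsClosed K)
    (hv : ∀ x ∉ K, v x = 0) {x : M} (hx : x ∉ K) : gradPairing m v f x = 0 := by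
  refine Finset.sum_eq_zero fun i _ => ?_
  have h1 : v ∘ (extChartAt (𝓡∂ (m + 1)) x).symm =ᶠ[𝓝[range (𝓡∂ (m + 1))]
      (extChartAt (𝓡∂ (m + 1)) x x)] fun _ => 0 := by
    have h2 : Tendsto (extChartAt (𝓡∂ (m + 1)) x).symm
        (𝓝[range (𝓡∂ (m + 1))] (extChartAt (𝓡∂ (m + 1)) x x)) (𝓝 x) := by
      have := (continuousAt_extChartAt_symm (I := 𝓡∂ (m + 1)) x).tendsto
      rw [extChartAt_to_inv] at this
      exact this.mono_left nhdsWithin_le_nhds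
    filter_upwards [h2 (hK.isOpen_compl.mem_nhds hx)] with y hy using hv _ hy
  rw [pderiv_congr h1 ((relOpen_target x).subset_range (mem_extChartAt_target x))]
  simp [pderiv]

variable [IsManifold (𝓡∂ (m + 1)) ∞ M]
  [IsContMDiffRiemannianBundle (𝓡∂ (m + 1)) ∞ (EuclideanSpace ℝ (Fin (m + 1)))
    (fun x : M => TangentSpace (𝓡∂ (m + 1)) x)]
  [MeasurableSpace M] [BorelSpace M] [T2Space M] {v f Lf Nf : M → ℝ} {K : Set M}

/-- Green's first formula for a function `v` supported in the domain of a chart. -/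
theorem integral_mul_laplacian_add_gradPairing_of_subset_source
    (hv : ContMDiff (𝓡∂ (m + 1)) 𝓘(ℝ, ℝ) ∞ v) (hf : ContMDiff (𝓡∂ (m + 1)) 𝓘(ℝ, ℝ) ∞ f) {x₀ : M}
    (hK : IsCompact K) (hKs : K ⊆ (extChartAt (𝓡∂ (m + 1)) x₀).source) (hvK : ∀ x ∉ K, v x = 0)
    (hL : ∀ x ∈ (extChartAt (𝓡∂ (m + 1)) x₀).source,
      laplacian x₀ f (extChartAt (𝓡∂ (m + 1)) x₀ x) = Lf x)
    (hN : ∀ x ∈ (extChartAt (𝓡∂ (m + 1)) x₀).source, x ∈ (𝓡∂ (m + 1)).boundary M →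
      normalDeriv x₀ f (extChartAt (𝓡∂ (m + 1)) x₀ x) = Nf x)
    (hLc : Continuous Lf) (hNc : ContinuousOn Nf ((𝓡∂ (m + 1)).boundary M)) :
    ∫ x, (v x * Lf x + gradPairing m v f x) ∂volumeMeasure m M =
      ∫ x, v x * Nf x ∂surfaceMeasure m M := by
  set T := (extChartAt (𝓡∂ (m + 1)) x₀).target with hTdef
  set Ψ := (extChartAt (𝓡∂ (m + 1)) x₀).symm with hΨ
  have hT : RelOpen T := relOpen_target x₀
  have hv0 : ∀ x ∉ (extChartAt (𝓡∂ (m + 1)) x₀).source, v x = 0 := fun x hx =>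
    hvK x fun h => hx (hKs h)
  have hvT := contDiffOn_comp_symm_of_contMDiff hv x₀
  have hfT := contDiffOn_comp_symm_of_contMDiff hf x₀
  set X : Fin (m + 1) → EuclideanSpace ℝ (Fin (m + 1)) → ℝ := fun i y =>
    √(gram x₀ y).det * gradCoord x₀ f i y with hX
  have hXc : ∀ i, ContDiffOn ℝ ∞ (X i) T := fun i =>
    (contDiffOn_sqrt_det_gram x₀).mul (contDiffOn_gradCoord x₀ hfT i)
  set K' := extChartAt (𝓡∂ (m + 1)) x₀ '' K with hK'
  have hK'c : IsCompact K' := hK.image_of_continuousOn ((continuousOn_extChartAt x₀).mono hKs)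
  have hK'T : K' ⊆ T := by
    rintro _ ⟨x, hx, rfl⟩
    exact (extChartAt (𝓡∂ (m + 1)) x₀).map_source (hKs hx)
  have hvK' : ∀ y ∈ T, y ∉ K' → (v ∘ Ψ) y = 0 := fun y hy hyK => hvK _ fun h =>
    hyK ⟨_, h, (extChartAt (𝓡∂ (m + 1)) x₀).right_inv hy⟩
  rw [integral_volumeMeasure_eq x₀ (g := fun x => v x * Lf x + gradPairing m v f x)
    ((hv.continuous.mul hLc).add (continuous_gradPairing hv hf)).continuousOn
    (fun x hx => by
      rw [hv0 x hx, gradPairing_eq_zero f hK.isClosed hvK fun h => hx (hKs h)]; simp),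
    integral_surfaceMeasure_eq x₀ (g := fun x => v x * Nf x)
      ((hv.continuous.continuousOn.mul hNc).mono inter_subset_right)
      (fun x hx => by rw [hv0 x hx, zero_mul])]
  have h1 : ∀ y ∈ T, √(gram x₀ y).det * (v (Ψ y) * Lf (Ψ y) + gradPairing m v f (Ψ y)) =
      (v ∘ Ψ) y * ∑ i, pderiv (X i) i y + ∑ i, pderiv (v ∘ Ψ) i y * X i y := by
    intro y hy
    have hys := (extChartAt (𝓡∂ (m + 1)) x₀).map_target hy
    rw [← hL _ hys, gradPairing_eq hv hf hys, (extChartAt (𝓡∂ (m + 1)) x₀).right_inv hy, laplacian,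
      mul_add]
    congr 1
    · have := Real.sqrt_ne_zero'.2 (det_gram_pos x₀ hy)
      rw [mul_left_comm, mul_inv_cancel_left₀ this]
      rfl
    · rw [Finset.mul_sum]
      refine Finset.sum_congr rfl fun i _ => ?_
      rw [hX, mul_left_comm]
  have h2 : ∀ z ∈ hyperplane ⁻¹' T,
      √((gram x₀ (hyperplane z)).submatrix Fin.succ Fin.succ).det *
        (v (Ψ (hyperplane z)) * Nf (Ψ (hyperplane z))) =
      -((v ∘ Ψ) (hyperplane z) * X 0 (hyperplane z)) := by
    intro z hz
    have hzs := (extChartAt (𝓡∂ (m + 1)) x₀).map_target hz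
    rw [← hN _ hzs ((symm_mem_boundary_iff hz).2 rfl), (extChartAt (𝓡∂ (m + 1)) x₀).right_inv hz,
      normalDeriv, ← sqrt_det_mul_sqrt_inv x₀ hz]
    have := Real.sqrt_ne_zero'.2 (gram_inv_diag_pos x₀ hz 0)
    simp only [hX, Function.comp]
    field_simp
  have hpc : ∀ i, ContinuousOn (pderiv (v ∘ Ψ) i) T := fun i =>
    (contDiffOn_pderiv (k := ∞) hT hvT le_rfl i).continuousOn
  have hXd : ∀ i, ContinuousOn (pderiv (X i) i) T := fun i =>
    (contDiffOn_pderiv (k := ∞) hT (hXc i) le_rfl i).continuousOn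
  have i1 : IntegrableOn (fun y => (v ∘ Ψ) y * ∑ i, pderiv (X i) i y) T :=
    integrableOn_of_compact_support hT.measurableSet hK'c hK'T
      (hvT.continuousOn.mul (continuousOn_finsetSum _ fun i _ => hXd i))
      fun y hy hyK => by rw [hvK' y hy hyK, zero_mul]
  have i2 : IntegrableOn (fun y => ∑ i, pderiv (v ∘ Ψ) i y * X i y) T :=
    integrableOn_of_compact_support hT.measurableSet hK'c hK'T
      (continuousOn_finsetSum _ fun i _ => (hpc i).mul (hXc i).continuousOn)
      fun y hy hyK => Finset.sum_eq_zero fun i _ => by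
        rw [pderiv_eq_zero_of_notMem hT hK'c.isClosed hvK' hy hyK, zero_mul]
  rw [setIntegral_congr_fun hT.measurableSet h1,
    setIntegral_congr_fun (measurableSet_hyperplane_preimage_target x₀) h2, integral_neg,
    integral_add i1 i2, green_halfSpace hT hK'c hK'T (hvT.of_le (by simp))
    (fun i => (hXc i).of_le (by simp)) hvK']
  ring

/-- Green's first formula, for functions `Lf` and `Nf` which represent the Laplacian and the normal
derivative of `f` in every chart. -/
theorem green_first [SigmaCompactSpace M]
    (hv : ContMDiff (𝓡∂ (m + 1)) 𝓘(ℝ, ℝ) ∞ v) (hf : ContMDiff (𝓡∂ (m + 1)) 𝓘(ℝ, ℝ) ∞ f)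
    (hK : IsCompact K) (hvK : ∀ x ∉ K, v x = 0)
    (hL : ∀ x₀, ∀ x ∈ (extChartAt (𝓡∂ (m + 1)) x₀).source,
      laplacian x₀ f (extChartAt (𝓡∂ (m + 1)) x₀ x) = Lf x)
    (hN : ∀ x₀, ∀ x ∈ (extChartAt (𝓡∂ (m + 1)) x₀).source, x ∈ (𝓡∂ (m + 1)).boundary M →
      normalDeriv x₀ f (extChartAt (𝓡∂ (m + 1)) x₀ x) = Nf x)
    (hLc : Continuous Lf) (hNc : ContinuousOn Nf ((𝓡∂ (m + 1)).boundary M)) :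
    Integrable (fun x => v x * Lf x + gradPairing m v f x) (volumeMeasure m M) ∧
      Integrable (fun x => v x * Nf x) (surfaceMeasure m M) ∧
      ∫ x, (v x * Lf x + gradPairing m v f x) ∂volumeMeasure m M =
        ∫ x, v x * Nf x ∂surfaceMeasure m M := by
  have hV := isLocallyFiniteMeasure_volumeMeasure (m := m) (M := M)
  have hS := isLocallyFiniteMeasure_surfaceMeasure (m := m) (M := M)
  have hb : (𝓡∂ (m + 1)).boundary M ∈ ae (surfaceMeasure m M) := surfaceMeasure_boundary_compl
  have hbc : IsClosed ((𝓡∂ (m + 1)).boundary M) :=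
    (𝓡∂ (m + 1)).isClosed_boundary (n := ∞) (by simp)
  have intV : ∀ {w : M → ℝ}, ContMDiff (𝓡∂ (m + 1)) 𝓘(ℝ, ℝ) ∞ w → (∀ x ∉ K, w x = 0) →
      Integrable (fun x => w x * Lf x + gradPairing m w f x) (volumeMeasure m M) := fun hw hwK =>
    integrable_of_continuousOn_compact hK
      ((hw.continuous.mul hLc).add (continuous_gradPairing hw hf)).continuousOn
      (Eventually.of_forall fun x hx => by
        rw [hwK x hx, gradPairing_eq_zero f hK.isClosed hwK hx]; simp)
  have intS : ∀ {w : M → ℝ}, ContMDiff (𝓡∂ (m + 1)) 𝓘(ℝ, ℝ) ∞ w → (∀ x ∉ K, w x = 0) →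
      Integrable (fun x => w x * Nf x) (surfaceMeasure m M) := fun hw hwK =>
    integrable_of_continuousOn_compact (hK.inter_right hbc)
      ((hw.continuous.continuousOn.mul hNc).mono inter_subset_right) (by
        filter_upwards [hb] with x hx hxK
        rw [hwK x fun h => hxK ⟨h, hx⟩, zero_mul])
  refine ⟨intV hv hvK, intS hv hvK, ?_⟩
  -- decompose `v` by a partition of unity; only finitely many terms are non-zero on `K`
  obtain ⟨ρ, hρ⟩ := SmoothPartitionOfUnity.exists_isSubordinate_chartAt_source (𝓡∂ (m + 1)) M
  have hfin := ρ.locallyFinite.finite_nonempty_inter_compact hK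
  have hsum : ∀ x, v x = ∑ k ∈ hfin.toFinset, ρ k x * v x := by
    intro x
    by_cases hx : x ∈ K
    · rw [← Finset.sum_mul, ← finsum_eq_sum_of_support_subset, ρ.sum_eq_one (mem_univ x), one_mul]
      intro k hk
      simpa using ⟨x, hk, hx⟩
    · simp [hvK x hx]
  have hρv : ∀ k, ContMDiff (𝓡∂ (m + 1)) 𝓘(ℝ, ℝ) ∞ (fun x => ρ k x * v x) := fun k =>
    (ρ k).contMDiff.mul hv
  have hρK : ∀ k, ∀ x ∉ K, ρ k x * v x = 0 := fun k x hx => by rw [hvK x hx, mul_zero]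
  have hv' : v = fun x => ∑ k ∈ hfin.toFinset, ρ k x * v x := funext hsum
  have hΓ : ∀ x, v x * Lf x + gradPairing m v f x =
      ∑ k ∈ hfin.toFinset, ((ρ k x * v x) * Lf x + gradPairing m (fun x => ρ k x * v x) f x) := by
    intro x
    rw [Finset.sum_add_distrib, ← Finset.sum_mul, ← hsum, ← gradPairing_sum _ f fun k _ => hρv k,
      ← hv']
  have hNs : ∀ x, v x * Nf x = ∑ k ∈ hfin.toFinset, (ρ k x * v x) * Nf x := by
    intro x
    rw [← Finset.sum_mul, ← hsum]
  simp_rw [hΓ]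
  rw [integral_finsetSum _ fun k _ => intV (hρv k) (hρK k), integral_congr_ae
    (Eventually.of_forall hNs), integral_finsetSum _ fun k _ => intS (hρv k) (hρK k)]
  refine Finset.sum_congr rfl fun k _ => ?_
  refine integral_mul_laplacian_add_gradPairing_of_subset_source (x₀ := k) (K := K ∩ tsupport (ρ k))
    (hρv k) hf (hK.inter_right (isClosed_tsupport _)) ?_ ?_ (hL k) (hN k) hLc hNc
  · rw [extChartAt_source]
    exact inter_subset_right.trans (hρ k)
  · intro x hx
    by_cases hxK : x ∈ K
    · rw [image_eq_zero_of_notMem_tsupport fun h => hx ⟨hxK, h⟩, zero_mul]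
    · exact hρK k x hxK

/-- Green's second formula. -/
theorem green_second [SigmaCompactSpace M] {L'f N'f : M → ℝ}
    (hv : ContMDiff (𝓡∂ (m + 1)) 𝓘(ℝ, ℝ) ∞ v) (hf : ContMDiff (𝓡∂ (m + 1)) 𝓘(ℝ, ℝ) ∞ f)
    (hK : IsCompact K) (hvK : ∀ x ∉ K, v x = 0) (hfK : ∀ x ∉ K, f x = 0)
    (hL : ∀ x₀, ∀ x ∈ (extChartAt (𝓡∂ (m + 1)) x₀).source,
      laplacian x₀ f (extChartAt (𝓡∂ (m + 1)) x₀ x) = Lf x)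
    (hN : ∀ x₀, ∀ x ∈ (extChartAt (𝓡∂ (m + 1)) x₀).source, x ∈ (𝓡∂ (m + 1)).boundary M →
      normalDeriv x₀ f (extChartAt (𝓡∂ (m + 1)) x₀ x) = Nf x)
    (hLc : Continuous Lf) (hNc : ContinuousOn Nf ((𝓡∂ (m + 1)).boundary M))
    (hL' : ∀ x₀, ∀ x ∈ (extChartAt (𝓡∂ (m + 1)) x₀).source,
      laplacian x₀ v (extChartAt (𝓡∂ (m + 1)) x₀ x) = L'f x)
    (hN' : ∀ x₀, ∀ x ∈ (extChartAt (𝓡∂ (m + 1)) x₀).source, x ∈ (𝓡∂ (m + 1)).boundary M →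
      normalDeriv x₀ v (extChartAt (𝓡∂ (m + 1)) x₀ x) = N'f x)
    (hLc' : Continuous L'f) (hNc' : ContinuousOn N'f ((𝓡∂ (m + 1)).boundary M)) :
    Integrable (fun x => N'f x * f x - v x * Nf x) (surfaceMeasure m M) ∧
      ∫ x, (L'f x * f x - v x * Lf x) ∂volumeMeasure m M =
        ∫ x, (N'f x * f x - v x * Nf x) ∂surfaceMeasure m M := by
  obtain ⟨i1, j1, e1⟩ := green_first hv hf hK hvK hL hN hLc hNc
  obtain ⟨i2, j2, e2⟩ := green_first hf hv hK hfK hL' hN' hLc' hNc'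
  have h1 : ∀ x, L'f x * f x - v x * Lf x = (f x * L'f x + gradPairing m f v x) -
      (v x * Lf x + gradPairing m v f x) := fun x => by rw [gradPairing_comm f v]; ring
  have h2 : ∀ x, N'f x * f x - v x * Nf x = f x * N'f x - v x * Nf x := fun x => by ring
  simp_rw [h1, h2]
  exact ⟨j2.sub j1, by rw [integral_sub i2 i1, integral_sub j2 j1, e1, e2]⟩

end

end

section

open Filter
open scoped Topology

/-! ### Extension of solutions to negative times -/

section

variable {m : ℕ} {M : Type*} [TopologicalSpace M] [ChartedSpace (EuclideanHalfSpace (m + 1)) M]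
  {w : M × ℝ → ℝ}

theorem contDiff_comp_time
    (hw : ContMDiff ((𝓡∂ (m + 1)).prod 𝓘(ℝ, ℝ)) 𝓘(ℝ, ℝ) ∞ w) (x : M) :
    ContDiff ℝ ∞ fun t => w (x, t) := by
  rw [← contMDiff_iff_contDiff]
  exact hw.comp (contMDiff_const.prodMk contMDiff_id)

theorem contMDiff_slice
    (hw : ContMDiff ((𝓡∂ (m + 1)).prod 𝓘(ℝ, ℝ)) 𝓘(ℝ, ℝ) ∞ w) (t : ℝ) :
    ContMDiff (𝓡∂ (m + 1)) 𝓘(ℝ, ℝ) ∞ fun x => w (x, t) :=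
  hw.comp (contMDiff_id.prodMk contMDiff_const)

variable [IsManifold (𝓡∂ (m + 1)) ∞ M]

/-- The time derivative of a smooth function is jointly smooth in space and time. -/
theorem contMDiff_deriv_time
    (hw : ContMDiff ((𝓡∂ (m + 1)).prod 𝓘(ℝ, ℝ)) 𝓘(ℝ, ℝ) ∞ w) :
    ContMDiff ((𝓡∂ (m + 1)).prod 𝓘(ℝ, ℝ)) 𝓘(ℝ, ℝ) ∞
      fun p : M × ℝ => deriv (fun s => w (p.1, s)) p.2 := by
  intro p
  have h1 : ContMDiffAt (((𝓡∂ (m + 1)).prod 𝓘(ℝ, ℝ)).prod 𝓘(ℝ, ℝ)) 𝓘(ℝ, ℝ) ∞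
      (Function.uncurry fun (p : M × ℝ) (s : ℝ) => w (p.1, s)) (p, p.2) :=
    (hw.comp ((contMDiff_fst.comp contMDiff_fst).prodMk contMDiff_snd)).contMDiffAt
  have h2 := ContMDiffAt.mfderiv (m := ∞) (fun (p : M × ℝ) (s : ℝ) => w (p.1, s))
    (fun p : M × ℝ => p.2) h1 contMDiff_snd.contMDiffAt le_rfl
  replace h2 := (congrArg (fun g => ContMDiffAt ((𝓡∂ (m + 1)).prod 𝓘(ℝ, ℝ)) 𝓘(ℝ, ℝ →L[ℝ] ℝ) ∞ g p)
    (inTangentCoordinates_model_space _ _ _ _)).mp h2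
  have h3 : ContMDiffAt ((𝓡∂ (m + 1)).prod 𝓘(ℝ, ℝ)) 𝓘(ℝ, ℝ) ∞
      (fun p : M × ℝ => (fderiv ℝ (fun s => w (p.1, s)) p.2 : ℝ →L[ℝ] ℝ) 1) p := by
    have h4 : ContMDiff 𝓘(ℝ, ℝ →L[ℝ] ℝ) 𝓘(ℝ, ℝ) ∞ fun L : ℝ →L[ℝ] ℝ => L 1 :=
      ((ContinuousLinearMap.apply ℝ ℝ (1 : ℝ)).contDiff).contMDiff
    have h5 := h4.contMDiffAt.comp p h2
    simp only [mfderiv_eq_fderiv] at h5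
    exact h5
  simpa only [fderiv_apply_one_eq_deriv] using h3

end

section

variable {m : ℕ} {M : Type*} [EMetricSpace M] [CompleteSpace M]
  [ChartedSpace (EuclideanHalfSpace (m + 1)) M] [IsManifold (𝓡∂ (m + 1)) ∞ M]
  [RiemannianBundle (fun x : M => TangentSpace (𝓡∂ (m + 1)) x)]
  [IsContMDiffRiemannianBundle (𝓡∂ (m + 1)) ∞ (EuclideanSpace ℝ (Fin (m + 1)))
    (fun x : M => TangentSpace (𝓡∂ (m + 1)) x)]
  [IsRiemannianManifold (𝓡∂ (m + 1)) M] {F u : M × ℝ → ℝ}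

/-- A solution vanishes near time `0`, so its extension by zero to negative times is smooth. -/
theorem IsSolution.exists_extension (hF : IsBoundarySource m F) (hu : IsSolution m F u) :
    ∃ w : M × ℝ → ℝ, ContMDiff ((𝓡∂ (m + 1)).prod 𝓘(ℝ, ℝ)) 𝓘(ℝ, ℝ) ∞ w ∧
      (∀ x t, 0 ≤ t → w (x, t) = u (x, t)) ∧ ∃ τ > 0, ∀ x, ∀ t ≤ τ, w (x, t) = 0 := by
  obtain ⟨τ, hτ, -, hu0⟩ := hu.exists_eq_zero_of_le hF
  have h0 : ∀ x, ∀ t ≤ τ, (univ ×ˢ Ici (0 : ℝ)).indicator u (x, t) = 0 := by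
    intro x t ht
    by_cases h : 0 ≤ t
    · rw [indicator_of_mem (by exact ⟨mem_univ _, h⟩), hu0 x t ⟨h, ht⟩]
    · exact indicator_of_notMem (fun h' => h h'.2) _
  have h1 : ∀ x t, 0 ≤ t → (univ ×ˢ Ici (0 : ℝ)).indicator u (x, t) = u (x, t) := fun x t ht =>
    indicator_of_mem (by exact ⟨mem_univ _, ht⟩) _
  refine ⟨(univ ×ˢ Ici (0 : ℝ)).indicator u, ?_, h1, τ, hτ, h0⟩
  rintro ⟨x, t⟩
  rcases lt_or_ge t τ with ht | ht
  · refine contMDiffAt_const (c := (0 : ℝ)).congr_of_eventuallyEq ?_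
    filter_upwards [continuous_snd.continuousAt.preimage_mem_nhds (Iio_mem_nhds ht)] with p hp
    exact h0 p.1 p.2 (le_of_lt hp)
  · have htp : t ∈ Ioi 0 := hτ.trans_le ht
    have hn : (univ ×ˢ Ici 0 : Set (M × ℝ)) ∈ 𝓝 (x, t) :=
      prod_mem_nhds univ_mem (Ici_mem_nhds htp)
    refine (hu.smooth.contMDiffAt hn).congr_of_eventuallyEq ?_
    filter_upwards [hn] with p hp using indicator_of_mem hp _

end

/-! ### The formula for the inner product -/

section

variable {m : ℕ} {M : Type*} [EMetricSpace M] [CompleteSpace M] [SecondCountableTopology M]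
  [MeasurableSpace M] [BorelSpace M]
  [ChartedSpace (EuclideanHalfSpace (m + 1)) M] [IsManifold (𝓡∂ (m + 1)) ∞ M]
  [RiemannianBundle (fun x : M => TangentSpace (𝓡∂ (m + 1)) x)]
  [IsContMDiffRiemannianBundle (𝓡∂ (m + 1)) ∞ (EuclideanSpace ℝ (Fin (m + 1)))
    (fun x : M => TangentSpace (𝓡∂ (m + 1)) x)]
  [IsRiemannianManifold (𝓡∂ (m + 1)) M] {F H u v wF wH : M × ℝ → ℝ}

/-- Green's formula turns the space integral of the wave operator of `u(x, t) v(x, s)` into the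
boundary pairing. -/
theorem integral_wave_operator_eq (hF : IsBoundarySource m F) (hH : IsBoundarySource m H)
    (hu : IsSolution m F u) (hv : IsSolution m H v)
    (hwF : ContMDiff ((𝓡∂ (m + 1)).prod 𝓘(ℝ, ℝ)) 𝓘(ℝ, ℝ) ∞ wF)
    (hwH : ContMDiff ((𝓡∂ (m + 1)).prod 𝓘(ℝ, ℝ)) 𝓘(ℝ, ℝ) ∞ wH)
    (hwFu : ∀ x t, 0 ≤ t → wF (x, t) = u (x, t)) (hwHv : ∀ x t, 0 ≤ t → wH (x, t) = v (x, t))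
    {K : Set M} (hK : IsCompact K) {q : ℝ × ℝ} (hq1 : 0 < q.1) (hq2 : 0 < q.2)
    (huK : ∀ x ∉ K, wF (x, q.2) = 0) (hvK : ∀ x ∉ K, wH (x, q.1) = 0) :
    Integrable (boundaryPairing m F H q) (surfaceMeasure m M) ∧
    ∫ x, (deriv (fun s => deriv (fun s => wF (x, s)) s) q.2 * wH (x, q.1) -
      wF (x, q.2) * deriv (fun s => deriv (fun s => wH (x, s)) s) q.1) ∂volumeMeasure m M =
    ∫ x, boundaryPairing m F H q x ∂surfaceMeasure m M := by
  have : LocallyCompactSpace M := Manifold.locallyCompact_of_finiteDimensional (𝓡∂ (m + 1))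
  have hb : (𝓡∂ (m + 1)).boundary M ∈ ae (surfaceMeasure m M) := surfaceMeasure_boundary_compl
  have wave : ∀ {F u w : M × ℝ → ℝ}, IsSolution m F u → (∀ x t, 0 ≤ t → w (x, t) = u (x, t)) →
      ∀ t, 0 < t → ∀ x₀, ∀ x ∈ (extChartAt (𝓡∂ (m + 1)) x₀).source,
      laplacian x₀ (fun x => w (x, t)) (extChartAt (𝓡∂ (m + 1)) x₀ x) =
        deriv (fun s => deriv (fun s => w (x, s)) s) t := by
    intro F u w hu hwu t ht x₀ x hx
    have e : (fun x => w (x, t)) = fun x => u (x, t) := funext fun x => hwu x t ht.le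
    rw [e, ← hu.wave x₀ x hx t ht, iteratedDeriv_succ, iteratedDeriv_one]
    have h1 : ∀ t, 0 < t → (fun s => u (x, s)) =ᶠ[𝓝 t] fun s => w (x, s) := fun t ht => by
      filter_upwards [Ioi_mem_nhds ht] with s hs using (hwu x s (le_of_lt hs)).symm
    refine EventuallyEq.deriv_eq ?_
    filter_upwards [Ioi_mem_nhds ht] with s hs using (h1 s hs).deriv_eq
  have neu : ∀ {F u w : M × ℝ → ℝ}, IsSolution m F u → (∀ x t, 0 ≤ t → w (x, t) = u (x, t)) →
      ∀ t, 0 < t → ∀ x₀, ∀ x ∈ (extChartAt (𝓡∂ (m + 1)) x₀).source,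
      x ∈ (𝓡∂ (m + 1)).boundary M →
      normalDeriv x₀ (fun x => w (x, t)) (extChartAt (𝓡∂ (m + 1)) x₀ x) = F (x, t) := by
    intro F u w hu hwu t ht x₀ x hx hxb
    have e : (fun x => w (x, t)) = fun x => u (x, t) := funext fun x => hwu x t ht.le
    rw [e, hu.neumann x₀ x hx hxb t ht]
  have cN : ∀ {F : M × ℝ → ℝ}, IsBoundarySource m F → ∀ t,
      ContinuousOn (fun x => F (x, t)) ((𝓡∂ (m + 1)).boundary M) := fun hF t =>
    hF.smooth.continuousOn.comp (f := fun x : M => (x, t)) (by fun_prop)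
      fun x hx => ⟨hx, mem_univ _⟩
  have cL : ∀ {w : M × ℝ → ℝ}, ContMDiff ((𝓡∂ (m + 1)).prod 𝓘(ℝ, ℝ)) 𝓘(ℝ, ℝ) ∞ w → ∀ t,
      Continuous fun x => deriv (fun s => deriv (fun s => w (x, s)) s) t := fun hw t =>
    (contMDiff_slice (contMDiff_deriv_time (contMDiff_deriv_time hw)) t).continuous
  obtain ⟨h1, h2⟩ := green_second (contMDiff_slice hwF q.2) (contMDiff_slice hwH q.1) hK huK hvK
    (wave hv hwHv q.1 hq1) (neu hv hwHv q.1 hq1) (cL hwH q.1) (cN hH q.1)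
    (wave hu hwFu q.2 hq2) (neu hu hwFu q.2 hq2) (cL hwF q.2) (cN hF q.2)
  have h3 : (fun x => F (x, q.2) * wH (x, q.1) - wF (x, q.2) * H (x, q.1))
      =ᵐ[surfaceMeasure m M] boundaryPairing m F H q := by
    filter_upwards [hb] with x hx
    rw [boundaryPairing, hu.response_eq hx hq2, hv.response_eq hx hq1, hwFu x _ hq2.le,
      hwHv x _ hq1.le]
  exact ⟨h1.congr h3, h2.trans (integral_congr_ae h3)⟩

end

end

end NeumannWave

theorem mainTheorem11 {m : ℕ} {M : Type*} [EMetricSpace M] [CompleteSpace M]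
    [SecondCountableTopology M] [MeasurableSpace M] [BorelSpace M]
    [ChartedSpace (EuclideanHalfSpace (m + 1)) M] [IsManifold (𝓡∂ (m + 1)) ∞ M]
    [RiemannianBundle (fun x : M => TangentSpace (𝓡∂ (m + 1)) x)]
    [IsContMDiffRiemannianBundle (𝓡∂ (m + 1)) ∞ (EuclideanSpace ℝ (Fin (m + 1)))
      (fun x : M => TangentSpace (𝓡∂ (m + 1)) x)]
    [IsRiemannianManifold (𝓡∂ (m + 1)) M]
    (F H : M × ℝ → ℝ)
    (hF : NeumannWave.IsBoundarySource m F) (hH : NeumannWave.IsBoundarySource m H)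
    (uF uH : M × ℝ → ℝ)
    (huF : NeumannWave.IsSolution m F uF) (huH : NeumannWave.IsSolution m H uH)
    (T : ℝ) (hT : 0 < T) :
    Integrable (fun x => uF (x, T) * uH (x, T)) (NeumannWave.volumeMeasure m M) ∧
    (∀ q ∈ NeumannWave.triangle T,
      Integrable (NeumannWave.boundaryPairing m F H q) (NeumannWave.surfaceMeasure m M)) ∧
    IntegrableOn
      (fun q => ∫ x, NeumannWave.boundaryPairing m F H q x ∂(NeumannWave.surfaceMeasure m M))
      (NeumannWave.triangle T) ∧
    ∫ x, uF (x, T) * uH (x, T) ∂(NeumannWave.volumeMeasure m M) =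
      1 / 2 * ∫ q in NeumannWave.triangle T,
        ∫ x, NeumannWave.boundaryPairing m F H q x ∂(NeumannWave.surfaceMeasure m M) := by
  -- extensions of the solutions to all times, and a common compact support up to time `2 T`
  open NeumannWave Filter in
  obtain ⟨wF, hwF, hwFu, τF, hτF, hF0⟩ := huF.exists_extension hF
  obtain ⟨wH, hwH, hwHu, τH, hτH, hH0⟩ := huH.exists_extension hH
  obtain ⟨K₁, hK₁, hK₁0⟩ := huF.exists_isCompact hF (2 * T)
  obtain ⟨K₂, hK₂, hK₂0⟩ := huH.exists_isCompact hH (2 * T)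
  set K := K₁ ∪ K₂ with hKdef
  have hK : IsCompact K := hK₁.union hK₂
  have hFK : ∀ x ∉ K, ∀ t ≤ 2 * T, wF (x, t) = 0 := fun x hx t ht => by
    rcases le_or_gt 0 t with h | h
    · rw [hwFu x t h, hK₁0 x (fun h' => hx (Or.inl h')) t ⟨h, ht⟩]
    · exact hF0 x t (by linarith)
  have hHK : ∀ x ∉ K, ∀ t ≤ 2 * T, wH (x, t) = 0 := fun x hx t ht => by
    rcases le_or_gt 0 t with h | h
    · rw [hwHu x t h, hK₂0 x (fun h' => hx (Or.inr h')) t ⟨h, ht⟩]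
    · exact hH0 x t (by linarith)
  have htri : ∀ q ∈ triangle T, 0 < q.1 ∧ 0 < q.2 ∧ q.1 < 2 * T ∧ q.2 < 2 * T := by
    rintro q ⟨-, h2, -, h4, h5⟩
    exact ⟨h5, h4, by linarith, by linarith⟩
  have hV := isLocallyFiniteMeasure_volumeMeasure (m := m) (M := M)
  have hq : ∀ q ∈ triangle T, _ := fun q hq => by
    obtain ⟨h1, h2, h3, h4⟩ := htri q hq
    exact integral_wave_operator_eq hF hH huF huH hwF hwH hwFu hwHu hK h1 h2
      (fun x hx => hFK x hx _ h4.le) (fun x hx => hHK x hx _ h3.le)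
  -- the wave operator `∂ₜ² - ∂ₛ²` of `u^F(x, t) u^H(x, s)` at `q = (s, t)`
  set P : M → ℝ × ℝ → ℝ := fun x q =>
    deriv (fun s => deriv (fun s => wF (x, s)) s) q.2 * wH (x, q.1) -
      wF (x, q.2) * deriv (fun s => deriv (fun s => wH (x, s)) s) q.1 with hP
  have hwF'' := contMDiff_deriv_time (contMDiff_deriv_time hwF)
  have hwH'' := contMDiff_deriv_time (contMDiff_deriv_time hwH)
  have cP : Continuous (Function.uncurry P) := by
    have c2 : Continuous fun p : M × (ℝ × ℝ) => (p.1, p.2.2) := by fun_prop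
    have c1 : Continuous fun p : M × (ℝ × ℝ) => (p.1, p.2.1) := by fun_prop
    exact ((hwF''.continuous.comp c2).mul (hwH.continuous.comp c1)).sub
      ((hwF.continuous.comp c2).mul (hwH''.continuous.comp c1))
  have iP : Integrable (Function.uncurry P)
      ((volumeMeasure m M).prod (volume.restrict (triangle T))) := by
    refine integrable_of_continuousOn_compact
      (hK.prod ((isCompact_Icc (a := (0 : ℝ)) (b := 2 * T)).prod
        (isCompact_Icc (a := (0 : ℝ)) (b := 2 * T)))) cP.continuousOn ?_
    have h1 : (volumeMeasure m M).prod (volume.restrict (triangle T)) =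
        ((volumeMeasure m M).prod volume).restrict (univ ×ˢ triangle T) := by
      rw [← Measure.prod_restrict, Measure.restrict_univ]
    rw [h1]
    refine ae_restrict_of_forall_mem (MeasurableSet.univ.prod (measurableSet_triangle T)) ?_
    rintro ⟨x, q⟩ ⟨-, hqT⟩ hxq
    obtain ⟨h1, h2, h3, h4⟩ := htri q hqT
    have hx : x ∉ K := fun h => hxq ⟨h, ⟨h1.le, h3.le⟩, ⟨h2.le, h4.le⟩⟩
    simp [Function.uncurry, hP, hFK x hx _ h4.le, hHK x hx _ h3.le]
  have hpt : ∀ x, uF (x, T) * uH (x, T) = 1 / 2 * ∫ q in triangle T, P x q := by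
    intro x
    have hd : ∀ {w : M × ℝ → ℝ},
        ContMDiff ((𝓡∂ (m + 1)).prod 𝓘(ℝ, ℝ)) 𝓘(ℝ, ℝ) ∞ w → ∀ t,
        HasDerivAt (fun s => w (x, s)) (deriv (fun s => w (x, s)) t) t := fun hw t =>
      ((contDiff_comp_time hw x).differentiable (by simp) t).hasDerivAt
    have hwF' := contMDiff_deriv_time hwF
    have hwH' := contMDiff_deriv_time hwH
    rw [← hwFu x T hT.le, ← hwHu x T hT.le]
    refine dalembert_mul (hd hwF) (hd hwF') (contDiff_comp_time hwF'' x).continuous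
      (hd hwH) (hd hwH') (contDiff_comp_time hwH'' x).continuous (hF0 x 0 hτF.le) ?_ hT
    have h0 : (fun s => wF (x, s)) =ᶠ[nhds 0] fun _ => 0 := by
      filter_upwards [Iio_mem_nhds hτF] with s hs using hF0 x s (le_of_lt hs)
    rw [h0.deriv_eq, deriv_const]
  have hsw : ∀ q ∈ triangle T, ∫ x, P x q ∂volumeMeasure m M =
      ∫ x, boundaryPairing m F H q x ∂surfaceMeasure m M := fun q h => (hq q h).2
  refine ⟨?_, fun q h => (hq q h).1, ?_, ?_⟩
  · have h1 : (fun x => uF (x, T) * uH (x, T)) = fun x => wF (x, T) * wH (x, T) :=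
      funext fun x => by rw [hwFu x T hT.le, hwHu x T hT.le]
    rw [h1]
    refine integrable_of_continuousOn_compact hK ((contMDiff_slice hwF T).continuous.mul
      (contMDiff_slice hwH T).continuous).continuousOn (Eventually.of_forall fun x hx => ?_)
    rw [hFK x hx T (by linarith), zero_mul]
  · exact IntegrableOn.congr_fun iP.integral_prod_right hsw (measurableSet_triangle T)
  · simp_rw [hpt]
    rw [integral_const_mul, integral_integral_swap iP,
      setIntegral_congr_fun (measurableSet_triangle T) hsw]
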